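/- Let $\mathcal{G}=(V,E)$ be a connected metric graph with finitely many vertices and edges (self-loops and multiple edges allowed), where each bounded edge is identified with a compact interval of positive length and each unbounded edge with a half-line $[0,+\infty)$, and suppose that $\mathcal{G}$ is non-compact, i.e. that at least one edge is a half-line. Let $H^1(\mathcal{G})$ be the space of continuous (real- or complex-valued) functions on $\mathcal{G}$ whose restriction to each edge belongs to $H^1$ of that edge. Let $2<p<6$ and $2<q<4$, and for $u\in H^1(\mathcal{G})$ put $$F_{p,q}(u,\mathcal{G})=\frac12\int_{\mathcal{G}}|u'|^2\,dx-\frac1p\int_{\mathcal{G}}|u|^p\,dx-\frac1q\sum_{v\in V}|u(v)|^q .$$ For $\mu>0$, a ground state of $F_{p,q}$ at mass $\mu$ is a global minimizer of $F_{p,q}(\cdot,\mathcal{G})$ over $H^1_\mu(\mathcal{G})=\{u\in H^1(\mathcal{G}) : \int_{\mathcal{G}}|u|^2\,dx=\mu\}$. Assume that $\mathcal{G}$ has at least one vertex of degree $2$, the degree of a vertex being the number of edge ends attached to it (a self-loop counts twice). Then there exists $\widetilde\mu_{p,q}>0$, depending only on $p$, $q$ and $\mathcal{G}$, such that a ground state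 of $F_{p,q}$ at mass $\mu$ exists for every $\mu\ge\widetilde\mu_{p,q}$. -/

import Mathlib

/-- A metric graph with finitely many vertices `V`, bounded edges `B` and half-lines `H`
(finiteness is imposed through `Fintype` instances). The bounded edge `e` is identified with the
interval `[0, len e]`, the endpoint `0` being glued to `src e` and `len e` to `tgt e`; the half-line
`h` is identified with `[0, ∞)`, its endpoint `0` being glued to `base h`. Self-loops and multiple
edges are allowed. -/
structure MetricGraph (V B H : Type*) where
  /-- vertex glued to the endpoint `0` of a bounded edge -/
  src : B → V
  /-- vertex glued to the endpoint `len e` of a bounded edge -/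
  tgt : B → V
  /-- length of a bounded edge -/
  len : B → ℝ
  len_pos : ∀ e, 0 < len e
  /-- vertex glued to the endpoint `0` of a half-line -/
  base : H → V

/-- A function on a metric graph: its values at the vertices, and its expression in the
coordinate of each edge. Only the values of `edge e` on `[0, len e]` and of `ray h` on `[0, ∞)`
matter. -/
structure GraphFunction (V B H 𝕜 : Type*) where
  /-- values at the vertices -/
  vertex : V → 𝕜
  /-- restriction to the bounded edges -/
  edge : B → ℝ → 𝕜
  /-- restriction to the half-lines -/
  ray : H → ℝ → 𝕜

namespace MetricGraph

variable {V B H 𝕜 : Type*}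

/-- The graph is connected: any two vertices are joined by a path of bounded edges. -/
def IsConnected (G : MetricGraph V B H) : Prop :=
  ∀ v w : V, Relation.EqvGen (fun a b => ∃ e, G.src e = a ∧ G.tgt e = b) v w

/-- The degree of a vertex: the number of edge ends attached to it (so a self-loop counts
twice). -/
noncomputable def degree (G : MetricGraph V B H) (v : V) : ℕ :=
  Nat.card {e : B // G.src e = v} + Nat.card {e : B // G.tgt e = v} +
    Nat.card {h : H // G.base h = v}

variable [RCLike 𝕜]

/-- Membership in the Sobolev space `H¹` of the graph: `u` is continuous on the graph, and on each
edge it is (the continuous representative of) an `H¹` function, that is, it is square integrable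
and absolutely continuous on the compact subintervals of the edge, with square integrable
derivative. -/
structure MemH1 (G : MetricGraph V B H) (u : GraphFunction V B H 𝕜) : Prop where
  edge_src : ∀ e, u.edge e 0 = u.vertex (G.src e)
  edge_tgt : ∀ e, u.edge e (G.len e) = u.vertex (G.tgt e)
  ray_base : ∀ h, u.ray h 0 = u.vertex (G.base h)
  edge_ac : ∀ e, AbsolutelyContinuousOnInterval (u.edge e) 0 (G.len e)
  ray_ac : ∀ h, ∀ R : ℝ, 0 < R → AbsolutelyContinuousOnInterval (u.ray h) 0 R
  edge_memLp : ∀ e, MeasureTheory.MemLp (u.edge e) 2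
    (MeasureTheory.volume.restrict (Set.Ioo 0 (G.len e)))
  ray_memLp : ∀ h, MeasureTheory.MemLp (u.ray h) 2
    (MeasureTheory.volume.restrict (Set.Ioi 0))
  edge_deriv_memLp : ∀ e, MeasureTheory.MemLp (deriv (u.edge e)) 2
    (MeasureTheory.volume.restrict (Set.Ioo 0 (G.len e)))
  ray_deriv_memLp : ∀ h, MeasureTheory.MemLp (deriv (u.ray h)) 2
    (MeasureTheory.volume.restrict (Set.Ioi 0))

variable [Fintype V] [Fintype B] [Fintype H]

/-- The integral over the graph of `|u| ^ r`. -/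
noncomputable def powerIntegral (G : MetricGraph V B H) (r : ℝ) (u : GraphFunction V B H 𝕜) : ℝ :=
  (∑ e, ∫ x in Set.Ioo 0 (G.len e), ‖u.edge e x‖ ^ r) + ∑ h, ∫ x in Set.Ioi 0, ‖u.ray h x‖ ^ r

/-- The mass of `u`, the integral over the graph of `|u| ^ 2`. -/
noncomputable def mass (G : MetricGraph V B H) (u : GraphFunction V B H 𝕜) : ℝ :=
  (∑ e, ∫ x in Set.Ioo 0 (G.len e), ‖u.edge e x‖ ^ 2) + ∑ h, ∫ x in Set.Ioi 0, ‖u.ray h x‖ ^ 2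

/-- The integral over the graph of `|u'| ^ 2`. -/
noncomputable def kinetic (G : MetricGraph V B H) (u : GraphFunction V B H 𝕜) : ℝ :=
  (∑ e, ∫ x in Set.Ioo 0 (G.len e), ‖deriv (u.edge e) x‖ ^ 2) +
    ∑ h, ∫ x in Set.Ioi 0, ‖deriv (u.ray h) x‖ ^ 2

/-- The doubly nonlinear Schrödinger energy
`F_{p,q}(u, G) = 1/2 ∫ |u'|^2 - 1/p ∫ |u|^p - 1/q ∑_v |u(v)|^q`. -/
noncomputable def energy (G : MetricGraph V B H) (p q : ℝ) (u : GraphFunction V B H 𝕜) : ℝ :=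
  1 / 2 * G.kinetic u - 1 / p * G.powerIntegral p u - 1 / q * ∑ v, ‖u.vertex v‖ ^ q

/-- `u` is a ground state of `F_{p,q}` at mass `μ`: a global minimizer of the energy among the
`H¹` functions of mass `μ`. -/
def IsGroundState (G : MetricGraph V B H) (p q μ : ℝ) (u : GraphFunction V B H 𝕜) : Prop :=
  G.MemH1 u ∧ G.mass u = μ ∧
    ∀ w : GraphFunction V B H 𝕜, G.MemH1 w → G.mass w = μ → G.energy p q u ≤ G.energy p q w

end MetricGraph

/-! The proof compares the graph with the line. On the line, without vertex terms, the least energy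
at mass 1 is some `e < 0`. The dilation that multiplies mass by `μ` multiplies energy by `μ ^ s`, `s
= (p + 2) / (6 - p)`, so the level at mass `μ` is `e * μ ^ s`.

Existence below this level. Since `p < 6` and `q < 4`, a minimizing sequence on the graph is bounded
in H¹ (`Covered.exists_coercive`), and a subsequence converges pointwise to some `U` in such a way
that Dirichlet and power integrals split (`Covered.exists_isLimit`). If `U = 0`, the sequence leaves
every bounded part of the graph along the half-lines and its energy is asymptotically at least `e *
μ ^ s` (`Covered.le_of_isLimit_of_mass_eq_zero`). If `U ≠ 0`, then since multiplying a function by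
`c ≥ 1` multiplies its energy by at most `c ^ 2`, the remainder carries at least its proportional
share of the infimum, so `U` carries at most its own, and `U` rescaled to mass `μ` is a minimizer
(`Covered.exists_minimizer_of_isLimit`). The same lemmas, applied to the line regarded as a graph
and combined with translations, give the minimizer at level `e` (`exists_line_minimizer`); no
explicit soliton is needed.

A competitor strictly below the level (`exists_energy_lt`). The line minimizer at mass `μ` lives at
scale `μ ^ (-β)`, `β = (p - 2) / (6 - p)`. Cut off at a fixed distance `r` from its centre, it fits
around a vertex of degree 2, where a neighbourhood looks like an interval of the line. At mass 1 the
cut is made at `L = r * μ ^ β` and costs `O(L⁻²)` (`LinePair.exists_truncation`), that is, `O(μ)`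
after dilation. The vertex term gains a multiple of `μ ^ (2 * q / (6 - p))`, and this exponent
exceeds 1 because `2 * q > 4 > 6 - p`. For large `μ` the gain wins. This crude truncation needs only
that the minimizer tends to zero at infinity, not exponential decay. -/

open MeasureTheory Set Filter Topology

/-! ### Absolutely continuous functions with vector values -/

section AbsolutelyContinuous

variable {E : Type*} [NormedAddCommGroup E] [NormedSpace ℝ E]

theorem AbsolutelyContinuousOnInterval.of_dist_le {X Y : Type*} [PseudoMetricSpace X]
    [PseudoMetricSpace Y] {f : ℝ → X} {g : ℝ → Y} {a b : ℝ}
    (hg : AbsolutelyContinuousOnInterval g a b)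
    (h : ∀ x ∈ uIcc a b, ∀ y ∈ uIcc a b, dist (f x) (f y) ≤ dist (g x) (g y)) :
    AbsolutelyContinuousOnInterval f a b := by
  rw [absolutelyContinuousOnInterval_iff] at hg ⊢
  intro ε hε
  obtain ⟨δ, hδ, H⟩ := hg ε hε
  refine ⟨δ, hδ, fun E hE hE' => lt_of_le_of_lt (Finset.sum_le_sum fun i hi => ?_) (H E hE hE')⟩
  exact h _ (hE.1 i hi).1 _ (hE.1 i hi).2

/-- Increments are dominated by those of the scalar primitive of `‖g‖`. -/
theorem IntervalIntegrable.absolutelyContinuousOnInterval_integral {g : ℝ → E} {a b : ℝ}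
    (hg : IntervalIntegrable g volume a b) :
    AbsolutelyContinuousOnInterval (fun x => ∫ t in a..x, g t) a b := by
  refine AbsolutelyContinuousOnInterval.of_dist_le
    (hg.norm.absolutelyContinuousOnInterval_intervalIntegral (c := a) left_mem_uIcc) ?_
  intro x hx y hy
  have h1 : ∀ z ∈ uIcc a b, IntervalIntegrable g volume a z := fun z hz =>
    hg.mono_set (uIcc_subset_uIcc left_mem_uIcc hz)
  rw [dist_eq_norm, dist_eq_norm, intervalIntegral.integral_interval_sub_left (h1 x hx) (h1 y hy),
    intervalIntegral.integral_interval_sub_left (h1 x hx).norm (h1 y hy).norm]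
  exact intervalIntegral.norm_integral_le_abs_integral_norm

/-- Subtracting the primitive of `deriv f` leaves an absolutely continuous function with zero
derivative almost everywhere, hence a constant. -/
theorem AbsolutelyContinuousOnInterval.sub_eq_integral_deriv [FiniteDimensional ℝ E] {f : ℝ → E}
    {a b : ℝ} (hf : AbsolutelyContinuousOnInterval f a b)
    (hi : IntervalIntegrable (deriv f) volume a b) :
    ∫ t in a..b, deriv f t = f b - f a := by
  have g_ac : AbsolutelyContinuousOnInterval (fun x => f x - ∫ t in a..x, deriv f t) a b :=
    hf.sub hi.absolutelyContinuousOnInterval_integral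
  obtain ⟨C, hC⟩ := g_ac.const_of_ae_hasDerivAt_zero (by
    filter_upwards [hf.boundedVariationOn.ae_differentiableAt_of_mem_uIcc,
      hi.ae_hasDerivAt_integral] with x hx₁ hx₂ hx₃
    have := (hx₁ hx₃).hasDerivAt.sub (hx₂ hx₃ a (by simp))
    rwa [sub_self] at this)
  have h1 := hC a (by simp)
  have h2 := hC b (by simp)
  simp only [intervalIntegral.integral_same, sub_zero] at h1
  rw [← h1] at h2
  rw [← h2]; abel

end AbsolutelyContinuous

/-- Nonnegativity of the variance of `h` about its mean `c`. -/
theorem MeasureTheory.MemLp.sq_integral_le {α : Type*} {m : MeasurableSpace α} {μ : Measure α}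
    [IsFiniteMeasure μ] {h : α → ℝ} (hh : MemLp h 2 μ) :
    (∫ x, h x ∂μ) ^ 2 ≤ μ.real univ * ∫ x, h x ^ 2 ∂μ := by
  have hi : Integrable h μ := hh.integrable (by norm_num)
  have hi2 : Integrable (fun x => h x ^ 2) μ := hh.integrable_sq
  rcases eq_or_lt_of_le (measureReal_nonneg (μ := μ) (s := univ)) with h0 | h0
  · have : μ = 0 := by
      rw [← Measure.measure_univ_eq_zero]
      rwa [eq_comm, measureReal_eq_zero_iff] at h0
    simp [this]
  · set c := (∫ x, h x ∂μ) / μ.real univ with hc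
    have hnn : 0 ≤ ∫ x, (h x - c) ^ 2 ∂μ := integral_nonneg fun x => sq_nonneg _
    have he : ∫ x, (h x - c) ^ 2 ∂μ
        = ∫ x, h x ^ 2 ∂μ - 2 * c * ∫ x, h x ∂μ + c ^ 2 * μ.real univ := by
      have : ∀ x, (h x - c) ^ 2 = h x ^ 2 - 2 * c * h x + c ^ 2 := fun x => by ring
      simp_rw [this]
      rw [integral_add (by exact hi2.sub (hi.const_mul _)) (integrable_const _),
        integral_sub hi2 (hi.const_mul (2 * c)), integral_const_mul, integral_const, smul_eq_mul]
      ring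
    rw [he] at hnn
    have hI : ∫ x, h x ∂μ = c * μ.real univ := by rw [hc]; field_simp
    rw [hI] at hnn ⊢
    nlinarith

/-! ### H¹ functions on a single edge -/

section

variable {𝕜 : Type*} [RCLike 𝕜]

/-- `D` is a domain of an edge of length at least `ℓ`. -/
def IsEdgeDomain (ℓ : ℝ) (D : Set ℝ) : Prop := (∃ b, ℓ ≤ b ∧ D = Icc 0 b) ∨ D = Ici 0

/-- `f` is in `H¹(D)` with weak derivative `g`. -/
structure H1On (D : Set ℝ) (f g : ℝ → 𝕜) : Prop where
  eq_integral : ∀ x ∈ D, f x = f 0 + ∫ t in (0 : ℝ)..x, g t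
  memLp : MemLp f 2 (volume.restrict D)
  deriv_memLp : MemLp g 2 (volume.restrict D)

namespace IsEdgeDomain

variable {ℓ : ℝ} {D : Set ℝ}

theorem measurableSet (h : IsEdgeDomain ℓ D) : MeasurableSet D := by
  rcases h with ⟨b, -, rfl⟩ | rfl
  exacts [measurableSet_Icc, measurableSet_Ici]

theorem nonneg (h : IsEdgeDomain ℓ D) {x : ℝ} (hx : x ∈ D) : 0 ≤ x := by
  rcases h with ⟨b, -, rfl⟩ | rfl
  exacts [hx.1, hx]

theorem zero_mem (h : IsEdgeDomain ℓ D) (hℓ : 0 ≤ ℓ) : (0 : ℝ) ∈ D := by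
  rcases h with ⟨b, hb, rfl⟩ | rfl
  exacts [⟨le_rfl, hℓ.trans hb⟩, self_mem_Ici]

theorem Icc_subset (h : IsEdgeDomain ℓ D) {x y : ℝ} (hx : x ∈ D) (hy : y ∈ D) : Icc x y ⊆ D := by
  rcases h with ⟨b, -, rfl⟩ | rfl
  · exact Icc_subset_Icc hx.1 hy.2
  · exact Icc_subset_Ici_self.trans (Ici_subset_Ici.2 hx)

theorem uIcc_subset (h : IsEdgeDomain ℓ D) {x y : ℝ} (hx : x ∈ D) (hy : y ∈ D) : uIcc x y ⊆ D := by
  rcases le_total x y with hxy | hxy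
  · rw [uIcc_of_le hxy]; exact h.Icc_subset hx hy
  · rw [uIcc_of_ge hxy]; exact h.Icc_subset hy hx

theorem exists_window (h : IsEdgeDomain ℓ D) {x r : ℝ} (hx : x ∈ D) (hr : 0 ≤ r) (hrℓ : r ≤ ℓ) :
    ∃ a, x ∈ Icc a (a + r) ∧ Icc a (a + r) ⊆ D := by
  rcases h with ⟨b, hb, rfl⟩ | rfl
  · rcases le_total (x + r) b with hxb | hxb
    · exact ⟨x, ⟨le_rfl, by linarith⟩, Icc_subset_Icc hx.1 hxb⟩
    · refine ⟨b - r, ⟨by linarith, by linarith [hx.2]⟩, Icc_subset_Icc (by linarith) (by linarith)⟩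
  · exact ⟨x, ⟨le_rfl, by linarith⟩, Icc_subset_Ici_self.trans (Ici_subset_Ici.2 hx)⟩

theorem ae_mem_nhds (h : IsEdgeDomain ℓ D) : ∀ᵐ x ∂(volume.restrict D), D ∈ 𝓝 x := by
  rcases h with ⟨b, -, rfl⟩ | rfl
  · rw [← restrict_Ioo_eq_restrict_Icc]
    filter_upwards [ae_restrict_mem measurableSet_Ioo] with x hx using Icc_mem_nhds hx.1 hx.2
  · rw [← restrict_Ioi_eq_restrict_Ici]
    filter_upwards [ae_restrict_mem measurableSet_Ioi] with x hx using Ici_mem_nhds hx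

end IsEdgeDomain

namespace H1On

variable {ℓ : ℝ} {D : Set ℝ} {f g f' g' : ℝ → 𝕜}

theorem intervalIntegrable_of_memLp (hD : IsEdgeDomain ℓ D) (hg : MemLp g 2 (volume.restrict D))
    {x y : ℝ} (hx : x ∈ D) (hy : y ∈ D) : IntervalIntegrable g volume x y := by
  rw [intervalIntegrable_iff]
  have hs : uIoc x y ⊆ D := uIoc_subset_uIcc.trans (hD.uIcc_subset hx hy)
  have h1 : MemLp g 2 (volume.restrict (uIoc x y)) := hg.mono_measure (Measure.restrict_mono_set _ hs)
  have : IsFiniteMeasure (volume.restrict (uIoc x y)) := by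
    unfold uIoc; infer_instance
  exact h1.integrable (by norm_num)

theorem intervalIntegrable (hD : IsEdgeDomain ℓ D) (h : H1On D f g) {x y : ℝ} (hx : x ∈ D)
    (hy : y ∈ D) : IntervalIntegrable g volume x y :=
  intervalIntegrable_of_memLp hD h.deriv_memLp hx hy

theorem sub_eq (hD : IsEdgeDomain ℓ D) (hℓ : 0 ≤ ℓ) (h : H1On D f g) {x y : ℝ} (hx : x ∈ D)
    (hy : y ∈ D) : f y - f x = ∫ t in x..y, g t := by
  have h0 := hD.zero_mem hℓ
  rw [h.eq_integral x hx, h.eq_integral y hy, ← intervalIntegral.integral_interval_sub_left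
    (h.intervalIntegrable hD h0 hy) (h.intervalIntegrable hD h0 hx)]
  abel

theorem of_ac (hD : IsEdgeDomain ℓ D) (hℓ : 0 ≤ ℓ)
    (hf : ∀ x ∈ D, AbsolutelyContinuousOnInterval f 0 x)
    (h1 : MemLp f 2 (volume.restrict D)) (h2 : MemLp (deriv f) 2 (volume.restrict D)) :
    H1On D f (deriv f) where
  eq_integral x hx := by
    rw [(hf x hx).sub_eq_integral_deriv
      (intervalIntegrable_of_memLp hD h2 (hD.zero_mem hℓ) hx)]
    abel
  memLp := h1
  deriv_memLp := h2

theorem ac (hD : IsEdgeDomain ℓ D) (hℓ : 0 ≤ ℓ) (h : H1On D f g) {x : ℝ} (hx : x ∈ D) :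
    AbsolutelyContinuousOnInterval f 0 x := by
  have h0 := hD.zero_mem hℓ
  refine (h.intervalIntegrable hD h0 hx).absolutelyContinuousOnInterval_integral.of_dist_le ?_
  intro y hy z hz
  rw [h.eq_integral y (hD.uIcc_subset h0 hx hy), h.eq_integral z (hD.uIcc_subset h0 hx hz)]
  simp

/-- Lebesgue differentiation, applied to `g` extended by zero so that it is locally integrable on
the whole line. -/
theorem hasDerivAt_ae (hD : IsEdgeDomain ℓ D) (hℓ : 0 ≤ ℓ) (h : H1On D f g) :
    ∀ᵐ x ∂(volume.restrict D), HasDerivAt f (g x) x := by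
  have hloc : LocallyIntegrable (D.indicator g) volume := by
    rw [locallyIntegrable_iff]
    intro K hK
    obtain ⟨a, ha⟩ := hK.isBounded.subset_closedBall (0:ℝ)
    refine IntegrableOn.mono_set ?_ ha
    rw [IntegrableOn]
    have : MemLp (D.indicator g) 2 (volume.restrict (Metric.closedBall 0 a)) := by
      have := (memLp_indicator_iff_restrict (p := 2) hD.measurableSet).2 h.deriv_memLp
      exact this.restrict _
    have : IsFiniteMeasure (volume.restrict (Metric.closedBall (0:ℝ) a)) :=
      ⟨by simpa using ENNReal.mul_lt_top (by simp) ENNReal.ofReal_lt_top⟩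
    exact MemLp.integrable (q := 2) (by norm_num) ‹_›
  filter_upwards [hD.ae_mem_nhds, ae_restrict_mem hD.measurableSet,
    ae_restrict_of_ae (LocallyIntegrable.ae_hasDerivAt_integral hloc)] with x hx hxD hder
  have h1 := (hder 0).const_add (f 0)
  rw [indicator_of_mem hxD] at h1
  refine h1.congr_of_eventuallyEq ?_
  filter_upwards [hx] with y hy
  rw [h.eq_integral y hy]
  congr 1
  refine intervalIntegral.integral_congr fun t ht => ?_
  exact (indicator_of_mem (hD.uIcc_subset (hD.zero_mem hℓ) hy ht) g).symm

theorem deriv_ae_eq (hD : IsEdgeDomain ℓ D) (hℓ : 0 ≤ ℓ) (h : H1On D f g) :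
    deriv f =ᵐ[volume.restrict D] g := by
  filter_upwards [h.hasDerivAt_ae hD hℓ] with x hx using hx.deriv

theorem sub (hD : IsEdgeDomain ℓ D) (hℓ : 0 ≤ ℓ) (h : H1On D f g) (h' : H1On D f' g') :
    H1On D (fun x => f x - f' x) (fun x => g x - g' x) where
  eq_integral x hx := by
    have h0 := hD.zero_mem hℓ
    rw [h.eq_integral x hx, h'.eq_integral x hx, intervalIntegral.integral_sub
      (h.intervalIntegrable hD h0 hx) (h'.intervalIntegrable hD h0 hx)]
    abel
  memLp := h.memLp.sub h'.memLp
  deriv_memLp := h.deriv_memLp.sub h'.deriv_memLp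

theorem add (hD : IsEdgeDomain ℓ D) (hℓ : 0 ≤ ℓ) (h : H1On D f g) (h' : H1On D f' g') :
    H1On D (fun x => f x + f' x) (fun x => g x + g' x) where
  eq_integral x hx := by
    have h0 := hD.zero_mem hℓ
    rw [h.eq_integral x hx, h'.eq_integral x hx, intervalIntegral.integral_add
      (h.intervalIntegrable hD h0 hx) (h'.intervalIntegrable hD h0 hx)]
    abel
  memLp := h.memLp.add h'.memLp
  deriv_memLp := h.deriv_memLp.add h'.deriv_memLp

theorem const_mul (c : 𝕜) (h : H1On D f g) : H1On D (fun x => c * f x) (fun x => c * g x) where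
  eq_integral x hx := by
    rw [h.eq_integral x hx, intervalIntegral.integral_const_mul]
    ring
  memLp := h.memLp.const_mul c
  deriv_memLp := h.deriv_memLp.const_mul c

theorem norm_integral_sq_le (hD : IsEdgeDomain ℓ D) (hg : MemLp g 2 (volume.restrict D))
    {x y : ℝ} (hx : x ∈ D) (hy : y ∈ D) :
    ‖∫ t in x..y, g t‖ ^ 2 ≤ |y - x| * ∫ t in D, ‖g t‖ ^ 2 := by
  have hs : uIoc x y ⊆ D := uIoc_subset_uIcc.trans (hD.uIcc_subset hx hy)
  have hfin : IsFiniteMeasure (volume.restrict (uIoc x y)) := by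
    unfold uIoc; infer_instance
  have h1 : MemLp (fun t => ‖g t‖) 2 (volume.restrict (uIoc x y)) :=
    (hg.mono_measure (Measure.restrict_mono_set _ hs)).norm
  have hm : (volume.restrict (uIoc x y)).real univ = |y - x| := by
    simp [Measure.real, uIoc, max_sub_min_eq_abs']
    rw [abs_sub_comm]
  have h2 := h1.sq_integral_le
  rw [hm] at h2
  calc ‖∫ t in x..y, g t‖ ^ 2 ≤ (∫ t in uIoc x y, ‖g t‖) ^ 2 := by
        gcongr; exact intervalIntegral.norm_integral_le_integral_norm_uIoc
    _ ≤ |y - x| * ∫ t in uIoc x y, ‖g t‖ ^ 2 := h2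
    _ ≤ |y - x| * ∫ t in D, ‖g t‖ ^ 2 := by
        exact mul_le_mul_of_nonneg_left (setIntegral_mono_set
          ((memLp_two_iff_integrable_sq_norm hg.1).1 hg)
          (Eventually.of_forall fun t => by positivity) (LE.le.eventuallyLE hs)) (abs_nonneg _)

/-- Sobolev bound at a free scale `r`: in a window of length `r` around `x`, some point has `‖f‖ ^
2` at most its average, and the oscillation over the window is controlled by Cauchy–Schwarz. Leaving
`r` free serves three purposes: optimized, it gives a Gagliardo–Nirenberg inequality; fixed, a
uniform bound; sent to zero, the vanishing of functions of zero mass. -/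
theorem norm_le (hD : IsEdgeDomain ℓ D) (hℓ : 0 ≤ ℓ) (h : H1On D f g) {x r : ℝ} (hx : x ∈ D)
    (hr : 0 < r) (hrℓ : r ≤ ℓ) :
    ‖f x‖ ≤ √((∫ t in D, ‖f t‖ ^ 2) / r) + √(r * ∫ t in D, ‖g t‖ ^ 2) := by
  obtain ⟨a, hxa, haD⟩ := hD.exists_window hx hr.le hrℓ
  have hf2 : IntegrableOn (fun t => ‖f t‖ ^ 2) D := (memLp_two_iff_integrable_sq_norm h.memLp.1).1 h.memLp
  have hvol : volume.real (Icc a (a + r)) = r := by simp [Measure.real, hr.le]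
  obtain ⟨y, hy, hyle⟩ := exists_le_setAverage (μ := volume) (s := Icc a (a + r))
    (f := fun t => ‖f t‖ ^ 2) (by simp [hr]) (by simp) (hf2.mono_set haD)
  have h1 : ‖f y‖ ≤ √((∫ t in D, ‖f t‖ ^ 2) / r) := by
    refine Real.le_sqrt_of_sq_le (hyle.trans ?_)
    rw [setAverage_eq, hvol, smul_eq_mul, div_eq_inv_mul]
    exact mul_le_mul_of_nonneg_left (setIntegral_mono_set hf2
      (Eventually.of_forall fun t => by positivity) (LE.le.eventuallyLE haD)) (by positivity)
  have h2 : ‖f x - f y‖ ≤ √(r * ∫ t in D, ‖g t‖ ^ 2) := by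
    rw [h.sub_eq hD hℓ (haD hy) hx]
    refine Real.le_sqrt_of_sq_le ((norm_integral_sq_le hD h.deriv_memLp (haD hy) hx).trans ?_)
    have : |x - y| ≤ r := by
      rw [abs_le]; constructor <;> linarith [hxa.1, hxa.2, hy.1, hy.2]
    gcongr
  calc ‖f x‖ = ‖f y + (f x - f y)‖ := by congr 1; abel
    _ ≤ _ := (norm_add_le _ _).trans (add_le_add h1 h2)

end H1On

end

/-! ### Weak sequential compactness in L² -/

section WeakCompactness

variable {𝕜 : Type*} [RCLike 𝕜]

/-- Sequential Banach–Alaoglu in the dual, carried back by the Riesz isometry. -/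
theorem exists_subseq_tendsto_inner {H : Type*} [NormedAddCommGroup H] [InnerProductSpace 𝕜 H]
    [CompleteSpace H] [TopologicalSpace.SeparableSpace H] (x : ℕ → H) {C : ℝ}
    (hx : ∀ n, ‖x n‖ ≤ C) :
    ∃ (y : H) (φ : ℕ → ℕ), StrictMono φ ∧
      ∀ z, Tendsto (fun n => inner 𝕜 (x (φ n)) z) atTop (𝓝 (inner 𝕜 y z)) := by
  obtain ⟨l, -, φ, hφ, hl⟩ := WeakDual.isSeqCompact_closedBall 𝕜 H 0 C
    (x := fun n => StrongDual.toWeakDual (InnerProductSpace.toDual 𝕜 H (x n)))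
    (fun n => by simpa using hx n)
  refine ⟨(InnerProductSpace.toDual 𝕜 H).symm (WeakDual.toStrongDual l), φ, hφ, fun z => ?_⟩
  rw [InnerProductSpace.toDual_symm_apply]
  exact ((WeakDual.eval_continuous z).tendsto l).comp hl

theorem MeasureTheory.MemLp.norm_toLp_sq {α : Type*} {m : MeasurableSpace α} {μ : Measure α}
    {g : α → 𝕜} (hg : MemLp g 2 μ) : ‖hg.toLp g‖ ^ 2 = ∫ x, ‖g x‖ ^ 2 ∂μ := by
  rw [← RCLike.ofReal_inj (K := 𝕜)]
  push_cast
  rw [← inner_self_eq_norm_sq_to_K (𝕜 := 𝕜), L2.inner_def, ← integral_ofReal]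
  refine integral_congr_ae ?_
  filter_upwards [hg.coeFn_toLp] with x hx
  rw [hx, inner_self_eq_norm_sq_to_K]
  push_cast; rfl

theorem exists_subseq_tendsto_integral_inner {α : Type*} {m : MeasurableSpace α} {μ : Measure α}
    [IsSeparable μ] (g : ℕ → α → 𝕜) (hg : ∀ n, MemLp (g n) 2 μ) {K : ℝ}
    (hK : ∀ n, ∫ x, ‖g n x‖ ^ 2 ∂μ ≤ K) :
    ∃ (g' : α → 𝕜) (φ : ℕ → ℕ), MemLp g' 2 μ ∧ StrictMono φ ∧
      ∀ h : α → 𝕜, MemLp h 2 μ → Tendsto (fun n => ∫ x, inner 𝕜 (h x) (g (φ n) x) ∂μ) atTop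
        (𝓝 (∫ x, inner 𝕜 (h x) (g' x) ∂μ)) := by
  have : Fact ((2 : ENNReal) ≠ ⊤) := ⟨by norm_num⟩
  obtain ⟨y, φ, hφ, hy⟩ := exists_subseq_tendsto_inner (𝕜 := 𝕜) (fun n => (hg n).toLp (g n))
    (C := √K) (fun n => Real.le_sqrt_of_sq_le ((hg n).norm_toLp_sq.trans_le (hK n)))
  refine ⟨y, φ, Lp.memLp y, hφ, fun h hh => ?_⟩
  have := (RCLike.continuous_conj (K := 𝕜)).tendsto _ |>.comp (hy (hh.toLp h))
  simp only [Function.comp_def, inner_conj_symm] at this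
  convert this using 1
  · ext n
    rw [L2.inner_def]
    refine integral_congr_ae ?_
    filter_upwards [hh.coeFn_toLp, (hg (φ n)).coeFn_toLp] with x h1 h2
    rw [h1, h2]
  · rw [L2.inner_def]
    congr 1
    refine integral_congr_ae ?_
    filter_upwards [hh.coeFn_toLp] with x h1
    rw [h1]

/-- Successive extraction, one index at a time; `hmono` keeps the properties already obtained. -/
theorem exists_subseq_forall_finite {ι : Type*} [Finite ι] (P : ι → (ℕ → ℕ) → Prop)
    (hmono : ∀ i (φ ψ : ℕ → ℕ), StrictMono ψ → P i φ → P i (φ ∘ ψ))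
    (hex : ∀ i (φ : ℕ → ℕ), StrictMono φ → ∃ ψ : ℕ → ℕ, StrictMono ψ ∧ P i (φ ∘ ψ)) :
    ∃ φ : ℕ → ℕ, StrictMono φ ∧ ∀ i, P i φ := by
  classical
  have := Fintype.ofFinite ι
  suffices ∀ s : Finset ι, ∃ φ : ℕ → ℕ, StrictMono φ ∧ ∀ i ∈ s, P i φ by
    simpa using this Finset.univ
  intro s
  induction s using Finset.induction with
  | empty => exact ⟨id, strictMono_id, by simp⟩
  | insert a s _ ih =>
    obtain ⟨φ, hφ, h⟩ := ih
    obtain ⟨ψ, hψ, h'⟩ := hex a φ hφ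
    refine ⟨φ ∘ ψ, hφ.comp hψ, fun i hi => ?_⟩
    rcases Finset.mem_insert.1 hi with rfl | hi
    exacts [h', hmono _ _ _ hψ (h i hi)]

end WeakCompactness

/-! ### Splitting of integrals along converging sequences -/

section Splitting

/-- Convexity: the tangent at `x` lies below the graph. It is Bernoulli's inequality at `y / x`. -/
theorem Real.rpow_sub_rpow_le {r x y : ℝ} (hr : 1 ≤ r) (hx : 0 ≤ x) (hy : 0 ≤ y) :
    x ^ r - y ^ r ≤ r * x ^ (r - 1) * (x - y) := by
  rcases hx.eq_or_lt with rfl | hx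
  · rcases eq_or_lt_of_le hr with rfl | hr'
    · simp
    · rw [Real.zero_rpow (by linarith), Real.zero_rpow (by linarith)]
      have := Real.rpow_nonneg hy r
      simpa
  · have h1 := one_add_mul_self_le_rpow_one_add (s := y / x - 1) (by
      have := div_nonneg hy hx.le
      linarith) hr
    rw [show 1 + (y / x - 1) = y / x by ring, Real.div_rpow hy hx.le, le_div_iff₀ (by positivity)] at h1
    have h2 : x ^ r = x ^ (r - 1) * x := by
      rw [← Real.rpow_add_one hx.ne']; congr 1; ring
    have h3 : (1 + r * (y / x - 1)) * x ^ r = x ^ r - r * x ^ (r - 1) * (x - y) := by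
      rw [h2]; field_simp; ring
    linarith

theorem Real.abs_rpow_sub_rpow_le {r x y z : ℝ} (hr : 1 ≤ r) (hx : 0 ≤ x) (hy : 0 ≤ y)
    (hxz : x ≤ z) (hyz : y ≤ z) : |x ^ r - y ^ r| ≤ r * z ^ (r - 1) * |x - y| := by
  have key : ∀ {x y : ℝ}, 0 ≤ x → 0 ≤ y → x ≤ z → y ≤ x →
      |x ^ r - y ^ r| ≤ r * z ^ (r - 1) * |x - y| := by
    intro x y hx hy hxz hyx
    rw [abs_of_nonneg (sub_nonneg.2 (Real.rpow_le_rpow hy hyx (by linarith))),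
      abs_of_nonneg (sub_nonneg.2 hyx)]
    refine (Real.rpow_sub_rpow_le hr hx hy).trans ?_
    have : x ^ (r - 1) ≤ z ^ (r - 1) := Real.rpow_le_rpow hx hxz (by linarith)
    have := sub_nonneg.2 hyx
    gcongr
  rcases le_total y x with h | h
  · exact key hx hy hxz h
  · rw [abs_sub_comm, abs_sub_comm x]; exact key hy hx hyz h

/-- With `‖b‖ ≤ ‖a‖`, replacing `a + b` by `a` costs a multiple of `‖a‖ ^ (r - 1) * ‖b‖`, and `‖b‖ ^
r ≤ ‖b‖ ^ (r - 2) * ‖a‖ * ‖b‖`. The error in Brezis–Lieb is thus a single product `‖a‖ * ‖b‖`. -/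
theorem abs_norm_add_rpow_sub_le {E : Type*} [NormedAddCommGroup E] {r M : ℝ} (hr : 2 ≤ r)
    (a b : E) (ha : ‖a‖ ≤ M) (hb : ‖b‖ ≤ M) :
    |‖a + b‖ ^ r - ‖a‖ ^ r - ‖b‖ ^ r| ≤ (2 * r + 1) * (2 * M) ^ (r - 2) * (‖a‖ * ‖b‖) := by
  wlog hab : ‖b‖ ≤ ‖a‖ generalizing a b
  · rw [add_comm a b, sub_right_comm, mul_comm ‖a‖]
    exact this b a hb ha (le_of_not_ge hab)
  have h0 : 0 ≤ M := (norm_nonneg a).trans ha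
  have h1 : |‖a + b‖ ^ r - ‖a‖ ^ r| ≤ r * (2 * ‖a‖) ^ (r - 1) * ‖b‖ := by
    refine (Real.abs_rpow_sub_rpow_le (z := 2 * ‖a‖) (by linarith) (norm_nonneg _) (norm_nonneg _)
      (by linarith [norm_add_le a b]) (by linarith [norm_nonneg a])).trans ?_
    have : |‖a + b‖ - ‖a‖| ≤ ‖b‖ := by simpa using abs_norm_sub_norm_le (a + b) a
    gcongr
  have h2 : (2 * ‖a‖) ^ (r - 1) = (2 * ‖a‖) ^ (r - 2) * (2 * ‖a‖) := by
    have : r - 1 = (r - 2) + 1 := by ring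
    rw [this, Real.rpow_add_one' (by positivity) (by linarith)]
  have h3 : ‖b‖ ^ r = ‖b‖ ^ (r - 2) * (‖b‖ * ‖b‖) := by
    have : r = (r - 2) + 2 := by ring
    conv_lhs => rw [this]
    rw [Real.rpow_add' (by positivity) (by linarith), Real.rpow_two, sq]
  have h4 : (2 * ‖a‖) ^ (r - 2) ≤ (2 * M) ^ (r - 2) :=
    Real.rpow_le_rpow (by positivity) (by linarith) (by linarith)
  have h5 : ‖b‖ ^ (r - 2) ≤ (2 * M) ^ (r - 2) :=
    Real.rpow_le_rpow (by positivity) (by linarith) (by linarith)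
  calc |‖a + b‖ ^ r - ‖a‖ ^ r - ‖b‖ ^ r| ≤ |‖a + b‖ ^ r - ‖a‖ ^ r| + |‖b‖ ^ r| := abs_sub _ _
    _ ≤ r * (2 * ‖a‖) ^ (r - 1) * ‖b‖ + ‖b‖ ^ r := by
        rw [abs_of_nonneg (Real.rpow_nonneg (norm_nonneg b) r)]; gcongr
    _ = 2 * r * (2 * ‖a‖) ^ (r - 2) * (‖a‖ * ‖b‖) + ‖b‖ ^ (r - 2) * (‖b‖ * ‖b‖) := by
        rw [h2, h3]; ring
    _ ≤ 2 * r * (2 * M) ^ (r - 2) * (‖a‖ * ‖b‖) + (2 * M) ^ (r - 2) * (‖a‖ * ‖b‖) := by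
        gcongr
    _ = _ := by ring

variable {α : Type*} {m : MeasurableSpace α} {μ : Measure α} {𝕜 : Type*} [RCLike 𝕜]

theorem MeasureTheory.MemLp.integrable_norm_rpow_of_bdd {f : α → 𝕜} (hf : MemLp f 2 μ) {M r : ℝ}
    (hr : 2 ≤ r) (hM : ∀ᵐ x ∂μ, ‖f x‖ ≤ M) : Integrable (fun x => ‖f x‖ ^ r) μ := by
  have hi := ((memLp_two_iff_integrable_sq_norm hf.1).1 hf).const_mul (M ^ (r - 2))
  refine hi.mono' (hf.1.norm.aemeasurable.pow_const r).aestronglyMeasurable ?_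
  filter_upwards [hM] with x hx
  rw [Real.norm_of_nonneg (Real.rpow_nonneg (norm_nonneg _) _)]
  have h3 : ‖f x‖ ^ r = ‖f x‖ ^ (r - 2) * ‖f x‖ ^ 2 := by
    conv_lhs => rw [show r = (r - 2) + 2 by ring]
    rw [Real.rpow_add' (by positivity) (by linarith), Real.rpow_two]
  rw [h3]
  gcongr

theorem integral_norm_rpow_le {f : α → 𝕜} (hf : MemLp f 2 μ) {M r : ℝ}
    (hr : 2 ≤ r) (hM : ∀ᵐ x ∂μ, ‖f x‖ ≤ M) :
    ∫ x, ‖f x‖ ^ r ∂μ ≤ M ^ (r - 2) * ∫ x, ‖f x‖ ^ 2 ∂μ := by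
  rw [← integral_const_mul]
  refine integral_mono_ae (hf.integrable_norm_rpow_of_bdd hr hM)
    (((memLp_two_iff_integrable_sq_norm hf.1).1 hf).const_mul _) ?_
  filter_upwards [hM] with x hx
  have h3 : ‖f x‖ ^ r = ‖f x‖ ^ (r - 2) * ‖f x‖ ^ 2 := by
    conv_lhs => rw [show r = (r - 2) + 2 by ring]
    rw [Real.rpow_add' (by positivity) (by linarith), Real.rpow_two]
  simp only [h3]
  gcongr

/-- Write `‖f‖ * ‖v‖ ≤ δ * ‖v‖ ^ 2 + (‖f‖ * ‖v‖ - δ * ‖v‖ ^ 2)⁺`. The first term is uniformly small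
in mean; the second is at most `‖f‖ ^ 2 / (4 * δ)` by Young, so dominated convergence applies to it.
-/
theorem tendsto_integral_norm_mul_norm_zero {f : α → 𝕜} {v : ℕ → α → 𝕜} (hf : MemLp f 2 μ)
    (hv : ∀ n, MemLp (v n) 2 μ) {A : ℝ} (hA : ∀ n, ∫ x, ‖v n x‖ ^ 2 ∂μ ≤ A)
    (hlim : ∀ᵐ x ∂μ, Tendsto (fun n => v n x) atTop (𝓝 0)) :
    Tendsto (fun n => ∫ x, ‖f x‖ * ‖v n x‖ ∂μ) atTop (𝓝 0) := by
  have hA0 : 0 ≤ A := le_trans (integral_nonneg fun x => by positivity) (hA 0)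
  have hint : ∀ n, Integrable (fun x => ‖f x‖ * ‖v n x‖) μ := fun n =>
    hf.norm.integrable_mul (hv n).norm
  have hv2 : ∀ n, Integrable (fun x => ‖v n x‖ ^ 2) μ := fun n =>
    (memLp_two_iff_integrable_sq_norm (hv n).1).1 (hv n)
  have hf2 : Integrable (fun x => ‖f x‖ ^ 2) μ := (memLp_two_iff_integrable_sq_norm hf.1).1 hf
  rw [Metric.tendsto_atTop]
  intro ε hε
  set δ : ℝ := ε / (2 * (A + 1)) with hδ
  have hδ0 : 0 < δ := by positivity
  have hdct : Tendsto (fun n => ∫ x, max 0 (‖f x‖ * ‖v n x‖ - δ * ‖v n x‖ ^ 2) ∂μ) atTop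
      (𝓝 (∫ _, (0 : ℝ) ∂μ)) := by
    refine tendsto_integral_of_dominated_convergence (fun x => (4 * δ)⁻¹ * ‖f x‖ ^ 2)
      (fun n => ?_) (hf2.const_mul _) (fun n => Eventually.of_forall fun x => ?_) ?_
    · exact (aestronglyMeasurable_const.sup ((hint n).sub ((hv2 n).const_mul δ)).1)
    · rw [Real.norm_of_nonneg (le_max_left _ _)]
      refine max_le (by positivity) ?_
      rw [inv_mul_eq_div, le_div_iff₀ (by positivity)]
      nlinarith [sq_nonneg (‖f x‖ - 2 * δ * ‖v n x‖)]
    · filter_upwards [hlim] with x hx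
      have h1 : Tendsto (fun n => ‖v n x‖) atTop (𝓝 0) := by simpa using hx.norm
      have h2 : Tendsto (fun n => max 0 (‖f x‖ * ‖v n x‖ - δ * ‖v n x‖ ^ 2)) atTop
          (𝓝 (max 0 (‖f x‖ * 0 - δ * 0 ^ 2))) :=
        tendsto_const_nhds.max ((h1.const_mul _).sub ((h1.pow 2).const_mul _))
      simpa using h2
  rw [integral_zero, Metric.tendsto_atTop] at hdct
  obtain ⟨N, hN⟩ := hdct (ε / 2) (by positivity)
  refine ⟨N, fun n hn => ?_⟩
  have hN' := hN n hn
  rw [dist_zero_right, Real.norm_of_nonneg (integral_nonneg fun x => by positivity)]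
  rw [dist_zero_right, Real.norm_of_nonneg (integral_nonneg fun x => by exact le_max_left _ _)] at hN'
  have hmax : Integrable (fun x => max 0 (‖f x‖ * ‖v n x‖ - δ * ‖v n x‖ ^ 2)) μ := by
    have := ((integrable_zero α ℝ μ).sup ((hint n).sub ((hv2 n).const_mul δ)))
    exact this
  calc ∫ x, ‖f x‖ * ‖v n x‖ ∂μ
      ≤ ∫ x, (δ * ‖v n x‖ ^ 2 + max 0 (‖f x‖ * ‖v n x‖ - δ * ‖v n x‖ ^ 2)) ∂μ := by
        refine integral_mono (hint n) (((hv2 n).const_mul δ).add hmax) fun x => ?_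
        have := le_max_right 0 (‖f x‖ * ‖v n x‖ - δ * ‖v n x‖ ^ 2)
        simp only
        linarith
    _ = δ * ∫ x, ‖v n x‖ ^ 2 ∂μ + ∫ x, max 0 (‖f x‖ * ‖v n x‖ - δ * ‖v n x‖ ^ 2) ∂μ := by
        rw [integral_add ((hv2 n).const_mul δ) hmax, integral_const_mul]
    _ < δ * A + ε / 2 := by
        have := mul_le_mul_of_nonneg_left (hA n) hδ0.le
        linarith
    _ ≤ ε := by
        have : δ * A ≤ ε / 2 := by
          rw [hδ, div_mul_eq_mul_div, div_le_div_iff₀ (by positivity) (by positivity)]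
          nlinarith
        linarith

/-- The Brezis–Lieb splitting for bounded sequences. -/
theorem tendsto_integral_norm_rpow_sub {f : α → 𝕜} {u : ℕ → α → 𝕜} (hf : MemLp f 2 μ)
    (hu : ∀ n, MemLp (u n) 2 μ) {A M r : ℝ} (hr : 2 ≤ r)
    (hA : ∀ n, ∫ x, ‖u n x‖ ^ 2 ∂μ ≤ A)
    (hM : ∀ n, ∀ᵐ x ∂μ, ‖u n x‖ ≤ M)
    (hlim : ∀ᵐ x ∂μ, Tendsto (fun n => u n x) atTop (𝓝 (f x))) :
    Tendsto (fun n => ∫ x, ‖u n x‖ ^ r ∂μ - ∫ x, ‖u n x - f x‖ ^ r ∂μ) atTop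
      (𝓝 (∫ x, ‖f x‖ ^ r ∂μ)) := by
  have hfM : ∀ᵐ x ∂μ, ‖f x‖ ≤ M := by
    filter_upwards [hlim, ae_all_iff.2 hM] with x hx hxM
    exact le_of_tendsto hx.norm (Eventually.of_forall hxM)
  have hvM : ∀ n, ∀ᵐ x ∂μ, ‖u n x - f x‖ ≤ 2 * M := fun n => by
    filter_upwards [hfM, hM n] with x h1 h2
    linarith [norm_sub_le (u n x) (f x)]
  have hv : ∀ n, MemLp (fun x => u n x - f x) 2 μ := fun n => (hu n).sub hf
  have hsq : ∀ {w : α → 𝕜}, MemLp w 2 μ → Integrable (fun x => ‖w x‖ ^ 2) μ := fun hw =>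
    (memLp_two_iff_integrable_sq_norm hw.1).1 hw
  have key := tendsto_integral_norm_mul_norm_zero hf hv
    (A := 2 * A + 2 * ∫ x, ‖f x‖ ^ 2 ∂μ) (fun n => by
      calc ∫ x, ‖u n x - f x‖ ^ 2 ∂μ ≤ ∫ x, (2 * ‖u n x‖ ^ 2 + 2 * ‖f x‖ ^ 2) ∂μ := by
            refine integral_mono (hsq (hv n)) (((hsq (hu n)).const_mul 2).add ((hsq hf).const_mul 2))
              fun x => ?_
            have := norm_sub_le (u n x) (f x)
            have h0 := norm_nonneg (u n x - f x)
            simp only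
            nlinarith [sq_nonneg (‖u n x‖ - ‖f x‖)]
        _ = 2 * ∫ x, ‖u n x‖ ^ 2 ∂μ + 2 * ∫ x, ‖f x‖ ^ 2 ∂μ := by
            rw [integral_add ((hsq (hu n)).const_mul 2) ((hsq hf).const_mul 2),
              integral_const_mul, integral_const_mul]
        _ ≤ _ := by linarith [hA n])
    (by
      filter_upwards [hlim] with x hx
      simpa using hx.sub_const (f x))
  have hiu := fun n => (hu n).integrable_norm_rpow_of_bdd hr (hM n)
  have hiv := fun n => (hv n).integrable_norm_rpow_of_bdd hr (hvM n)
  have hif := hf.integrable_norm_rpow_of_bdd hr hfM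
  rw [tendsto_iff_norm_sub_tendsto_zero]
  refine squeeze_zero (fun n => norm_nonneg _) (fun n => ?_)
    (by simpa using key.const_mul ((2 * r + 1) * (2 * (2 * |M|)) ^ (r - 2)))
  rw [← integral_sub (hiu n) (hiv n), ← integral_sub (by exact (hiu n).sub (hiv n)) hif,
    ← integral_const_mul]
  refine norm_integral_le_of_norm_le ((hf.norm.integrable_mul (hv n).norm).const_mul _) ?_
  filter_upwards [hfM, hvM n] with x h1 h2
  have h3 := le_abs_self M
  have h4 := abs_norm_add_rpow_sub_le (M := 2 * |M|) hr (f x) (u n x - f x)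
    (by linarith [abs_nonneg M]) (by linarith)
  rw [add_sub_cancel] at h4
  rw [Real.norm_eq_abs]
  refine le_of_eq_of_le ?_ h4
  congr 1; ring

/-- The difference of squares equals `2 * re ⟪g, u n⟫ - ‖g‖ ^ 2`, which is affine in `u n`; weak
convergence tested against `g` alone suffices. -/
theorem tendsto_integral_norm_sq_sub {g : α → 𝕜} {u : ℕ → α → 𝕜} (hg : MemLp g 2 μ)
    (hu : ∀ n, MemLp (u n) 2 μ)
    (hw : Tendsto (fun n => ∫ x, inner 𝕜 (g x) (u n x) ∂μ) atTop (𝓝 (∫ x, inner 𝕜 (g x) (g x) ∂μ))) :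
    Tendsto (fun n => ∫ x, ‖u n x‖ ^ 2 ∂μ - ∫ x, ‖u n x - g x‖ ^ 2 ∂μ) atTop
      (𝓝 (∫ x, ‖g x‖ ^ 2 ∂μ)) := by
  have hsq : ∀ {w : α → 𝕜}, MemLp w 2 μ → Integrable (fun x => ‖w x‖ ^ 2) μ := fun hw =>
    (memLp_two_iff_integrable_sq_norm hw.1).1 hw
  have hin : ∀ {w : α → 𝕜}, MemLp w 2 μ → Integrable (fun x => inner 𝕜 (g x) (w x)) μ := fun hw =>
    (hg.norm.integrable_mul hw.norm).mono' (hg.1.inner hw.1)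
      (Eventually.of_forall fun x => norm_inner_le_norm _ _)
  have h1 : Tendsto (fun n => RCLike.re (∫ x, inner 𝕜 (g x) (u n x) ∂μ)) atTop
      (𝓝 (RCLike.re (∫ x, inner 𝕜 (g x) (g x) ∂μ))) :=
    (RCLike.continuous_re.tendsto _).comp hw
  simp_rw [fun n => (integral_re (hin (hu n))).symm, (integral_re (hin hg)).symm,
    inner_self_eq_norm_sq] at h1
  have h2 := (h1.const_mul 2).sub_const (∫ x, ‖g x‖ ^ 2 ∂μ)
  convert h2 using 1
  · ext n
    rw [← integral_sub (hsq (hu n)) (by exact hsq ((hu n).sub hg)), ← integral_const_mul,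
      ← integral_sub (by exact (hin (hu n)).re.const_mul 2) (hsq hg)]
    refine integral_congr_ae (Eventually.of_forall fun x => ?_)
    simp only
    rw [@norm_sub_sq 𝕜, ← inner_conj_symm, RCLike.conj_re]
    ring
  · congr 1; ring

end Splitting

/-! ### Local limits on an edge -/

section

variable {𝕜 : Type*} [RCLike 𝕜]

/-- `(f, f')` is the local limit of the bounded sequence `(u n, g n)` in `H¹(D)`, along which the
Dirichlet and the power integrals split. -/
structure EdgeLimit (D : Set ℝ) (u g : ℕ → ℝ → 𝕜) (f f' : ℝ → 𝕜) : Prop where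
  h1On : H1On D f f'
  tendsto : ∀ x ∈ D, Tendsto (fun n => u n x) atTop (𝓝 (f x))
  dirichlet : Tendsto (fun n => (∫ x in D, ‖g n x‖ ^ 2) - ∫ x in D, ‖g n x - f' x‖ ^ 2) atTop
    (𝓝 (∫ x in D, ‖f' x‖ ^ 2))
  power : ∀ r : ℝ, 2 ≤ r → Tendsto
    (fun n => (∫ x in D, ‖u n x‖ ^ r) - ∫ x in D, ‖u n x - f x‖ ^ r) atTop
    (𝓝 (∫ x in D, ‖f x‖ ^ r))

theorem EdgeLimit.comp {D : Set ℝ} {u g : ℕ → ℝ → 𝕜} {f f' : ℝ → 𝕜} (h : EdgeLimit D u g f f')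
    {φ : ℕ → ℕ} (hφ : StrictMono φ) : EdgeLimit D (u ∘ φ) (g ∘ φ) f f' where
  h1On := h.h1On
  tendsto x hx := (h.tendsto x hx).comp hφ.tendsto_atTop
  dirichlet := h.dirichlet.comp hφ.tendsto_atTop
  power r hr := (h.power r hr).comp hφ.tendsto_atTop

theorem MeasureTheory.MemLp.eLpNorm_two_le {α : Type*} {m : MeasurableSpace α} {μ : Measure α}
    {f : α → 𝕜} (hf : MemLp f 2 μ) {A : ℝ} (hA : ∫ x, ‖f x‖ ^ 2 ∂μ ≤ A) :
    eLpNorm f 2 μ ≤ ENNReal.ofReal √A := by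
  rw [← hf.norm_toLp_sq] at hA
  have := Real.le_sqrt_of_sq_le hA
  rw [Lp.norm_toLp] at this
  rw [← ENNReal.ofReal_toReal hf.2.ne]
  exact ENNReal.ofReal_le_ofReal this

theorem MeasureTheory.memLp_two_of_tendsto {α : Type*} {m : MeasurableSpace α} {μ : Measure α}
    {f : α → 𝕜} {u : ℕ → α → 𝕜} (hu : ∀ n, MemLp (u n) 2 μ) {A : ℝ}
    (hA : ∀ n, ∫ x, ‖u n x‖ ^ 2 ∂μ ≤ A)
    (hlim : ∀ᵐ x ∂μ, Tendsto (fun n => u n x) atTop (𝓝 (f x))) : MemLp f 2 μ := by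
  refine ⟨aestronglyMeasurable_of_tendsto_ae atTop (fun n => (hu n).1) hlim, ?_⟩
  refine lt_of_le_of_lt (Lp.eLpNorm_lim_le_liminf_eLpNorm (fun n => (hu n).1) f hlim) ?_
  refine lt_of_le_of_lt (liminf_le_of_le (a := ENNReal.ofReal √A) (by isBoundedDefault) ?_)
    ENNReal.ofReal_lt_top
  intro b hb
  obtain ⟨n, hn⟩ := hb.exists
  exact hn.trans ((hu n).eLpNorm_two_le (hA n))

/-- Weak compactness is needed only for the derivatives. Once the values at `0` converge, the
integral representation gives convergence at every point of the edge, and the pointwise limit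
together with the uniform bound feeds Brezis–Lieb. -/
theorem H1On.exists_edgeLimit {ℓ : ℝ} {D : Set ℝ} (hD : IsEdgeDomain ℓ D) (hℓ : 0 < ℓ)
    {u g : ℕ → ℝ → 𝕜} (hu : ∀ n, H1On D (u n) (g n)) {A K : ℝ}
    (hA : ∀ n, ∫ x in D, ‖u n x‖ ^ 2 ≤ A) (hK : ∀ n, ∫ x in D, ‖g n x‖ ^ 2 ≤ K) :
    ∃ φ : ℕ → ℕ, StrictMono φ ∧ ∃ f f', EdgeLimit D (u ∘ φ) (g ∘ φ) f f' := by
  have h0 := hD.zero_mem hℓ.le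
  set M := √(A / ℓ) + √(ℓ * K) with hMdef
  have hM : ∀ n, ∀ x ∈ D, ‖u n x‖ ≤ M := fun n x hx => by
    refine ((hu n).norm_le hD hℓ.le hx hℓ le_rfl).trans ?_
    have h1 := hA n
    have h2 := hK n
    change _ ≤ √(A / ℓ) + √(ℓ * K)
    gcongr
  obtain ⟨f', φ, hf', hφ, hweak⟩ := exists_subseq_tendsto_integral_inner g
    (fun n => (hu n).deriv_memLp) hK
  obtain ⟨a, -, ψ, hψ, ha⟩ := tendsto_subseq_of_bounded (Metric.isBounded_closedBall (x := (0:𝕜)) (r := M))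
    (x := fun n => u (φ n) 0) (fun n => by simpa using hM (φ n) 0 h0)
  have hφψ := hφ.comp hψ
  have hpt : ∀ x ∈ D, Tendsto (fun n => u (φ (ψ n)) x) atTop
      (𝓝 (a + ∫ t in (0:ℝ)..x, f' t)) := by
    intro x hx
    have hx0 := hD.nonneg hx
    have hsub : Ioc 0 x ⊆ D := Ioc_subset_Icc_self.trans (hD.Icc_subset h0 hx)
    -- Testing weak convergence against the indicator of `Ioc 0 x` turns it into convergence of the
    -- primitives at `x`.
    have hind : MemLp ((Ioc 0 x).indicator fun _ => (1:𝕜)) 2 (volume.restrict D) :=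
      memLp_indicator_const _ measurableSet_Ioc _ (Or.inr (by
        rw [Measure.restrict_apply measurableSet_Ioc, inter_eq_left.2 hsub]
        simp))
    have hconv : ∀ w : ℝ → 𝕜, ∫ t in D, inner 𝕜 ((Ioc 0 x).indicator (fun _ => (1:𝕜)) t) (w t)
        = ∫ t in (0:ℝ)..x, w t := by
      intro w
      rw [intervalIntegral.integral_of_le hx0, ← inter_eq_left.2 hsub,
        ← Measure.restrict_restrict measurableSet_Ioc, ← integral_indicator measurableSet_Ioc,
        inter_eq_left.2 hsub]
      congr 1
      ext t
      by_cases ht : t ∈ Ioc 0 x <;> simp [ht]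
    have h1 := (hweak _ hind).comp hψ.tendsto_atTop
    simp only [hconv, Function.comp_def] at h1
    refine (ha.add h1).congr fun n => ?_
    exact ((hu _).eq_integral x hx).symm
  have hae : ∀ᵐ x ∂(volume.restrict D), Tendsto (fun n => u (φ (ψ n)) x) atTop
      (𝓝 (a + ∫ t in (0:ℝ)..x, f' t)) := by
    filter_upwards [ae_restrict_mem hD.measurableSet] with x hx using hpt x hx
  have hmem := memLp_two_of_tendsto (fun n => (hu (φ (ψ n))).memLp) (fun n => hA _) hae
  refine ⟨φ ∘ ψ, hφψ, fun x => a + ∫ t in (0:ℝ)..x, f' t, f', ⟨fun x _ => by simp, hmem, hf'⟩,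
    hpt, ?_, fun r hr => ?_⟩
  · exact tendsto_integral_norm_sq_sub hf' (fun n => (hu (φ (ψ n))).deriv_memLp)
      ((hweak f' hf').comp hψ.tendsto_atTop)
  · refine tendsto_integral_norm_rpow_sub hmem (fun n => (hu (φ (ψ n))).memLp) hr (fun n => hA _)
      (M := M) (fun n => ?_) hae
    filter_upwards [ae_restrict_mem hD.measurableSet] with x hx using hM _ x hx

end

/-! ### H¹ functions on a metric graph, their mass and energy -/

namespace GraphFunction

variable {V B H 𝕜 : Type*}

/-- The restriction of a function to an edge, bounded or not. -/
def branch (u : GraphFunction V B H 𝕜) : B ⊕ H → ℝ → 𝕜 := Sum.elim u.edge u.ray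

/-- The graph function with prescribed vertex values and restrictions to the edges. -/
def ofBranch (a : V → 𝕜) (f : B ⊕ H → ℝ → 𝕜) : GraphFunction V B H 𝕜 :=
  ⟨a, fun e => f (Sum.inl e), fun h => f (Sum.inr h)⟩

@[simp] theorem branch_ofBranch (a : V → 𝕜) (f : B ⊕ H → ℝ → 𝕜) : (ofBranch a f).branch = f := by
  ext i; cases i <;> rfl

@[simp] theorem vertex_ofBranch (a : V → 𝕜) (f : B ⊕ H → ℝ → 𝕜) : (ofBranch a f).vertex = a := rfl

variable [RCLike 𝕜]

/-- Difference of two graph functions. -/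
def diff (u w : GraphFunction V B H 𝕜) : GraphFunction V B H 𝕜 :=
  ofBranch (fun v => u.vertex v - w.vertex v) fun i x => u.branch i x - w.branch i x

/-- Multiple of a graph function. -/
def scale (c : 𝕜) (u : GraphFunction V B H 𝕜) : GraphFunction V B H 𝕜 :=
  ofBranch (fun v => c * u.vertex v) fun i x => c * u.branch i x

end GraphFunction

namespace MetricGraph

variable {V B H 𝕜 : Type*} [RCLike 𝕜]

/-- The interval with which an edge is identified. -/
def dom (G : MetricGraph V B H) : B ⊕ H → Set ℝ :=
  Sum.elim (fun e => Icc 0 (G.len e)) fun _ => Ici 0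

/-- `u` is in `H¹` with weak derivative `g`. -/
structure HasWeakDeriv (G : MetricGraph V B H) (u : GraphFunction V B H 𝕜) (g : B ⊕ H → ℝ → 𝕜) :
    Prop where
  edge_src : ∀ e, u.branch (Sum.inl e) 0 = u.vertex (G.src e)
  edge_tgt : ∀ e, u.branch (Sum.inl e) (G.len e) = u.vertex (G.tgt e)
  ray_base : ∀ h, u.branch (Sum.inr h) 0 = u.vertex (G.base h)
  h1On : ∀ i, H1On (G.dom i) (u.branch i) (g i)

theorem exists_isEdgeDomain [Finite B] (G : MetricGraph V B H) :
    ∃ ℓ : ℝ, 0 < ℓ ∧ ∀ i, IsEdgeDomain ℓ (G.dom i) := by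
  suffices ∃ ℓ : ℝ, 0 < ℓ ∧ ∀ e, ℓ ≤ G.len e by
    obtain ⟨ℓ, h0, h⟩ := this
    refine ⟨ℓ, h0, ?_⟩
    rintro (e | h')
    exacts [Or.inl ⟨_, h e, rfl⟩, Or.inr rfl]
  rcases isEmpty_or_nonempty B with hB | hB
  · exact ⟨1, one_pos, fun e => hB.elim e⟩
  · obtain ⟨e, he⟩ := Finite.exists_min G.len
    exact ⟨G.len e, G.len_pos e, he⟩

theorem MemH1.hasWeakDeriv {G : MetricGraph V B H} {u : GraphFunction V B H 𝕜} (h : G.MemH1 u) :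
    G.HasWeakDeriv u fun i => deriv (u.branch i) where
  edge_src := h.edge_src
  edge_tgt := h.edge_tgt
  ray_base := h.ray_base
  h1On := by
    rintro (e | r)
    · refine H1On.of_ac (ℓ := G.len e) (Or.inl ⟨_, le_rfl, rfl⟩) (G.len_pos e).le (fun x hx => ?_) ?_ ?_
      · refine (h.edge_ac e).mono (uIcc_subset_uIcc left_mem_uIcc ?_)
        rw [uIcc_of_le (G.len_pos e).le]; exact hx
      · exact restrict_Ioo_eq_restrict_Icc (μ := volume) (a := (0 : ℝ)) (b := G.len e) ▸ h.edge_memLp e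
      · exact restrict_Ioo_eq_restrict_Icc (μ := volume) (a := (0 : ℝ)) (b := G.len e) ▸ h.edge_deriv_memLp e
    · refine H1On.of_ac (ℓ := 0) (Or.inr rfl) le_rfl (fun x hx => ?_) ?_ ?_
      · have hx' : (0:ℝ) ≤ x := hx
        refine (h.ray_ac r (x + 1) (by linarith)).mono (uIcc_subset_uIcc left_mem_uIcc ?_)
        rw [uIcc_of_le (by linarith)]; exact ⟨hx', by linarith⟩
      · exact restrict_Ioi_eq_restrict_Ici (μ := volume) (a := (0 : ℝ)) ▸ h.ray_memLp r
      · exact restrict_Ioi_eq_restrict_Ici (μ := volume) (a := (0 : ℝ)) ▸ h.ray_deriv_memLp r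

theorem HasWeakDeriv.deriv_ae_eq {G : MetricGraph V B H} {u : GraphFunction V B H 𝕜}
    {g : B ⊕ H → ℝ → 𝕜} (h : G.HasWeakDeriv u g) (i : B ⊕ H) :
    deriv (u.branch i) =ᵐ[volume.restrict (G.dom i)] g i := by
  rcases i with e | r
  · exact (h.h1On (Sum.inl e)).deriv_ae_eq (ℓ := G.len e) (Or.inl ⟨_, le_rfl, rfl⟩) (G.len_pos e).le
  · exact (h.h1On (Sum.inr r)).deriv_ae_eq (ℓ := 0) (Or.inr rfl) le_rfl

theorem HasWeakDeriv.memH1 {G : MetricGraph V B H} {u : GraphFunction V B H 𝕜}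
    {g : B ⊕ H → ℝ → 𝕜} (h : G.HasWeakDeriv u g) : G.MemH1 u where
  edge_src := h.edge_src
  edge_tgt := h.edge_tgt
  ray_base := h.ray_base
  edge_ac e := (h.h1On (Sum.inl e)).ac (ℓ := G.len e) (Or.inl ⟨_, le_rfl, rfl⟩) (G.len_pos e).le
    ⟨(G.len_pos e).le, le_rfl⟩
  ray_ac r R hR := (h.h1On (Sum.inr r)).ac (ℓ := 0) (Or.inr rfl) le_rfl hR.le
  edge_memLp e := by
    rw [restrict_Ioo_eq_restrict_Icc]; exact (h.h1On (Sum.inl e)).memLp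
  ray_memLp r := by
    rw [restrict_Ioi_eq_restrict_Ici]; exact (h.h1On (Sum.inr r)).memLp
  edge_deriv_memLp e := by
    rw [restrict_Ioo_eq_restrict_Icc]
    exact (memLp_congr_ae (h.deriv_ae_eq (Sum.inl e))).2 (h.h1On (Sum.inl e)).deriv_memLp
  ray_deriv_memLp r := by
    rw [restrict_Ioi_eq_restrict_Ici]
    exact (memLp_congr_ae (h.deriv_ae_eq (Sum.inr r))).2 (h.h1On (Sum.inr r)).deriv_memLp

theorem HasWeakDeriv.diff [Finite B] {G : MetricGraph V B H} {u w : GraphFunction V B H 𝕜}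
    {g k : B ⊕ H → ℝ → 𝕜} (hu : G.HasWeakDeriv u g) (hw : G.HasWeakDeriv w k) :
    G.HasWeakDeriv (u.diff w) fun i x => g i x - k i x where
  edge_src e := by simp [GraphFunction.diff, hu.edge_src, hw.edge_src]
  edge_tgt e := by simp [GraphFunction.diff, hu.edge_tgt, hw.edge_tgt]
  ray_base e := by simp [GraphFunction.diff, hu.ray_base, hw.ray_base]
  h1On i := by
    obtain ⟨ℓ, hℓ, hD⟩ := G.exists_isEdgeDomain
    simpa [GraphFunction.diff] using (hu.h1On i).sub (hD i) hℓ.le (hw.h1On i)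

theorem HasWeakDeriv.scale {G : MetricGraph V B H} {u : GraphFunction V B H 𝕜}
    {g : B ⊕ H → ℝ → 𝕜} (hu : G.HasWeakDeriv u g) (c : 𝕜) :
    G.HasWeakDeriv (u.scale c) fun i x => c * g i x where
  edge_src e := by simp [GraphFunction.scale, hu.edge_src]
  edge_tgt e := by simp [GraphFunction.scale, hu.edge_tgt]
  ray_base e := by simp [GraphFunction.scale, hu.ray_base]
  h1On i := by
    simpa [GraphFunction.scale] using (hu.h1On i).const_mul c

/-- Every vertex is an end of some edge. -/
def Covered (G : MetricGraph V B H) : Prop :=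
  ∀ v, (∃ e, G.src e = v) ∨ (∃ e, G.tgt e = v) ∨ ∃ h, G.base h = v

/-- This is the only use of connectedness: it excludes isolated vertices, at which a value would be
controlled by no edge. -/
theorem IsConnected.covered {G : MetricGraph V B H} (hG : G.IsConnected) (hH : Nonempty H) :
    G.Covered := by
  intro v
  obtain ⟨h⟩ := hH
  have key : ∀ a b, Relation.EqvGen (fun a b => ∃ e, G.src e = a ∧ G.tgt e = b) a b →
      a = b ∨ (((∃ e, G.src e = a) ∨ ∃ e, G.tgt e = a) ∧ ((∃ e, G.src e = b) ∨ ∃ e, G.tgt e = b)) := by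
    intro a b hab
    induction hab with
    | rel a b h => obtain ⟨e, h1, h2⟩ := h; exact Or.inr ⟨Or.inl ⟨e, h1⟩, Or.inr ⟨e, h2⟩⟩
    | refl a => exact Or.inl rfl
    | symm a b _ ih => tauto
    | trans a b c _ _ ih1 ih2 =>
      rcases ih1 with rfl | ih1
      · exact ih2
      · rcases ih2 with rfl | ih2
        · exact Or.inr ih1
        · exact Or.inr ⟨ih1.1, ih2.2⟩
  rcases key v (G.base h) (hG v (G.base h)) with rfl | h'
  · exact Or.inr (Or.inr ⟨h, rfl⟩)
  · tauto

theorem Covered.exists_branch_eq {G : MetricGraph V B H} (hG : G.Covered) (v : V) :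
    ∃ i, ∃ x ∈ G.dom i, ∀ (u : GraphFunction V B H 𝕜), G.MemH1 u →
      u.branch i x = u.vertex v := by
  rcases hG v with ⟨e, rfl⟩ | ⟨e, rfl⟩ | ⟨h, rfl⟩
  · exact ⟨Sum.inl e, 0, ⟨le_rfl, (G.len_pos e).le⟩, fun u hu => hu.edge_src e⟩
  · exact ⟨Sum.inl e, G.len e, ⟨(G.len_pos e).le, le_rfl⟩, fun u hu => hu.edge_tgt e⟩
  · exact ⟨Sum.inr h, 0, self_mem_Ici, fun u hu => hu.ray_base h⟩

theorem MemH1.scale {G : MetricGraph V B H} {u : GraphFunction V B H 𝕜} (hu : G.MemH1 u) (c : 𝕜) :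
    G.MemH1 (u.scale c) := (hu.hasWeakDeriv.scale c).memH1

theorem MemH1.diff [Finite B] {G : MetricGraph V B H} {u w : GraphFunction V B H 𝕜} (hu : G.MemH1 u)
    (hw : G.MemH1 w) : G.MemH1 (u.diff w) := (hu.hasWeakDeriv.diff hw.hasWeakDeriv).memH1

variable [Fintype B] [Fintype H]

theorem mass_eq (G : MetricGraph V B H) (u : GraphFunction V B H 𝕜) :
    G.mass u = ∑ i, ∫ x in G.dom i, ‖u.branch i x‖ ^ 2 := by
  simp only [mass, Fintype.sum_sum_type, dom, GraphFunction.branch, Sum.elim_inl, Sum.elim_inr,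
    restrict_Ioo_eq_restrict_Icc, restrict_Ioi_eq_restrict_Ici]

theorem powerIntegral_eq (G : MetricGraph V B H) (r : ℝ) (u : GraphFunction V B H 𝕜) :
    G.powerIntegral r u = ∑ i, ∫ x in G.dom i, ‖u.branch i x‖ ^ r := by
  simp only [powerIntegral, Fintype.sum_sum_type, dom, GraphFunction.branch, Sum.elim_inl,
    Sum.elim_inr, restrict_Ioo_eq_restrict_Icc, restrict_Ioi_eq_restrict_Ici]

theorem HasWeakDeriv.kinetic_eq {G : MetricGraph V B H} {u : GraphFunction V B H 𝕜}
    {g : B ⊕ H → ℝ → 𝕜} (h : G.HasWeakDeriv u g) :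
    G.kinetic u = ∑ i, ∫ x in G.dom i, ‖g i x‖ ^ 2 := by
  have : G.kinetic u = ∑ i, ∫ x in G.dom i, ‖deriv (u.branch i) x‖ ^ 2 := by
    simp only [kinetic, Fintype.sum_sum_type, dom, GraphFunction.branch, Sum.elim_inl,
      Sum.elim_inr, restrict_Ioo_eq_restrict_Icc, restrict_Ioi_eq_restrict_Ici]
  rw [this]
  refine Finset.sum_congr rfl fun i _ => integral_congr_ae ?_
  filter_upwards [h.deriv_ae_eq i] with x hx
  rw [hx]

theorem mass_nonneg (G : MetricGraph V B H) (u : GraphFunction V B H 𝕜) : 0 ≤ G.mass u := by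
  rw [mass_eq]
  exact Finset.sum_nonneg fun i _ => integral_nonneg fun x => by positivity

theorem kinetic_nonneg (G : MetricGraph V B H) (u : GraphFunction V B H 𝕜) : 0 ≤ G.kinetic u :=
  add_nonneg (Finset.sum_nonneg fun i _ => integral_nonneg fun x => by positivity)
    (Finset.sum_nonneg fun i _ => integral_nonneg fun x => by positivity)

theorem powerIntegral_nonneg (G : MetricGraph V B H) (r : ℝ) (u : GraphFunction V B H 𝕜) :
    0 ≤ G.powerIntegral r u := by
  rw [powerIntegral_eq]
  exact Finset.sum_nonneg fun i _ => integral_nonneg fun x => by positivity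

theorem mass_scale (G : MetricGraph V B H) (c : 𝕜) (u : GraphFunction V B H 𝕜) :
    G.mass (u.scale c) = ‖c‖ ^ 2 * G.mass u := by
  simp only [mass_eq, GraphFunction.scale, GraphFunction.branch_ofBranch, norm_mul, mul_pow,
    integral_const_mul, Finset.mul_sum]

theorem powerIntegral_scale (G : MetricGraph V B H) (r : ℝ) (c : 𝕜) (u : GraphFunction V B H 𝕜) :
    G.powerIntegral r (u.scale c) = ‖c‖ ^ r * G.powerIntegral r u := by
  simp only [powerIntegral_eq, GraphFunction.scale, GraphFunction.branch_ofBranch, norm_mul,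
    Real.mul_rpow (norm_nonneg _) (norm_nonneg _), integral_const_mul, Finset.mul_sum]

theorem MemH1.kinetic_scale {G : MetricGraph V B H} {u : GraphFunction V B H 𝕜} (hu : G.MemH1 u)
    (c : 𝕜) : G.kinetic (u.scale c) = ‖c‖ ^ 2 * G.kinetic u := by
  rw [(hu.hasWeakDeriv.scale c).kinetic_eq, hu.hasWeakDeriv.kinetic_eq]
  simp only [norm_mul, mul_pow, integral_const_mul, Finset.mul_sum]

theorem integral_sq_le_mass (G : MetricGraph V B H) (u : GraphFunction V B H 𝕜) (i : B ⊕ H) :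
    ∫ x in G.dom i, ‖u.branch i x‖ ^ 2 ≤ G.mass u := by
  rw [mass_eq]
  exact Finset.single_le_sum (f := fun i => ∫ x in G.dom i, ‖u.branch i x‖ ^ 2)
    (fun i _ => integral_nonneg fun x => by positivity) (Finset.mem_univ i)

theorem HasWeakDeriv.integral_sq_le_kinetic {G : MetricGraph V B H} {u : GraphFunction V B H 𝕜}
    {g : B ⊕ H → ℝ → 𝕜} (h : G.HasWeakDeriv u g) (i : B ⊕ H) :
    ∫ x in G.dom i, ‖g i x‖ ^ 2 ≤ G.kinetic u := by
  rw [h.kinetic_eq]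
  exact Finset.single_le_sum (f := fun i => ∫ x in G.dom i, ‖g i x‖ ^ 2)
    (fun i _ => integral_nonneg fun x => by positivity) (Finset.mem_univ i)

theorem MemH1.norm_branch_le {G : MetricGraph V B H} {u : GraphFunction V B H 𝕜} (hu : G.MemH1 u)
    {ℓ : ℝ} (hD : ∀ i, IsEdgeDomain ℓ (G.dom i)) {r : ℝ} (hr : 0 < r) (hrℓ : r ≤ ℓ)
    {i : B ⊕ H} {x : ℝ} (hx : x ∈ G.dom i) :
    ‖u.branch i x‖ ≤ √(G.mass u / r) + √(r * G.kinetic u) := by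
  refine ((hu.hasWeakDeriv.h1On i).norm_le (hD i) (hr.le.trans hrℓ) hx hr hrℓ).trans ?_
  have h1 := G.integral_sq_le_mass u i
  have h2 := hu.hasWeakDeriv.integral_sq_le_kinetic i
  gcongr

theorem MemH1.powerIntegral_le {G : MetricGraph V B H} {u : GraphFunction V B H 𝕜} (hu : G.MemH1 u)
    {M r : ℝ} (hr : 2 ≤ r) (hM : ∀ i, ∀ x ∈ G.dom i, ‖u.branch i x‖ ≤ M) :
    G.powerIntegral r u ≤ M ^ (r - 2) * G.mass u := by
  obtain ⟨ℓ, hℓ, hD⟩ := G.exists_isEdgeDomain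
  rw [powerIntegral_eq, mass_eq, Finset.mul_sum]
  refine Finset.sum_le_sum fun i _ =>
    integral_norm_rpow_le (hu.hasWeakDeriv.h1On i).memLp hr ?_
  filter_upwards [ae_restrict_mem (hD i).measurableSet] with x hx using hM i x hx

variable [Fintype V]

/-- The energy with an arbitrary strength `κ` of the vertex nonlinearity. -/
noncomputable def genEnergy (G : MetricGraph V B H) (p q κ : ℝ) (u : GraphFunction V B H 𝕜) : ℝ :=
  1 / 2 * G.kinetic u - 1 / p * G.powerIntegral p u - κ * ∑ v, ‖u.vertex v‖ ^ q

/-- The kinetic term is exactly quadratic, while the terms with a minus sign grow at least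
quadratically. -/
theorem MemH1.genEnergy_scale_le {G : MetricGraph V B H} {u : GraphFunction V B H 𝕜}
    (hu : G.MemH1 u) {p q κ : ℝ} (hp : 2 ≤ p) (hq : 2 ≤ q) (hκ : 0 ≤ κ) {c : 𝕜} (hc : 1 ≤ ‖c‖) :
    G.genEnergy p q κ (u.scale c) ≤ ‖c‖ ^ 2 * G.genEnergy p q κ u := by
  have hpow : ∀ r : ℝ, 2 ≤ r → ‖c‖ ^ 2 ≤ ‖c‖ ^ r := fun r hr => by
    rw [← Real.rpow_two]; exact Real.rpow_le_rpow_of_exponent_le hc hr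
  have h1 : ∑ v, ‖(u.scale c).vertex v‖ ^ q = ‖c‖ ^ q * ∑ v, ‖u.vertex v‖ ^ q := by
    simp only [GraphFunction.scale, GraphFunction.vertex_ofBranch, norm_mul,
      Real.mul_rpow (norm_nonneg _) (norm_nonneg _), Finset.mul_sum]
  unfold genEnergy
  rw [hu.kinetic_scale, powerIntegral_scale, h1]
  have h2 := mul_le_mul_of_nonneg_right (hpow p hp) (G.powerIntegral_nonneg p u)
  have h3 := mul_le_mul_of_nonneg_right (hpow q hq)
    (Finset.sum_nonneg fun v (_ : v ∈ Finset.univ) => Real.rpow_nonneg (norm_nonneg (u.vertex v)) q)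
  have h4 := mul_le_mul_of_nonneg_left h2 (show 0 ≤ 1 / p by positivity)
  have h5 := mul_le_mul_of_nonneg_left h3 hκ
  linarith

end MetricGraph

/-! ### Coercivity, minimizing sequences and their limits -/

theorem Real.exists_const_mul_rpow_le {C s ε : ℝ} (hC : 0 ≤ C) (hs : 0 ≤ s) (hs4 : s < 4)
    (hε : 0 < ε) : ∃ C' : ℝ, ∀ t : ℝ, 0 ≤ t → C * t ^ s ≤ ε * t ^ 4 + C' := by
  set T : ℝ := (C / ε + 1) ^ (1 / (4 - s)) with hT
  have hb : 0 < C / ε + 1 := by positivity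
  have hT0 : 0 < T := Real.rpow_pos_of_pos hb _
  have hTs : T ^ (4 - s) = C / ε + 1 := by
    rw [hT, ← Real.rpow_mul hb.le, one_div_mul_cancel (by linarith), Real.rpow_one]
  refine ⟨C * T ^ s, fun t ht => ?_⟩
  rcases le_total t T with h | h
  · have h1 : C * t ^ s ≤ C * T ^ s := by gcongr
    have h2 : 0 ≤ ε * t ^ 4 := by positivity
    linarith
  · have ht0 : 0 < t := hT0.trans_le h
    have h1 : C / ε + 1 ≤ t ^ (4 - s) := by
      rw [← hTs]; exact Real.rpow_le_rpow hT0.le h (by linarith)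
    have h2 : C ≤ ε * t ^ (4 - s) := by
      have := mul_le_mul_of_nonneg_left h1 hε.le
      rw [mul_add, mul_div_cancel₀ _ hε.ne'] at this
      linarith
    have h3 : t ^ (4 - s) * t ^ s = t ^ 4 := by
      rw [← Real.rpow_add ht0, sub_add_cancel]; norm_cast
    have h4 : C * t ^ s ≤ ε * t ^ (4 - s) * t ^ s := by gcongr
    have h5 : 0 ≤ C * T ^ s := by positivity
    rw [mul_assoc, h3] at h4
    linarith

namespace MetricGraph

variable {V B H 𝕜 : Type*} [RCLike 𝕜]

theorem Covered.norm_vertex_le {G : MetricGraph V B H} (hG : G.Covered)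
    {u : GraphFunction V B H 𝕜} (hu : G.MemH1 u) {M : ℝ}
    (hM : ∀ i, ∀ x ∈ G.dom i, ‖u.branch i x‖ ≤ M) (v : V) : ‖u.vertex v‖ ≤ M := by
  obtain ⟨i, x, hx, h⟩ := hG.exists_branch_eq (𝕜 := 𝕜) v
  rw [← h u hu]; exact hM i x hx

variable [Fintype B] [Fintype H]

/-- With zero mass the Sobolev bound at scale `r` reduces to `√(r * kinetic)`; let `r` tend to zero.
-/
theorem Covered.eq_zero_of_mass_eq_zero {G : MetricGraph V B H} {u : GraphFunction V B H 𝕜}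
    (hG : G.Covered) (hu : G.MemH1 u) (h0 : G.mass u = 0) :
    (∀ i, ∀ x ∈ G.dom i, u.branch i x = 0) ∧ ∀ v, u.vertex v = 0 := by
  obtain ⟨ℓ, hℓ, hD⟩ := G.exists_isEdgeDomain
  have key : ∀ i, ∀ x ∈ G.dom i, ‖u.branch i x‖ ≤ 0 := by
    intro i x hx
    have hlim : Tendsto (fun r : ℝ => √(r * G.kinetic u)) (𝓝[>] 0) (𝓝 0) := by
      have : Continuous fun r : ℝ => √(r * G.kinetic u) := by fun_prop
      simpa using (this.tendsto 0).mono_left nhdsWithin_le_nhds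
    refine ge_of_tendsto hlim ?_
    filter_upwards [Ioc_mem_nhdsGT hℓ] with r hr
    have := hu.norm_branch_le hD hr.1 hr.2 hx
    simpa [h0] using this
  refine ⟨fun i x hx => norm_le_zero_iff.1 (key i x hx), fun v => ?_⟩
  exact norm_le_zero_iff.1 (hG.norm_vertex_le hu key v)

/-- `U` is a local limit of `u n`, along which the integrals split. -/
structure IsLimit (G : MetricGraph V B H) (u : ℕ → GraphFunction V B H 𝕜)
    (U : GraphFunction V B H 𝕜) : Prop where
  memH1 : G.MemH1 U
  vertex : ∀ v, Tendsto (fun n => (u n).vertex v) atTop (𝓝 (U.vertex v))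
  branch : ∀ i, ∀ x ∈ G.dom i, Tendsto (fun n => (u n).branch i x) atTop (𝓝 (U.branch i x))
  kinetic : Tendsto (fun n => G.kinetic (u n) - G.kinetic ((u n).diff U)) atTop (𝓝 (G.kinetic U))
  power : ∀ r : ℝ, 2 ≤ r → Tendsto
    (fun n => G.powerIntegral r (u n) - G.powerIntegral r ((u n).diff U)) atTop
      (𝓝 (G.powerIntegral r U))

theorem powerIntegral_two (G : MetricGraph V B H) (u : GraphFunction V B H 𝕜) :
    G.powerIntegral 2 u = G.mass u := by
  simp only [powerIntegral_eq, mass_eq, Real.rpow_two]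

theorem Covered.exists_isLimit {G : MetricGraph V B H} (hG : G.Covered)
    {u : ℕ → GraphFunction V B H 𝕜} (hu : ∀ n, G.MemH1 (u n)) {A K : ℝ}
    (hA : ∀ n, G.mass (u n) ≤ A) (hK : ∀ n, G.kinetic (u n) ≤ K) :
    ∃ φ : ℕ → ℕ, StrictMono φ ∧ ∃ U, G.IsLimit (u ∘ φ) U := by
  obtain ⟨ℓ, hℓ, hD⟩ := G.exists_isEdgeDomain
  have hw := fun n => (hu n).hasWeakDeriv
  obtain ⟨φ, hφ, hlim⟩ := exists_subseq_forall_finite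
    (fun (i : B ⊕ H) (φ : ℕ → ℕ) => ∃ f f' : ℝ → 𝕜, EdgeLimit (G.dom i)
      (fun n => (u (φ n)).branch i) (fun n => deriv ((u (φ n)).branch i)) f f')
    (fun i φ ψ hψ ⟨f, f', h⟩ => ⟨f, f', h.comp hψ⟩)
    (fun i φ _ => by
      obtain ⟨ψ, hψ, f, f', h⟩ := H1On.exists_edgeLimit (hD i) hℓ
        (fun n => (hw (φ n)).h1On i)
        (fun n => (G.integral_sq_le_mass (u (φ n)) i).trans (hA _))
        (fun n => ((hw (φ n)).integral_sq_le_kinetic i).trans (hK _))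
      exact ⟨ψ, hψ, f, f', h⟩)
  choose f f' hf using hlim
  have hvert : ∀ v, ∃ a : 𝕜, Tendsto (fun n => (u (φ n)).vertex v) atTop (𝓝 a) := by
    intro v
    obtain ⟨i, x, hx, h⟩ := hG.exists_branch_eq (𝕜 := 𝕜) v
    exact ⟨f i x, ((hf i).tendsto x hx).congr fun n => h _ (hu _)⟩
  choose a ha using hvert
  have hU : G.HasWeakDeriv (GraphFunction.ofBranch a f) f' := by
    refine ⟨fun e => ?_, fun e => ?_, fun r => ?_, fun i => ?_⟩
    · rw [GraphFunction.branch_ofBranch]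
      exact tendsto_nhds_unique (((hf (Sum.inl e)).tendsto 0 ⟨le_rfl, (G.len_pos e).le⟩).congr
        fun n => (hw (φ n)).edge_src e) (ha _)
    · rw [GraphFunction.branch_ofBranch]
      exact tendsto_nhds_unique (((hf (Sum.inl e)).tendsto _ ⟨(G.len_pos e).le, le_rfl⟩).congr
        fun n => (hw (φ n)).edge_tgt e) (ha _)
    · rw [GraphFunction.branch_ofBranch]
      exact tendsto_nhds_unique (((hf (Sum.inr r)).tendsto 0 self_mem_Ici).congr
        fun n => (hw (φ n)).ray_base r) (ha _)
    · rw [GraphFunction.branch_ofBranch]; exact (hf i).h1On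
  refine ⟨φ, hφ, GraphFunction.ofBranch a f, hU.memH1, ha, fun i x hx => ?_, ?_, fun r hr => ?_⟩
  · rw [GraphFunction.branch_ofBranch]; exact (hf i).tendsto x hx
  · simp only [Function.comp_def, (hw _).kinetic_eq, ((hw _).diff hU).kinetic_eq, hU.kinetic_eq,
      ← Finset.sum_sub_distrib]
    exact tendsto_finsetSum _ fun i _ => (hf i).dirichlet
  · simp only [Function.comp_def, powerIntegral_eq, GraphFunction.branch_ofBranch,
      GraphFunction.diff, ← Finset.sum_sub_distrib]
    exact tendsto_finsetSum _ fun i _ => (hf i).power r hr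

theorem IsLimit.mass {G : MetricGraph V B H} {u : ℕ → GraphFunction V B H 𝕜}
    {U : GraphFunction V B H 𝕜} (h : G.IsLimit u U) :
    Tendsto (fun n => G.mass (u n) - G.mass ((u n).diff U)) atTop (𝓝 (G.mass U)) := by
  simpa only [powerIntegral_two] using h.power 2 le_rfl

variable [Fintype V]

/-- The energy controls the Dirichlet integral at fixed mass. -/
theorem Covered.exists_coercive (𝕜 : Type*) [RCLike 𝕜] {G : MetricGraph V B H} (hG : G.Covered)
    {p q κ : ℝ} (hp : 2 < p ∧ p < 6) (hq : 2 < q ∧ q < 4) (hκ : 0 ≤ κ) (μ : ℝ) :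
    ∃ C : ℝ, ∀ u : GraphFunction V B H 𝕜, G.MemH1 u → G.mass u = μ →
      G.kinetic u / 4 - C ≤ G.genEnergy p q κ u := by
  obtain ⟨ℓ, hℓ, hD⟩ := G.exists_isEdgeDomain
  set c : ℝ := √μ + 1 with hc
  have hc0 : 0 ≤ c := by positivity
  -- Both nonlinear terms will be powers of `t ≈ kinetic ^ (1 / 4)` with exponents `p - 2 < 4` and
  -- `q < 4`. Two absorptions of size `t ^ 4 / 8` leave a quarter of the kinetic term. The absolute
  -- value keeps the constant nonnegative when `μ < 0`, a case in which no function has mass `μ`.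
  obtain ⟨C₁, h₁⟩ := Real.exists_const_mul_rpow_le (C := 1 / p * (c ^ (p - 2) * |μ|)) (s := p - 2)
    (ε := 1 / 8) (by have := hp.1; positivity) (by linarith) (by linarith) (by norm_num)
  obtain ⟨C₂, h₂⟩ := Real.exists_const_mul_rpow_le (C := κ * (Fintype.card V * c ^ q)) (s := q)
    (ε := 1 / 8) (by positivity) (by linarith) (by linarith) (by norm_num)
  refine ⟨1 / 2 * (ℓ⁻¹) ^ 2 + C₁ + C₂, fun u hu hmass => ?_⟩
  have hK := G.kinetic_nonneg u
  have hμ : 0 ≤ μ := hmass ▸ G.mass_nonneg u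
  set K := G.kinetic u with hKdef
  -- The optimal Sobolev scale is `t⁻²`; the added `(ℓ⁻¹) ^ 2` keeps it below the shortest edge
  -- length.
  set t := √√(K + (ℓ⁻¹) ^ 2) with ht
  have hpos : 0 < K + (ℓ⁻¹) ^ 2 := by positivity
  have ht0 : 0 < t := by positivity
  have ht2 : t ^ 2 = √(K + (ℓ⁻¹) ^ 2) := Real.sq_sqrt (by positivity)
  have ht4 : t ^ 4 = K + (ℓ⁻¹) ^ 2 := by
    rw [show t ^ 4 = (t ^ 2) ^ 2 by ring, ht2, Real.sq_sqrt hpos.le]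
  have htℓ : ℓ⁻¹ ≤ t ^ 2 := by
    rw [ht2]; exact Real.le_sqrt_of_sq_le (by linarith)
  have hr : (t ^ 2)⁻¹ ≤ ℓ := by
    rw [inv_le_comm₀ (by positivity) hℓ]; exact htℓ
  have hM : ∀ i, ∀ x ∈ G.dom i, ‖u.branch i x‖ ≤ c * t := by
    intro i x hx
    refine (hu.norm_branch_le hD (by positivity) hr hx).trans ?_
    rw [hmass, div_inv_eq_mul, Real.sqrt_mul hμ, Real.sqrt_sq ht0.le, hc, add_mul, one_mul]
    have : √((t ^ 2)⁻¹ * K) ≤ t := by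
      rw [Real.sqrt_le_left ht0.le, inv_mul_le_iff₀ (by positivity)]
      nlinarith [sq_nonneg ℓ⁻¹]
    linarith
  have hP : G.powerIntegral p u ≤ c ^ (p - 2) * |μ| * t ^ (p - 2) := by
    refine (hu.powerIntegral_le hp.1.le hM).trans_eq ?_
    rw [Real.mul_rpow hc0 ht0.le, hmass, abs_of_nonneg hμ]; ring
  have hV : ∑ v, ‖u.vertex v‖ ^ q ≤ Fintype.card V * c ^ q * t ^ q := by
    calc ∑ v, ‖u.vertex v‖ ^ q ≤ ∑ _v : V, (c * t) ^ q := by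
          refine Finset.sum_le_sum fun v _ => ?_
          exact Real.rpow_le_rpow (norm_nonneg _) (hG.norm_vertex_le hu hM v) (by linarith)
      _ = _ := by
          rw [Real.mul_rpow hc0 ht0.le]; simp; ring
  have e1 := h₁ t ht0.le
  have e2 := h₂ t ht0.le
  have e3 := mul_le_mul_of_nonneg_left hP (show 0 ≤ 1 / p by have := hp.1; positivity)
  have e4 := mul_le_mul_of_nonneg_left hV hκ
  unfold genEnergy
  rw [← hKdef]
  nlinarith

/-- A function of mass `0` has nonnegative energy. -/
theorem Covered.genEnergy_nonneg_of_mass_eq_zero {G : MetricGraph V B H}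
    {u : GraphFunction V B H 𝕜} (hG : G.Covered) (hu : G.MemH1 u) (h0 : G.mass u = 0)
    {p q κ : ℝ} (hp : 2 ≤ p) (hq : 2 ≤ q) : 0 ≤ G.genEnergy p q κ u := by
  obtain ⟨h1, h2⟩ := hG.eq_zero_of_mass_eq_zero hu h0
  have hP : G.powerIntegral p u ≤ 0 := by
    have := hu.powerIntegral_le (M := 0) hp fun i x hx => by rw [h1 i x hx, norm_zero]
    simpa [h0] using this
  have hV : ∑ v, ‖u.vertex v‖ ^ q = 0 :=
    Finset.sum_eq_zero fun v _ => by rw [h2, norm_zero, Real.zero_rpow (by linarith)]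
  have h3 := mul_nonpos_of_nonneg_of_nonpos (show 0 ≤ 1 / p by positivity) hP
  have h4 := G.kinetic_nonneg u
  unfold genEnergy
  rw [hV]
  linarith

theorem IsLimit.genEnergy {G : MetricGraph V B H} {u : ℕ → GraphFunction V B H 𝕜}
    {U : GraphFunction V B H 𝕜} (h : G.IsLimit u U) {p q κ : ℝ} (hp : 2 ≤ p) (hq : 0 < q) :
    Tendsto (fun n => G.genEnergy p q κ (u n) - G.genEnergy p q κ ((u n).diff U)) atTop
      (𝓝 (G.genEnergy p q κ U)) := by
  have hV : Tendsto (fun n => ∑ v, ‖(u n).vertex v‖ ^ q - ∑ v, ‖((u n).diff U).vertex v‖ ^ q) atTop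
      (𝓝 (∑ v, ‖U.vertex v‖ ^ q)) := by
    simp only [← Finset.sum_sub_distrib]
    refine tendsto_finsetSum _ fun v _ => ?_
    have h1 : Tendsto (fun n => ‖(u n).vertex v‖ ^ q) atTop (𝓝 (‖U.vertex v‖ ^ q)) :=
      (h.vertex v).norm.rpow_const (Or.inr hq.le)
    have h2 : Tendsto (fun n => ‖((u n).diff U).vertex v‖ ^ q) atTop (𝓝 (‖(0 : 𝕜)‖ ^ q)) := by
      refine Tendsto.rpow_const (Tendsto.norm ?_) (Or.inr hq.le)
      simpa [GraphFunction.diff] using (h.vertex v).sub_const (U.vertex v)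
    simpa [Real.zero_rpow hq.ne'] using h1.sub h2
  have := ((h.kinetic.const_mul (1 / 2)).sub ((h.power p hp).const_mul (1 / p))).sub
    (hV.const_mul κ)
  refine this.congr fun n => ?_
  unfold MetricGraph.genEnergy
  ring

/-- A local limit of a minimizing sequence, if nonzero, is a minimizer up to rescaling. -/
theorem Covered.exists_minimizer_of_isLimit {G : MetricGraph V B H} (hG : G.Covered)
    {p q κ μ I : ℝ} (hp : 2 ≤ p) (hq : 2 ≤ q) (hκ : 0 ≤ κ)
    (hI : ∀ w : GraphFunction V B H 𝕜, G.MemH1 w → G.mass w = μ → I ≤ G.genEnergy p q κ w)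
    {u : ℕ → GraphFunction V B H 𝕜} (hu : ∀ n, G.MemH1 (u n)) (hmass : ∀ n, G.mass (u n) = μ)
    (henergy : Tendsto (fun n => G.genEnergy p q κ (u n)) atTop (𝓝 I))
    {U : GraphFunction V B H 𝕜} (hU : G.IsLimit u U) (hU0 : 0 < G.mass U) :
    ∃ c : 𝕜, c ≠ 0 ∧ G.MemH1 (U.scale c) ∧ G.mass (U.scale c) = μ ∧
      G.genEnergy p q κ (U.scale c) ≤ I := by
  set m := G.mass U with hm
  have hv := fun n => (hu n).diff hU.memH1
  have hvmass : Tendsto (fun n => G.mass ((u n).diff U)) atTop (𝓝 (μ - m)) := by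
    have := hU.mass.const_sub μ
    refine this.congr fun n => ?_
    rw [hmass]; ring
  have hmμ : m ≤ μ := sub_nonneg.1 (ge_of_tendsto' hvmass fun n => G.mass_nonneg _)
  have hμ : 0 < μ := hU0.trans_le hmμ
  -- Scaling up to mass `μ` has factor at least 1, where the energy grows at most like the mass.
  -- Applied to the remainders it bounds their energy below; applied to `U` it produces the
  -- minimizer.
  have scale_le : ∀ w : GraphFunction V B H 𝕜, G.MemH1 w → 0 < G.mass w → G.mass w ≤ μ →
      ∃ c : 𝕜, c ≠ 0 ∧ G.MemH1 (w.scale c) ∧ G.mass (w.scale c) = μ ∧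
        G.genEnergy p q κ (w.scale c) ≤ μ / G.mass w * G.genEnergy p q κ w := by
    intro w hw hw0 hwμ
    have hc : ‖((√(μ / G.mass w) : ℝ) : 𝕜)‖ ^ 2 = μ / G.mass w := by
      rw [RCLike.norm_ofReal, sq_abs, Real.sq_sqrt (by positivity)]
    have h1 : 1 ≤ ‖((√(μ / G.mass w) : ℝ) : 𝕜)‖ ^ 2 := by
      rw [hc, one_le_div hw0]; exact hwμ
    have h2 : 1 ≤ ‖((√(μ / G.mass w) : ℝ) : 𝕜)‖ := by
      nlinarith [norm_nonneg ((√(μ / G.mass w) : ℝ) : 𝕜)]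
    refine ⟨_, norm_pos_iff.1 (one_pos.trans_le h2), hw.scale _, ?_, ?_⟩
    · rw [mass_scale, hc, div_mul_cancel₀ _ hw0.ne']
    · have := hw.genEnergy_scale_le hp hq hκ h2
      rwa [hc] at this
  have hlow : ∀ᶠ n in atTop, G.mass ((u n).diff U) / μ * I ≤ G.genEnergy p q κ ((u n).diff U) := by
    -- The remainders eventually have mass below `μ` because `U` has taken a positive amount.
    filter_upwards [hvmass.eventually_lt_const (show μ - m < μ by linarith)] with n hn
    rcases (G.mass_nonneg ((u n).diff U)).eq_or_lt with h0 | h0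
    · rw [← h0, zero_div, zero_mul]
      exact hG.genEnergy_nonneg_of_mass_eq_zero (hv n) h0.symm hp hq
    · obtain ⟨c, -, hc1, hc2, hc3⟩ := scale_le _ (hv n) h0 hn.le
      have := (hI _ hc1 hc2).trans hc3
      rw [div_mul_eq_mul_div, div_le_iff₀ hμ]
      rw [div_mul_eq_mul_div, le_div_iff₀ h0] at this
      linarith
  have hUle : G.genEnergy p q κ U ≤ m / μ * I := by
    -- The energy of `U` is the limit of total energy minus remainder energy, hence at most `I - (μ
    -- - m) / μ * I`. Neither strict subadditivity nor the sign of `I` is used.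
    have h1 := hU.genEnergy (κ := κ) hp (show 0 < q by linarith)
    have h2 : Tendsto (fun n => G.genEnergy p q κ (u n) - G.mass ((u n).diff U) / μ * I) atTop
        (𝓝 (I - (μ - m) / μ * I)) := henergy.sub ((hvmass.div_const μ).mul_const I)
    have h3 : I - (μ - m) / μ * I = m / μ * I := by field_simp; ring
    rw [h3] at h2
    refine le_of_tendsto_of_tendsto h1 h2 ?_
    filter_upwards [hlow] with n hn
    linarith
  obtain ⟨c, hc0, hc1, hc2, hc3⟩ := scale_le U hU.memH1 hU0 hmμ
  refine ⟨c, hc0, hc1, hc2, hc3.trans ?_⟩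
  calc μ / m * G.genEnergy p q κ U ≤ μ / m * (m / μ * I) := by gcongr
    _ = I := by field_simp

/-- Minimizing sequences exist, are bounded in `H¹`, and have local limits. -/
theorem Covered.exists_minimizing {G : MetricGraph V B H} (hG : G.Covered)
    {p q κ μ : ℝ} (hp : 2 < p ∧ p < 6) (hq : 2 < q ∧ q < 4) (hκ : 0 ≤ κ)
    (hne : ∃ w : GraphFunction V B H 𝕜, G.MemH1 w ∧ G.mass w = μ) :
    ∃ (I K : ℝ) (u : ℕ → GraphFunction V B H 𝕜),
      (∀ w : GraphFunction V B H 𝕜, G.MemH1 w → G.mass w = μ → I ≤ G.genEnergy p q κ w) ∧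
      (∀ n, G.MemH1 (u n)) ∧ (∀ n, G.mass (u n) = μ) ∧ (∀ n, G.kinetic (u n) ≤ K) ∧
      Tendsto (fun n => G.genEnergy p q κ (u n)) atTop (𝓝 I) := by
  obtain ⟨C, hC⟩ := hG.exists_coercive 𝕜 hp hq hκ μ
  set S : Set ℝ := {t | ∃ w : GraphFunction V B H 𝕜, G.MemH1 w ∧ G.mass w = μ ∧
    G.genEnergy p q κ w = t} with hS
  have hbdd : BddBelow S := by
    refine ⟨-C, ?_⟩
    rintro _ ⟨w, hw, hwμ, rfl⟩
    linarith [hC w hw hwμ, G.kinetic_nonneg w]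
  have hSne : S.Nonempty := by
    obtain ⟨w, hw, hwμ⟩ := hne
    exact ⟨_, w, hw, hwμ, rfl⟩
  obtain ⟨t, -, htend, htS⟩ := exists_seq_tendsto_sInf hSne hbdd
  choose u hu hmass hen using htS
  obtain ⟨T, hT⟩ := htend.bddAbove_range
  refine ⟨sInf S, 4 * (T + C), u, fun w hw hwμ => csInf_le hbdd ⟨w, hw, hwμ, rfl⟩, hu, hmass,
    fun n => ?_, by simpa only [hen] using htend⟩
  have h1 := hC (u n) (hu n) (hmass n)
  have h2 := hT (mem_range_self n)
  rw [hen] at h1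
  linarith

end MetricGraph

/-! ### Dilations and exponentials on the half-line -/

section HalfLine

variable {𝕜 : Type*} [RCLike 𝕜]

theorem isEdgeDomain_Ici : IsEdgeDomain 1 (Ici 0) := Or.inr rfl

theorem MeasureTheory.MemLp.comp_dilation_Ici {f : ℝ → 𝕜} (hf : MemLp f 2 (volume.restrict (Ici 0)))
    {τ : ℝ} (hτ : 0 < τ) : MemLp (fun x => f (τ * x)) 2 (volume.restrict (Ici 0)) := by
  have h0 : MemLp ((Ici 0).indicator f) 2 volume := (memLp_indicator_iff_restrict measurableSet_Ici).2 hf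
  have hmap : Measure.map (fun x : ℝ => τ * x) volume = ENNReal.ofReal |τ⁻¹| • volume :=
    Real.map_volume_mul_left hτ.ne'
  have h1 : MemLp ((Ici 0).indicator f) 2 (Measure.map (fun x : ℝ => τ * x) volume) := by
    rw [hmap]; exact h0.smul_measure (by simp)
  have h2 := (h1.comp_of_map (measurable_const_mul τ).aemeasurable).restrict (Ici 0)
  refine (memLp_congr_ae ?_).1 h2
  filter_upwards [ae_restrict_mem measurableSet_Ici] with x hx
  simp only [Function.comp]
  exact indicator_of_mem (mul_nonneg hτ.le hx) f

theorem H1On.dilate {f g : ℝ → 𝕜} (h : H1On (Ici 0) f g) (σ : ℝ) {τ : ℝ} (hτ : 0 < τ) :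
    H1On (Ici 0) (fun x => (σ : 𝕜) * f (τ * x)) fun x => ((σ * τ : ℝ) : 𝕜) * g (τ * x) where
  eq_integral x hx := by
    have hx' : τ * x ∈ Ici (0 : ℝ) := mul_nonneg hτ.le hx
    rw [h.eq_integral _ hx', intervalIntegral.integral_const_mul,
      intervalIntegral.integral_comp_mul_left _ hτ.ne', mul_zero, RCLike.real_smul_eq_coe_mul]
    push_cast
    have : (τ : 𝕜) ≠ 0 := by exact_mod_cast hτ.ne'
    field_simp
  memLp := (h.memLp.comp_dilation_Ici hτ).const_mul _
  deriv_memLp := (h.deriv_memLp.comp_dilation_Ici hτ).const_mul _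

theorem integral_Ici_comp_mul_left (F : ℝ → ℝ) {τ : ℝ} (hτ : 0 < τ) :
    ∫ x in Ici 0, F (τ * x) = τ⁻¹ * ∫ x in Ici 0, F x := by
  rw [integral_Ici_eq_integral_Ioi, integral_Ici_eq_integral_Ioi, integral_comp_mul_left_Ioi _ _ hτ,
    mul_zero, smul_eq_mul]

theorem integral_norm_rpow_dilate (f : ℝ → 𝕜) {σ τ : ℝ} (hσ : 0 < σ) (hτ : 0 < τ) (r : ℝ) :
    ∫ x in Ici 0, ‖(σ : 𝕜) * f (τ * x)‖ ^ r = σ ^ r * τ⁻¹ * ∫ x in Ici 0, ‖f x‖ ^ r := by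
  simp_rw [norm_mul, Real.mul_rpow (norm_nonneg _) (norm_nonneg _), integral_const_mul]
  rw [integral_Ici_comp_mul_left (fun x => ‖f x‖ ^ r) hτ, RCLike.norm_ofReal, abs_of_pos hσ]
  ring

theorem integral_norm_sq_dilate (f : ℝ → 𝕜) {σ τ : ℝ} (hτ : 0 < τ) :
    ∫ x in Ici 0, ‖(σ : 𝕜) * f (τ * x)‖ ^ 2 = σ ^ 2 * τ⁻¹ * ∫ x in Ici 0, ‖f x‖ ^ 2 := by
  simp_rw [norm_mul, mul_pow, integral_const_mul]
  rw [integral_Ici_comp_mul_left (fun x => ‖f x‖ ^ 2) hτ, RCLike.norm_ofReal, sq_abs]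
  ring

theorem integral_Ici_exp_neg_mul {a : ℝ} (ha : 0 < a) :
    ∫ x in Ici (0 : ℝ), Real.exp (-a * x) = a⁻¹ := by
  rw [integral_Ici_eq_integral_Ioi, integral_exp_mul_Ioi (by linarith)]
  simp

theorem h1On_exp (a : 𝕜) : H1On (Ici 0) (fun x => a * (Real.exp (-x) : ℝ))
    fun x => -(a * (Real.exp (-x) : ℝ)) := by
  have hmem : MemLp (fun x : ℝ => a * ((Real.exp (-x) : ℝ) : 𝕜)) 2 (volume.restrict (Ici 0)) := by
    refine MemLp.const_mul ?_ a
    rw [memLp_two_iff_integrable_sq_norm (by fun_prop)]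
    have : ∀ x : ℝ, ‖((Real.exp (-x) : ℝ) : 𝕜)‖ ^ 2 = Real.exp (-2 * x) := fun x => by
      rw [RCLike.norm_ofReal, abs_of_pos (Real.exp_pos _), ← Real.exp_nat_mul]
      congr 1; push_cast; ring
    simp_rw [this]
    exact (integrableOn_Ici_iff_integrableOn_Ioi).2 (integrableOn_exp_mul_Ioi (by norm_num) 0)
  refine ⟨fun x _ => ?_, hmem, hmem.neg⟩
  have hder : ∀ t ∈ uIcc 0 x, HasDerivAt (fun x : ℝ => a * ((Real.exp (-x) : ℝ) : 𝕜))
      (-(a * ((Real.exp (-t) : ℝ) : 𝕜))) t := by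
    intro t _
    have h1 : HasDerivAt (fun x : ℝ => Real.exp (-x)) (Real.exp (-t) * -1) t :=
      (hasDerivAt_neg t).exp
    have h2 := ((RCLike.ofRealCLM (K := 𝕜)).hasFDerivAt.comp_hasDerivAt t h1).const_mul a
    have h3 : a * RCLike.ofRealCLM (K := 𝕜) (Real.exp (-t) * -1) = -(a * ((Real.exp (-t) : ℝ) : 𝕜)) := by
      rw [RCLike.ofRealCLM_apply]; push_cast; ring
    rw [h3] at h2
    exact h2
  rw [intervalIntegral.integral_eq_sub_of_hasDerivAt hder
    (Continuous.intervalIntegrable (by fun_prop) _ _)]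
  abel

theorem integral_norm_exp_rpow (a : 𝕜) {r : ℝ} (hr : 0 < r) :
    ∫ x in Ici (0:ℝ), ‖a * ((Real.exp (-x) : ℝ) : 𝕜)‖ ^ r = ‖a‖ ^ r * r⁻¹ := by
  simp_rw [norm_mul, Real.mul_rpow (norm_nonneg _) (norm_nonneg _), integral_const_mul,
    RCLike.norm_ofReal, abs_of_pos (Real.exp_pos _), ← Real.exp_mul]
  rw [← integral_Ici_exp_neg_mul hr]
  congr 2
  ext x; congr 1; ring

theorem integral_norm_exp_sq (a : 𝕜) :
    ∫ x in Ici (0:ℝ), ‖a * ((Real.exp (-x) : ℝ) : 𝕜)‖ ^ 2 = ‖a‖ ^ 2 / 2 := by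
  have := integral_norm_exp_rpow a (r := 2) (by norm_num)
  simp only [Real.rpow_two] at this
  rw [this]; ring

end HalfLine

/-! ### Passing between pairs of half-lines and the line; translations -/

section Line

variable {𝕜 : Type*} [RCLike 𝕜]

theorem MeasureTheory.MemLp.comp_reflect {F : ℝ → 𝕜} (hF : MemLp F 2 volume) (x₀ : ℝ) :
    MemLp (fun x => F (x₀ - x)) 2 volume :=
  hF.comp_measurePreserving (Measure.measurePreserving_sub_left volume x₀)

theorem MeasureTheory.MemLp.comp_translate {F : ℝ → 𝕜} (hF : MemLp F 2 volume) (x₀ : ℝ) :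
    MemLp (fun x => F (x₀ + x)) 2 volume :=
  hF.comp_measurePreserving (measurePreserving_add_left volume x₀)

/-- Two `H¹` functions on half-lines glued at the origin. -/
structure LinePair (f g : Bool → ℝ → 𝕜) : Prop where
  h1On : ∀ b, H1On (Ici 0) (f b) (g b)
  glue : f true 0 = f false 0

/-- The function on the whole line whose restrictions to the half-lines are `f`; the sign `s`
multiplies the part on the negative half-line. -/
noncomputable def joinLine (s : 𝕜) (f : Bool → ℝ → 𝕜) (x : ℝ) : 𝕜 :=
  (Ioi 0).indicator (f true) x + (Iic 0).indicator (fun x => s * f false (0 - x)) x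

theorem joinLine_of_pos (s : 𝕜) (f : Bool → ℝ → 𝕜) {x : ℝ} (hx : 0 < x) :
    joinLine s f x = f true x := by
  simp [joinLine, hx, hx.not_ge]

theorem joinLine_of_nonpos (s : 𝕜) (f : Bool → ℝ → 𝕜) {x : ℝ} (hx : x ≤ 0) :
    joinLine s f x = s * f false (-x) := by
  simp [joinLine, hx, hx.not_gt]

theorem memLp_joinLine (s : 𝕜) {f : Bool → ℝ → 𝕜}
    (hf : ∀ b, MemLp (f b) 2 (volume.restrict (Ici 0))) : MemLp (joinLine s f) 2 volume := by
  refine MemLp.add ?_ ?_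
  · exact (memLp_indicator_iff_restrict measurableSet_Ioi).2
      ((hf true).mono_measure (Measure.restrict_mono_set _ Ioi_subset_Ici_self))
  · have h1 := ((memLp_indicator_iff_restrict measurableSet_Ici).2 (hf false)).comp_reflect 0
    refine (memLp_congr_ae (Eventually.of_forall fun x => ?_)).1 (h1.const_mul s)
    by_cases hx : x ≤ 0
    · simp [hx]
    · simp [hx]

theorem integral_joinLine (Ψ : 𝕜 → ℝ) {s : 𝕜} (hs : ∀ z, Ψ (s * z) = Ψ z) {f : Bool → ℝ → 𝕜}
    (hi : Integrable fun x => Ψ (joinLine s f x)) :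
    ∫ x, Ψ (joinLine s f x) = (∫ x in Ici 0, Ψ (f true x)) + ∫ x in Ici 0, Ψ (f false x) := by
  rw [← integral_add_compl (measurableSet_Ioi (a := (0:ℝ))) hi, compl_Ioi,
    integral_Ici_eq_integral_Ioi, integral_Ici_eq_integral_Ioi]
  congr 1
  · exact setIntegral_congr_fun measurableSet_Ioi fun x hx => by rw [joinLine_of_pos s f hx]
  · have h2 := integral_comp_neg_Iic (0:ℝ) (fun x => Ψ (f false x))
    rw [neg_zero] at h2
    rw [← h2]
    exact setIntegral_congr_fun measurableSet_Iic fun x hx => by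
      rw [joinLine_of_nonpos s f hx, hs]

/-- The negative half-line is parametrized backwards, so values are joined with sign `1` and
derivatives with sign `-1`; `glue` makes the primitive continuous at the origin. -/
theorem LinePair.joinLine_eq {f g : Bool → ℝ → 𝕜} (h : LinePair f g) (x y : ℝ) :
    joinLine 1 f y - joinLine 1 f x = ∫ t in x..y, joinLine (-1) g t := by
  have hloc : ∀ a b, IntervalIntegrable (joinLine (-1) g) volume a b := fun a b =>
    (intervalIntegrable_iff' (by simp)).2 (LocallyIntegrable.integrableOn_isCompact
      ((memLp_joinLine (-1) fun b => (h.h1On b).deriv_memLp).locallyIntegrable (by norm_num))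
      isCompact_uIcc)
  have key : ∀ z, joinLine 1 f z = f true 0 + ∫ t in (0:ℝ)..z, joinLine (-1) g t := by
    intro z
    rcases lt_or_ge 0 z with hz | hz
    · rw [joinLine_of_pos _ _ hz, (h.h1On true).eq_integral z hz.le,
        intervalIntegral.integral_of_le hz.le, intervalIntegral.integral_of_le hz.le]
      congr 1
      exact setIntegral_congr_fun measurableSet_Ioc fun t ht => (joinLine_of_pos _ _ ht.1).symm
    · rw [joinLine_of_nonpos _ _ hz, one_mul, (h.h1On false).eq_integral (-z) (neg_nonneg.2 hz),
        h.glue, intervalIntegral.integral_symm z 0]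
      congr 1
      have h1 := intervalIntegral.integral_comp_neg (a := z) (b := 0) (fun t => g false t)
      rw [neg_zero] at h1
      rw [← h1, intervalIntegral.integral_of_le hz, intervalIntegral.integral_of_le hz,
        ← integral_neg]
      refine setIntegral_congr_fun measurableSet_Ioc fun t ht => ?_
      rw [joinLine_of_nonpos _ _ ht.2]; ring
  rw [key, key, ← intervalIntegral.integral_interval_sub_left (hloc 0 y) (hloc 0 x)]
  abel

/-- The restrictions of a function on the line to the half-lines on both sides of `x₀`; the sign
`s` multiplies the part on the left. -/
def splitLine (s : 𝕜) (F : ℝ → 𝕜) (x₀ : ℝ) (b : Bool) (x : ℝ) : 𝕜 :=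
  bif b then F (x₀ + x) else s * F (x₀ - x)

theorem linePair_splitLine {F G : ℝ → 𝕜} (hF : MemLp F 2 volume) (hG : MemLp G 2 volume)
    (h : ∀ x y, F y - F x = ∫ t in x..y, G t) (x₀ : ℝ) :
    LinePair (splitLine 1 F x₀) (splitLine (-1) G x₀) where
  h1On b := by
    cases b
    · refine ⟨fun x _ => ?_, ((hF.comp_reflect x₀).const_mul 1).restrict _,
        ((hG.comp_reflect x₀).const_mul (-1)).restrict _⟩
      simp only [splitLine, cond_false, one_mul, intervalIntegral.integral_const_mul, sub_zero]
      rw [intervalIntegral.integral_comp_sub_left, sub_zero, ← h]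
      ring
    · refine ⟨fun x _ => ?_, (hF.comp_translate x₀).restrict _, (hG.comp_translate x₀).restrict _⟩
      simp only [splitLine, cond_true, add_zero]
      rw [intervalIntegral.integral_comp_add_left, add_zero, ← h]
      ring
  glue := by simp [splitLine]

theorem integral_splitLine (Ψ : 𝕜 → ℝ) {s : 𝕜} (hs : ∀ z, Ψ (s * z) = Ψ z) {F : ℝ → 𝕜}
    (hi : Integrable fun x => Ψ (F x)) (x₀ : ℝ) :
    (∫ x in Ici 0, Ψ (splitLine s F x₀ true x)) + ∫ x in Ici 0, Ψ (splitLine s F x₀ false x)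
      = ∫ x, Ψ (F x) := by
  simp only [splitLine, cond_true, cond_false, hs]
  have hi' : Integrable fun x => Ψ (F (x₀ + x)) := hi.comp_add_left x₀
  rw [← integral_add_left_eq_self (fun x => Ψ (F x)) x₀,
    ← integral_add_compl (measurableSet_Ioi (a := (0:ℝ))) hi', compl_Ioi,
    integral_Ici_eq_integral_Ioi, integral_Ici_eq_integral_Ioi]
  congr 1
  have h2 := integral_comp_neg_Iic (0:ℝ) (fun x => Ψ (F (x₀ - x)))
  rw [neg_zero] at h2
  rw [← h2]
  simp only [sub_neg_eq_add]

/-- A pair can be translated so that a given point becomes the origin. -/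
theorem LinePair.exists_translate {f g : Bool → ℝ → 𝕜} (h : LinePair f g) (b : Bool) {x : ℝ}
    (hx : 0 ≤ x) : ∃ f' g' : Bool → ℝ → 𝕜, LinePair f' g' ∧ f' true 0 = f b x ∧
      ∑ c, ∫ t in Ici 0, ‖f' c t‖ ^ 2 = ∑ c, ∫ t in Ici 0, ‖f c t‖ ^ 2 ∧
      ∑ c, ∫ t in Ici 0, ‖g' c t‖ ^ 2 = ∑ c, ∫ t in Ici 0, ‖g c t‖ ^ 2 ∧
      ∀ r : ℝ, 2 ≤ r →
        ∑ c, ∫ t in Ici 0, ‖f' c t‖ ^ r = ∑ c, ∫ t in Ici 0, ‖f c t‖ ^ r := by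
  set x₀ : ℝ := bif b then x else -x with hx₀
  have hF := memLp_joinLine 1 fun b => (h.h1On b).memLp
  have hG := memLp_joinLine (-1) fun b => (h.h1On b).deriv_memLp
  have hval : joinLine 1 f x₀ = f b x := by
    cases b
    · simp only [hx₀, cond_false]
      rw [joinLine_of_nonpos _ _ (by linarith), neg_neg, one_mul]
    · simp only [hx₀, cond_true]
      rcases hx.eq_or_lt with rfl | hx
      · rw [joinLine_of_nonpos _ _ le_rfl, neg_zero, one_mul, h.glue]
      · rw [joinLine_of_pos _ _ hx]
  have hbd : ∃ M, ∀ x, ‖joinLine 1 f x‖ ≤ M := by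
    have hb : ∀ b, ∃ M, ∀ x ∈ Ici (0:ℝ), ‖f b x‖ ≤ M := fun b =>
      ⟨_, fun x hx => (h.h1On b).norm_le isEdgeDomain_Ici zero_le_one hx one_pos le_rfl⟩
    choose M hM using hb
    refine ⟨max (M true) (M false), fun x => ?_⟩
    rcases lt_or_ge 0 x with hx | hx
    · rw [joinLine_of_pos _ _ hx]; exact (hM true x hx.le).trans (le_max_left _ _)
    · rw [joinLine_of_nonpos _ _ hx, one_mul]
      exact (hM false (-x) (neg_nonneg.2 hx)).trans (le_max_right _ _)
  obtain ⟨M, hM⟩ := hbd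
  have hF2 : Integrable fun x => ‖joinLine 1 f x‖ ^ 2 := (memLp_two_iff_integrable_sq_norm hF.1).1 hF
  have hG2 : Integrable fun x => ‖joinLine (-1) g x‖ ^ 2 :=
    (memLp_two_iff_integrable_sq_norm hG.1).1 hG
  refine ⟨splitLine 1 (joinLine 1 f) x₀, splitLine (-1) (joinLine (-1) g) x₀,
    linePair_splitLine hF hG h.joinLine_eq x₀, ?_, ?_, ?_, fun r hr => ?_⟩
  · simp [splitLine, hval]
  · rw [Fintype.sum_bool, Fintype.sum_bool, integral_splitLine (fun z => ‖z‖ ^ 2) (by simp) hF2,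
      integral_joinLine (fun z => ‖z‖ ^ 2) (by simp) hF2]
  · rw [Fintype.sum_bool, Fintype.sum_bool, integral_splitLine (fun z => ‖z‖ ^ 2) (by simp) hG2,
      integral_joinLine (fun z => ‖z‖ ^ 2) (by simp) hG2]
  · have hFr : Integrable fun x => ‖joinLine 1 f x‖ ^ r :=
      hF.integrable_norm_rpow_of_bdd hr (Eventually.of_forall hM)
    rw [Fintype.sum_bool, Fintype.sum_bool, integral_splitLine (fun z => ‖z‖ ^ r) (by simp) hFr,
      integral_joinLine (fun z => ‖z‖ ^ r) (by simp) hFr]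

end Line

/-! ### The minimization problem on the line -/

section LineProblem

variable {𝕜 : Type*} [RCLike 𝕜]

/-- The mass of a pair of functions on half-lines. -/
noncomputable def pairMass (f : Bool → ℝ → 𝕜) : ℝ := ∑ b, ∫ x in Ici 0, ‖f b x‖ ^ 2

/-- The energy on the line, without vertex nonlinearity, of a pair of functions on half-lines. -/
noncomputable def pairEnergy (p : ℝ) (f g : Bool → ℝ → 𝕜) : ℝ :=
  1 / 2 * (∑ b, ∫ x in Ici 0, ‖g b x‖ ^ 2) - 1 / p * ∑ b, ∫ x in Ici 0, ‖f b x‖ ^ p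

theorem pairMass_nonneg (f : Bool → ℝ → 𝕜) : 0 ≤ pairMass f :=
  Finset.sum_nonneg fun i _ => integral_nonneg fun x => by positivity

/-- The line, as a metric graph with two half-lines. -/
def lineGraph : MetricGraph Unit Empty Bool where
  src := Empty.elim
  tgt := Empty.elim
  len := Empty.elim
  len_pos e := e.elim
  base _ := ()

theorem lineGraph_covered : lineGraph.Covered := fun _ => Or.inr (Or.inr ⟨true, rfl⟩)

/-- The function on the line determined by its restrictions to the half-lines. -/
def pairFunction (f : Bool → ℝ → 𝕜) : GraphFunction Unit Empty Bool 𝕜 :=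
  GraphFunction.ofBranch (fun _ => f true 0) (Sum.elim (fun e => e.elim) f)

theorem LinePair.hasWeakDeriv {f g : Bool → ℝ → 𝕜} (h : LinePair f g) :
    lineGraph.HasWeakDeriv (pairFunction f) (Sum.elim (fun e => e.elim) g) where
  edge_src e := e.elim
  edge_tgt e := e.elim
  ray_base b := by
    cases b
    · exact h.glue.symm
    · rfl
  h1On i := by
    rcases i with e | b
    · exact e.elim
    · exact h.h1On b

theorem MetricGraph.MemH1.linePair {u : GraphFunction Unit Empty Bool 𝕜} (hu : lineGraph.MemH1 u) :
    LinePair u.ray fun b => deriv (u.ray b) where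
  h1On b := hu.hasWeakDeriv.h1On (Sum.inr b)
  glue := (hu.ray_base true).trans (hu.ray_base false).symm

theorem lineGraph_mass (u : GraphFunction Unit Empty Bool 𝕜) :
    lineGraph.mass u = pairMass u.ray := by
  rw [MetricGraph.mass_eq, Fintype.sum_sum_type, Finset.univ_eq_empty, Finset.sum_empty, zero_add]
  rfl

theorem lineGraph_power (r : ℝ) (u : GraphFunction Unit Empty Bool 𝕜) :
    lineGraph.powerIntegral r u = ∑ b, ∫ x in Ici 0, ‖u.ray b x‖ ^ r := by
  rw [MetricGraph.powerIntegral_eq, Fintype.sum_sum_type, Finset.univ_eq_empty, Finset.sum_empty,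
    zero_add]
  rfl

theorem MetricGraph.HasWeakDeriv.lineGraph_kinetic {u : GraphFunction Unit Empty Bool 𝕜}
    {g : Empty ⊕ Bool → ℝ → 𝕜} (h : lineGraph.HasWeakDeriv u g) :
    lineGraph.kinetic u = ∑ b, ∫ x in Ici 0, ‖g (Sum.inr b) x‖ ^ 2 := by
  rw [h.kinetic_eq, Fintype.sum_sum_type, Finset.univ_eq_empty, Finset.sum_empty, zero_add]
  rfl

theorem LinePair.genEnergy_eq {f g : Bool → ℝ → 𝕜} (h : LinePair f g) (p q : ℝ) :
    lineGraph.genEnergy p q 0 (pairFunction f) = pairEnergy p f g := by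
  rw [MetricGraph.genEnergy, h.hasWeakDeriv.lineGraph_kinetic, lineGraph_power, pairEnergy,
    zero_mul, sub_zero]
  rfl

theorem MetricGraph.MemH1.pairEnergy_eq {u : GraphFunction Unit Empty Bool 𝕜}
    (hu : lineGraph.MemH1 u) (p q : ℝ) :
    pairEnergy p u.ray (fun b => deriv (u.ray b)) = lineGraph.genEnergy p q 0 u := by
  rw [MetricGraph.genEnergy, hu.hasWeakDeriv.lineGraph_kinetic, lineGraph_power, pairEnergy,
    zero_mul, sub_zero]
  rfl

/-- Dilation of a pair of functions on half-lines. -/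
def dilatePair (c τ : ℝ) (f : Bool → ℝ → 𝕜) (b : Bool) (x : ℝ) : 𝕜 := (c : 𝕜) * f b (τ * x)

theorem LinePair.dilate {f g : Bool → ℝ → 𝕜} (h : LinePair f g) (σ : ℝ) {τ : ℝ} (hτ : 0 < τ) :
    LinePair (dilatePair σ τ f) (dilatePair (σ * τ) τ g) where
  h1On b := (h.h1On b).dilate σ hτ
  glue := by simp [dilatePair, h.glue]

theorem pairMass_dilate (f : Bool → ℝ → 𝕜) (σ : ℝ) {τ : ℝ} (hτ : 0 < τ) :
    pairMass (dilatePair σ τ f) = σ ^ 2 * τ⁻¹ * pairMass f := by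
  simp only [pairMass, dilatePair, integral_norm_sq_dilate _ hτ, Finset.mul_sum]

theorem pairEnergy_dilate (p : ℝ) (f g : Bool → ℝ → 𝕜) {σ τ : ℝ} (hσ : 0 < σ) (hτ : 0 < τ) :
    pairEnergy p (dilatePair σ τ f) (dilatePair (σ * τ) τ g) =
      σ ^ 2 * τ * (1 / 2 * ∑ b, ∫ x in Ici 0, ‖g b x‖ ^ 2) -
        σ ^ p * τ⁻¹ * (1 / p * ∑ b, ∫ x in Ici 0, ‖f b x‖ ^ p) := by
  simp only [pairEnergy, dilatePair, integral_norm_sq_dilate _ hτ,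
    integral_norm_rpow_dilate _ hσ hτ, ← Finset.mul_sum]
  field_simp

/-- The scaling that multiplies the mass by `m` multiplies the energy by a power of `m`. -/
theorem dilate_mass_energy {p : ℝ} (hp : 2 < p ∧ p < 6) {m : ℝ} (hm : 0 < m)
    (f g : Bool → ℝ → 𝕜) :
    pairMass (dilatePair (m ^ (2 / (6 - p))) (m ^ ((p - 2) / (6 - p))) f) = m * pairMass f ∧
    pairEnergy p (dilatePair (m ^ (2 / (6 - p))) (m ^ ((p - 2) / (6 - p))) f)
      (dilatePair (m ^ (2 / (6 - p)) * m ^ ((p - 2) / (6 - p))) (m ^ ((p - 2) / (6 - p))) g) =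
        m ^ ((p + 2) / (6 - p)) * pairEnergy p f g := by
  have h6 : 6 - p ≠ 0 := by linarith [hp.2]
  have hσ : 0 < m ^ (2 / (6 - p)) := Real.rpow_pos_of_pos hm _
  have hτ : 0 < m ^ ((p - 2) / (6 - p)) := Real.rpow_pos_of_pos hm _
  have e1 : (m ^ (2 / (6 - p))) ^ 2 * (m ^ ((p - 2) / (6 - p)))⁻¹ = m := by
    rw [← Real.rpow_natCast, ← Real.rpow_mul hm.le, ← Real.rpow_neg hm.le, ← Real.rpow_add hm]
    conv_rhs => rw [← Real.rpow_one m]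
    congr 1; push_cast; field_simp; ring
  have e2 : (m ^ (2 / (6 - p))) ^ 2 * m ^ ((p - 2) / (6 - p)) = m ^ ((p + 2) / (6 - p)) := by
    rw [← Real.rpow_natCast, ← Real.rpow_mul hm.le, ← Real.rpow_add hm]
    congr 1; push_cast; field_simp; ring
  have e3 : (m ^ (2 / (6 - p))) ^ p * (m ^ ((p - 2) / (6 - p)))⁻¹ = m ^ ((p + 2) / (6 - p)) := by
    rw [← Real.rpow_mul hm.le, ← Real.rpow_neg hm.le, ← Real.rpow_add hm]
    congr 1; field_simp; ring
  refine ⟨by rw [pairMass_dilate _ _ hτ, e1], ?_⟩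
  rw [pairEnergy_dilate p f g hσ hτ, e2, e3, pairEnergy]
  ring

/-- Spread `exp (-|x|)` at constant mass. With dilation factor `τ → 0` the kinetic energy is of
order `τ ^ 2` and the power integral of order `τ ^ (p / 2 - 1)`, which dominates since `p < 6`. -/
theorem exists_pair_negative_energy (𝕜 : Type*) [RCLike 𝕜] {p : ℝ} (hp : 2 < p ∧ p < 6) :
    ∃ f g : Bool → ℝ → 𝕜, LinePair f g ∧ pairMass f = 1 ∧ pairEnergy p f g < 0 := by
  set f₀ : Bool → ℝ → 𝕜 := fun _ x => 1 * ((Real.exp (-x) : ℝ) : 𝕜)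
  set g₀ : Bool → ℝ → 𝕜 := fun _ x => -(1 * ((Real.exp (-x) : ℝ) : 𝕜))
  have h₀ : LinePair f₀ g₀ := ⟨fun _ => h1On_exp 1, rfl⟩
  have hm : pairMass f₀ = 1 := by
    simp only [pairMass, f₀, integral_norm_exp_sq, Fintype.sum_bool, norm_one]
    norm_num
  have hp0 : 0 < p := by linarith [hp.1]
  set B : ℝ := 1 / p * (2 * p⁻¹)
  have hB : 0 < B := by positivity
  obtain ⟨τ, hτ, hlt⟩ : ∃ τ : ℝ, 0 < τ ∧ τ ^ ((6 - p) / 2) * (1 / 2) < B := by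
    have hc : Tendsto (fun τ : ℝ => τ ^ ((6 - p) / 2) * (1 / 2)) (𝓝[>] 0) (𝓝 0) := by
      have h1 : ContinuousAt (fun τ : ℝ => τ ^ ((6 - p) / 2)) 0 :=
        Real.continuousAt_rpow_const _ _ (Or.inr (by linarith [hp.2]))
      have h2 := (h1.tendsto.mul_const (1 / 2)).mono_left (nhdsWithin_le_nhds (s := Ioi 0))
      rwa [Real.zero_rpow (by linarith [hp.2]), zero_mul] at h2
    obtain ⟨τ, h1, h2⟩ := ((hc.eventually_lt_const hB).and self_mem_nhdsWithin).exists
    exact ⟨τ, h2, h1⟩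
  refine ⟨_, _, h₀.dilate (√τ) hτ, ?_, ?_⟩
  · rw [pairMass_dilate _ _ hτ, hm, Real.sq_sqrt hτ.le, mul_inv_cancel₀ hτ.ne', one_mul]
  · rw [pairEnergy_dilate p f₀ g₀ (Real.sqrt_pos.2 hτ) hτ, Real.sq_sqrt hτ.le]
    simp only [f₀, g₀, norm_neg, integral_norm_exp_sq, integral_norm_exp_rpow _ hp0,
      Fintype.sum_bool, norm_one, Real.one_rpow]
    have e1 : √τ ^ p * τ⁻¹ = τ ^ (p / 2 - 1) := by
      rw [Real.sqrt_eq_rpow, ← Real.rpow_mul hτ.le, ← Real.rpow_neg_one τ, ← Real.rpow_add hτ]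
      congr 1; ring
    have e2 : τ * τ = τ ^ (p / 2 - 1) * τ ^ ((6 - p) / 2) := by
      rw [← Real.rpow_add hτ, ← sq, ← Real.rpow_two]
      congr 1; ring
    have e3 : 0 < τ ^ (p / 2 - 1) := Real.rpow_pos_of_pos hτ _
    rw [e1, e2]
    have := mul_lt_mul_of_pos_left hlt e3
    have e4 : 1 / p * (1 * p⁻¹ + 1 * p⁻¹) = B := by simp only [B]; ring
    rw [e4]
    linarith

/-- The minimization problem on the line at mass `1` has a solution, which may be translated so as
not to vanish at the origin. -/
theorem exists_line_minimizer (𝕜 : Type*) [RCLike 𝕜] {p : ℝ} (hp : 2 < p ∧ p < 6) :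
    ∃ f g : Bool → ℝ → 𝕜, LinePair f g ∧ pairMass f = 1 ∧ pairEnergy p f g < 0 ∧ f true 0 ≠ 0 ∧
      ∀ f' g' : Bool → ℝ → 𝕜, LinePair f' g' → pairMass f' = 1 →
        pairEnergy p f g ≤ pairEnergy p f' g' := by
  obtain ⟨f₁, g₁, h₁, hm₁, he₁⟩ := exists_pair_negative_energy 𝕜 hp
  have hp0 : 0 < p := by linarith [hp.1]
  -- With `κ = 0` there is no vertex term, and `q = 3` is an arbitrary admissible value.
  obtain ⟨I, K, u, hI, hu, hmass, hkin, hen⟩ := lineGraph_covered.exists_minimizing (𝕜 := 𝕜)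
    (q := 3) (κ := 0) (μ := 1) hp (by norm_num) le_rfl
    ⟨_, h₁.hasWeakDeriv.memH1, (lineGraph_mass _).trans hm₁⟩
  have hI0 : I < 0 := by
    refine (hI _ h₁.hasWeakDeriv.memH1 ((lineGraph_mass _).trans hm₁)).trans_lt ?_
    rwa [h₁.genEnergy_eq]
  -- If `‖u‖ ≤ c` everywhere, then `∫ ‖u‖ ^ p / p ≤ -I / 4`, so the energy is at least `I / 4`. This
  -- contradicts an energy below `I / 2`, since `I < 0`.
  set c : ℝ := (-I * p / 4) ^ (1 / (p - 2)) with hc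
  have hb : 0 < -I * p / 4 := by
    have := mul_pos (neg_pos.2 hI0) hp0
    positivity
  have hc0 : 0 < c := Real.rpow_pos_of_pos hb _
  have hcp : c ^ (p - 2) = -I * p / 4 := by
    rw [hc, ← Real.rpow_mul hb.le, one_div_mul_cancel (by linarith [hp.1]), Real.rpow_one]
  have hex : ∀ᶠ n in atTop, ∃ b, ∃ x : ℝ, 0 ≤ x ∧ c < ‖(u n).ray b x‖ := by
    filter_upwards [hen.eventually_lt_const (show I < I / 2 by linarith)] with n hn
    by_contra! hcon
    have hP : lineGraph.powerIntegral p (u n) ≤ c ^ (p - 2) * 1 := by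
      rw [← hmass n]
      refine (hu n).powerIntegral_le hp.1.le fun i x hx => ?_
      rcases i with e | b
      · exact e.elim
      · exact hcon b x hx
    rw [hcp, mul_one] at hP
    have h1 := mul_le_mul_of_nonneg_left hP (show 0 ≤ 1 / p by positivity)
    have h2 : 1 / p * (-I * p / 4) = -I / 4 := by field_simp
    have h3 := lineGraph.kinetic_nonneg (u n)
    unfold MetricGraph.genEnergy at hn
    linarith
  -- Moving a point where the value exceeds `c` to the origin stops the sequence from escaping: the
  -- limit is then nonzero at the vertex. For the finitely many `n` without such a point, `u n` is
  -- kept.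
  have htr : ∀ n, ∃ w : GraphFunction Unit Empty Bool 𝕜, lineGraph.MemH1 w ∧
      lineGraph.mass w = 1 ∧ lineGraph.kinetic w = lineGraph.kinetic (u n) ∧
      lineGraph.genEnergy p 3 0 w = lineGraph.genEnergy p 3 0 (u n) ∧
      ((∃ b, ∃ x : ℝ, 0 ≤ x ∧ c < ‖(u n).ray b x‖) → c < ‖w.vertex ()‖) := by
    intro n
    have key : ∀ (b : Bool) (x : ℝ), 0 ≤ x → ∃ w : GraphFunction Unit Empty Bool 𝕜,
        lineGraph.MemH1 w ∧ lineGraph.mass w = 1 ∧ lineGraph.kinetic w = lineGraph.kinetic (u n) ∧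
        lineGraph.genEnergy p 3 0 w = lineGraph.genEnergy p 3 0 (u n) ∧
        w.vertex () = (u n).ray b x := by
      intro b x hx
      obtain ⟨f', g', h', hv, h1, h2, h3⟩ := (hu n).linePair.exists_translate b hx
      refine ⟨pairFunction f', h'.hasWeakDeriv.memH1, ?_, ?_, ?_, hv⟩
      · rw [← hmass n, lineGraph_mass, lineGraph_mass]; exact h1
      · rw [h'.hasWeakDeriv.lineGraph_kinetic, (hu n).hasWeakDeriv.lineGraph_kinetic]; exact h2
      · rw [h'.genEnergy_eq, ← (hu n).pairEnergy_eq, pairEnergy, pairEnergy, h2, h3 p hp.1.le]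
    by_cases hx : ∃ b, ∃ x : ℝ, 0 ≤ x ∧ c < ‖(u n).ray b x‖
    · obtain ⟨b, x, hx0, hcx⟩ := hx
      obtain ⟨w, hw1, hw2, hw3, hw4, hw5⟩ := key b x hx0
      exact ⟨w, hw1, hw2, hw3, hw4, fun _ => by rwa [hw5]⟩
    · exact ⟨u n, hu n, hmass n, rfl, rfl, fun h => absurd h hx⟩
  choose w hw1 hw2 hw3 hw4 hw5 using htr
  obtain ⟨φ, hφ, U, hU⟩ := lineGraph_covered.exists_isLimit hw1 (fun n => (hw2 n).le)
    (fun n => (hw3 n).trans_le (hkin n))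
  have hUv : c ≤ ‖U.vertex ()‖ := by
    refine ge_of_tendsto (hU.vertex ()).norm ?_
    filter_upwards [hφ.tendsto_atTop.eventually hex] with n hn using (hw5 _ hn).le
  have hU0 : 0 < lineGraph.mass U := by
    refine (lineGraph.mass_nonneg U).lt_of_ne' fun h0 => ?_
    have := (lineGraph_covered.eq_zero_of_mass_eq_zero hU.memH1 h0).2 ()
    rw [this, norm_zero] at hUv
    linarith
  obtain ⟨a, ha, h1, h2, h3⟩ := lineGraph_covered.exists_minimizer_of_isLimit hp.1.le
    (show (2:ℝ) ≤ 3 by norm_num) le_rfl hI (u := w ∘ φ) (fun n => hw1 _) (fun n => hw2 _)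
    ((hen.congr fun n => (hw4 n).symm).comp hφ.tendsto_atTop) hU hU0
  rw [← h1.pairEnergy_eq] at h3
  refine ⟨_, _, h1.linePair, (lineGraph_mass _).symm.trans h2, h3.trans_lt hI0, ?_,
    fun f' g' h' hm' => h3.trans ?_⟩
  · have h4 : (U.scale a).ray true 0 = a * U.vertex () := h1.ray_base true
    rw [h4]
    exact mul_ne_zero ha (norm_pos_iff.1 (hc0.trans_le hUv))
  · rw [← h'.genEnergy_eq p 3]
    exact hI _ h'.hasWeakDeriv.memH1 ((lineGraph_mass _).trans hm')

/-- A lower bound for the energy at mass `1` scales to all masses. -/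
theorem LinePair.le_energy {p : ℝ} (hp : 2 < p ∧ p < 6) {e : ℝ}
    (he : ∀ f g : Bool → ℝ → 𝕜, LinePair f g → pairMass f = 1 → e ≤ pairEnergy p f g)
    {f g : Bool → ℝ → 𝕜} (h : LinePair f g) :
    e * pairMass f ^ ((p + 2) / (6 - p)) ≤ pairEnergy p f g := by
  have h6 : 0 < (p + 2) / (6 - p) := div_pos (by linarith [hp.1]) (by linarith [hp.2])
  rcases (pairMass_nonneg f).eq_or_lt with h0 | h0
  · rw [← h0, Real.zero_rpow h6.ne', mul_zero, ← h.genEnergy_eq p 3]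
    exact lineGraph_covered.genEnergy_nonneg_of_mass_eq_zero h.hasWeakDeriv.memH1
      ((lineGraph_mass _).trans h0.symm) hp.1.le (by norm_num)
  · have hm := inv_pos.2 h0
    obtain ⟨h1, h2⟩ := dilate_mass_energy hp hm f g
    have h3 := he _ _ (h.dilate ((pairMass f)⁻¹ ^ (2 / (6 - p))) (Real.rpow_pos_of_pos hm _))
      (h1.trans (inv_mul_cancel₀ h0.ne'))
    rw [h2, Real.inv_rpow h0.le, inv_mul_eq_div, le_div_iff₀ (Real.rpow_pos_of_pos h0 _)] at h3
    exact h3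

end LineProblem

/-! ### Lower bound for sequences escaping along the half-lines -/

theorem Finset.sum_rpow_le_rpow_sum {ι : Type*} (t : Finset ι) {x : ι → ℝ} (hx : ∀ i, 0 ≤ x i)
    {s : ℝ} (hs : 1 ≤ s) : ∑ i ∈ t, x i ^ s ≤ (∑ i ∈ t, x i) ^ s := by
  classical
  induction t using Finset.induction with
  | empty => simp [Real.zero_rpow (show s ≠ 0 by linarith)]
  | insert a t ha ih =>
    rw [Finset.sum_insert ha, Finset.sum_insert ha]
    refine le_trans ?_ (Real.add_rpow_le_rpow_add (hx a) (Finset.sum_nonneg fun i _ => hx i) hs)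
    gcongr

namespace MetricGraph

variable {V B H 𝕜 : Type*} [RCLike 𝕜]

/-- Continue `u` beyond the origin of the half-line by `a * exp (-x)`. This gives a function on the
line with extra mass `‖a‖ ^ 2 / 2`, and the added energy is at most `‖a‖ ^ 2 / 4`. Both errors
vanish when the vertex value does. -/
theorem MemH1.ray_energy_ge {G : MetricGraph V B H} {u : GraphFunction V B H 𝕜} (hu : G.MemH1 u)
    {p e : ℝ} (hp : 2 < p ∧ p < 6)
    (he : ∀ f g : Bool → ℝ → 𝕜, LinePair f g → pairMass f = 1 → e ≤ pairEnergy p f g) (h : H) :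
    e * ((∫ x in Ici 0, ‖u.ray h x‖ ^ 2) + ‖u.vertex (G.base h)‖ ^ 2 / 2) ^ ((p + 2) / (6 - p)) -
        ‖u.vertex (G.base h)‖ ^ 2 / 4 ≤
      1 / 2 * (∫ x in Ici 0, ‖deriv (u.ray h) x‖ ^ 2) - 1 / p * ∫ x in Ici 0, ‖u.ray h x‖ ^ p := by
  set a := u.vertex (G.base h)
  have hp0 : 0 < p := by linarith [hp.1]
  set f : Bool → ℝ → 𝕜 := fun b => bif b then u.ray h else fun x => a * ((Real.exp (-x) : ℝ) : 𝕜)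
  set g : Bool → ℝ → 𝕜 := fun b => bif b then deriv (u.ray h) else
    fun x => -(a * ((Real.exp (-x) : ℝ) : 𝕜))
  have hfg : LinePair f g := by
    refine ⟨fun b => ?_, ?_⟩
    · cases b
      · exact h1On_exp a
      · exact hu.hasWeakDeriv.h1On (Sum.inr h)
    · simp only [f, cond_true, cond_false, hu.ray_base h]
      simp [a]
  have hle := hfg.le_energy hp he
  simp only [pairMass, pairEnergy, Fintype.sum_bool, f, g, cond_true, cond_false, norm_neg,
    integral_norm_exp_sq, integral_norm_exp_rpow a hp0] at hle
  have : 0 ≤ 1 / p * (‖a‖ ^ p * p⁻¹) := by positivity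
  linarith

variable [Fintype V] [Fintype B] [Fintype H]

/-- Energy estimate from below in terms of the energy on the line and of the values on the compact
core. -/
theorem MemH1.genEnergy_ge {G : MetricGraph V B H} {u : GraphFunction V B H 𝕜} (hu : G.MemH1 u)
    {p q κ e : ℝ} (hp : 2 < p ∧ p < 6) (he0 : e ≤ 0)
    (he : ∀ f g : Bool → ℝ → 𝕜, LinePair f g → pairMass f = 1 → e ≤ pairEnergy p f g) :
    e * (G.mass u + ∑ h, ‖u.vertex (G.base h)‖ ^ 2 / 2) ^ ((p + 2) / (6 - p))
      - ∑ h, ‖u.vertex (G.base h)‖ ^ 2 / 4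
      - 1 / p * (∑ b, ∫ x in G.dom (Sum.inl b), ‖u.branch (Sum.inl b) x‖ ^ p)
      - κ * ∑ v, ‖u.vertex v‖ ^ q ≤ G.genEnergy p q κ u := by
  have h6 : 0 < 6 - p := by linarith [hp.2]
  have hs : 1 ≤ (p + 2) / (6 - p) := by rw [one_le_div h6]; linarith [hp.1]
  have hx : ∀ h, 0 ≤ (∫ x in Ici 0, ‖u.ray h x‖ ^ 2) + ‖u.vertex (G.base h)‖ ^ 2 / 2 := fun h =>
    add_nonneg (integral_nonneg fun x => by positivity) (by positivity)
  have h1 := Finset.sum_le_sum fun (h : H) (_ : h ∈ Finset.univ) => hu.ray_energy_ge hp he h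
  rw [Finset.sum_sub_distrib, Finset.sum_sub_distrib, ← Finset.mul_sum, ← Finset.mul_sum,
    ← Finset.mul_sum] at h1
  have h2 := Finset.sum_rpow_le_rpow_sum Finset.univ hx hs
  have h3 : (∑ h, ((∫ x in Ici 0, ‖u.ray h x‖ ^ 2) + ‖u.vertex (G.base h)‖ ^ 2 / 2)) ≤
      G.mass u + ∑ h, ‖u.vertex (G.base h)‖ ^ 2 / 2 := by
    rw [Finset.sum_add_distrib, mass_eq, Fintype.sum_sum_type]
    have : 0 ≤ ∑ b, ∫ x in G.dom (Sum.inl b), ‖u.branch (Sum.inl b) x‖ ^ 2 :=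
      Finset.sum_nonneg fun i _ => integral_nonneg fun x => by positivity
    have h4 : ∑ h, ∫ x in G.dom (Sum.inr h), ‖u.branch (Sum.inr h) x‖ ^ 2 =
      ∑ h, ∫ x in Ici 0, ‖u.ray h x‖ ^ 2 := rfl
    rw [h4]
    linarith
  -- As `s ≥ 1` and `e ≤ 0`, splitting mass among several half-lines never beats putting it all on
  -- one line.
  have h4 := mul_le_mul_of_nonpos_left (h2.trans (Real.rpow_le_rpow
    (Finset.sum_nonneg fun h _ => hx h) h3 (by linarith))) he0
  have h5 : ∑ h, ∫ x in Ici 0, ‖deriv (u.ray h) x‖ ^ 2 ≤ G.kinetic u := by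
    rw [hu.hasWeakDeriv.kinetic_eq, Fintype.sum_sum_type]
    have : 0 ≤ ∑ b, ∫ x in G.dom (Sum.inl b), ‖deriv (u.branch (Sum.inl b)) x‖ ^ 2 :=
      Finset.sum_nonneg fun i _ => integral_nonneg fun x => by positivity
    exact le_add_of_nonneg_left this
  have h6 : G.powerIntegral p u = (∑ b, ∫ x in G.dom (Sum.inl b), ‖u.branch (Sum.inl b) x‖ ^ p) +
      ∑ h, ∫ x in Ici 0, ‖u.ray h x‖ ^ p := by
    rw [powerIntegral_eq, Fintype.sum_sum_type]; rfl
  unfold genEnergy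
  rw [h6, mul_add]
  linarith

/-- A minimizing sequence that converges locally to zero has at least the energy of the line. -/
theorem Covered.le_of_isLimit_of_mass_eq_zero {G : MetricGraph V B H} (hG : G.Covered)
    {p q κ e μ I K : ℝ} (hp : 2 < p ∧ p < 6) (hq : 0 < q) (he0 : e ≤ 0)
    (he : ∀ f g : Bool → ℝ → 𝕜, LinePair f g → pairMass f = 1 → e ≤ pairEnergy p f g)
    {u : ℕ → GraphFunction V B H 𝕜} (hu : ∀ n, G.MemH1 (u n)) (hmass : ∀ n, G.mass (u n) = μ)
    (hkin : ∀ n, G.kinetic (u n) ≤ K)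
    (henergy : Tendsto (fun n => G.genEnergy p q κ (u n)) atTop (𝓝 I))
    {U : GraphFunction V B H 𝕜} (hU : G.IsLimit u U) (hU0 : G.mass U = 0) :
    e * μ ^ ((p + 2) / (6 - p)) ≤ I := by
  obtain ⟨ℓ, hℓ, hD⟩ := G.exists_isEdgeDomain
  have hp0 : 0 < p := by linarith [hp.1]
  obtain ⟨hb0, hv0⟩ := hG.eq_zero_of_mass_eq_zero hU.memH1 hU0
  have hv : ∀ v, Tendsto (fun n => ‖(u n).vertex v‖) atTop (𝓝 0) := fun v => by
    simpa [hv0] using (hU.vertex v).norm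
  have hsq : ∀ c : ℝ, Tendsto (fun n => ∑ h, ‖(u n).vertex (G.base h)‖ ^ 2 / c) atTop (𝓝 0) := by
    intro c
    have := tendsto_finsetSum Finset.univ fun (h : H) _ => ((hv (G.base h)).pow 2).div_const c
    simpa using this
  have hvq : Tendsto (fun n => ∑ v, ‖(u n).vertex v‖ ^ q) atTop (𝓝 0) := by
    have := tendsto_finsetSum Finset.univ fun (v : V) _ => (hv v).rpow_const (p := q) (Or.inr hq.le)
    simpa [Real.zero_rpow hq.ne'] using this
  -- Bounded edges have finite measure, so the uniform Sobolev bound serves as dominating constant.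
  have hcore : Tendsto (fun n => ∑ b, ∫ x in G.dom (Sum.inl b), ‖(u n).branch (Sum.inl b) x‖ ^ p)
      atTop (𝓝 0) := by
    have hM : ∀ n i, ∀ x ∈ G.dom i, ‖(u n).branch i x‖ ≤ √(μ / ℓ) + √(ℓ * K) := by
      intro n i x hx
      refine ((hu n).norm_branch_le hD hℓ le_rfl hx).trans ?_
      rw [hmass]
      have := hkin n
      gcongr
    have h1 : ∀ b : B, Tendsto (fun n => ∫ x in G.dom (Sum.inl b), ‖(u n).branch (Sum.inl b) x‖ ^ p)
        atTop (𝓝 (∫ x in G.dom (Sum.inl b), (0 : ℝ))) := by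
      intro b
      refine tendsto_integral_of_dominated_convergence
        (fun _ => (√(μ / ℓ) + √(ℓ * K)) ^ p) (fun n => ?_) ?_ (fun n => ?_) ?_
      · exact (((hu n).hasWeakDeriv.h1On (Sum.inl b)).memLp.1.norm.aemeasurable.pow_const
          p).aestronglyMeasurable
      · exact integrableOn_const (by simp [dom])
      · filter_upwards [ae_restrict_mem (hD (Sum.inl b)).measurableSet] with x hx
        rw [Real.norm_of_nonneg (Real.rpow_nonneg (norm_nonneg _) _)]
        exact Real.rpow_le_rpow (norm_nonneg _) (hM n _ x hx) hp0.le
      · filter_upwards [ae_restrict_mem (hD (Sum.inl b)).measurableSet] with x hx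
        have := (hU.branch (Sum.inl b) x hx).norm.rpow_const (p := p) (Or.inr hp0.le)
        simpa [hb0 _ x hx, Real.zero_rpow hp0.ne'] using this
    simpa using tendsto_finsetSum Finset.univ fun (b : B) _ => h1 b
  have hs : 0 < (p + 2) / (6 - p) := div_pos (by linarith) (by linarith [hp.2])
  have hlim : Tendsto (fun n => e * (μ + ∑ h, ‖(u n).vertex (G.base h)‖ ^ 2 / 2) ^ ((p + 2) / (6 - p))
      - ∑ h, ‖(u n).vertex (G.base h)‖ ^ 2 / 4
      - 1 / p * (∑ b, ∫ x in G.dom (Sum.inl b), ‖(u n).branch (Sum.inl b) x‖ ^ p)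
      - κ * ∑ v, ‖(u n).vertex v‖ ^ q) atTop
      (𝓝 (e * (μ + 0) ^ ((p + 2) / (6 - p)) - 0 - 1 / p * 0 - κ * 0)) :=
    ((((((hsq 2).const_add μ).rpow_const (Or.inr hs.le)).const_mul e).sub (hsq 4)).sub
      (hcore.const_mul _)).sub (hvq.const_mul κ)
  simp only [add_zero, sub_zero, mul_zero] at hlim
  refine le_of_tendsto_of_tendsto' hlim henergy fun n => ?_
  have := (hu n).genEnergy_ge (q := q) (κ := κ) hp he0 he
  rwa [hmass] at this

end MetricGraph

/-! ### Decay at infinity of H¹ functions -/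

section Decay

variable {𝕜 : Type*} [RCLike 𝕜]

theorem H1On.shift {f g : ℝ → 𝕜} (h : H1On (Ici 0) f g) {x₀ : ℝ} (hx₀ : 0 ≤ x₀) :
    H1On (Ici 0) (fun x => f (x₀ + x)) fun x => g (x₀ + x) := by
  have key : ∀ w : ℝ → 𝕜, MemLp w 2 (volume.restrict (Ici 0)) →
      MemLp (fun x => w (x₀ + x)) 2 (volume.restrict (Ici 0)) := by
    intro w hw
    have h1 := ((memLp_indicator_iff_restrict measurableSet_Ici).2 hw).comp_translate x₀
    refine (memLp_congr_ae ?_).1 (h1.restrict (Ici 0))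
    filter_upwards [ae_restrict_mem measurableSet_Ici] with x hx
    exact indicator_of_mem (add_nonneg hx₀ hx) w
  refine ⟨fun x hx => ?_, key f h.memLp, key g h.deriv_memLp⟩
  have := h.sub_eq isEdgeDomain_Ici zero_le_one (x := x₀) (y := x₀ + x) hx₀ (add_nonneg hx₀ hx)
  rw [intervalIntegral.integral_comp_add_left, add_zero, ← this]
  ring

theorem tendsto_setIntegral_Ici_comp_add {F : ℝ → ℝ} (hF : IntegrableOn F (Ici 0)) :
    Tendsto (fun x₀ => ∫ x in Ici 0, F (x₀ + x)) atTop (𝓝 0) := by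
  have hF' : IntegrableOn F (Ioi 0) := hF.mono_set Ioi_subset_Ici_self
  have h1 := (intervalIntegral_tendsto_integral_Ioi 0 hF' tendsto_id).const_sub (∫ x in Ioi 0, F x)
  rw [sub_self] at h1
  refine h1.congr' ?_
  filter_upwards [eventually_ge_atTop 0] with x₀ hx₀
  have h2 : ∫ x in Ici 0, F (x₀ + x) = ∫ x in Ioi x₀, F x := by
    rw [← integral_Ici_eq_integral_Ioi, ← integral_indicator measurableSet_Ici,
      ← integral_indicator measurableSet_Ici,
      ← integral_add_left_eq_self ((Ici x₀).indicator F) x₀]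
    congr 1
    ext x
    simp [indicator]
  rw [h2, id, intervalIntegral.integral_of_le hx₀, ← Ioc_union_Ioi_eq_Ioi hx₀,
    setIntegral_union (by simp) measurableSet_Ioi
      (hF'.mono_set Ioc_subset_Ioi_self) (hF'.mono_set (Ioi_subset_Ioi hx₀))]
  ring

/-- The unit-scale Sobolev bound on `[x₀, ∞)` involves only tails of two convergent integrals. -/
theorem H1On.tendsto_zero {f g : ℝ → 𝕜} (h : H1On (Ici 0) f g) : Tendsto f atTop (𝓝 0) := by
  rw [tendsto_zero_iff_norm_tendsto_zero]
  have hsq : ∀ {w : ℝ → 𝕜}, MemLp w 2 (volume.restrict (Ici 0)) →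
      Tendsto (fun x₀ => ∫ x in Ici 0, ‖w (x₀ + x)‖ ^ 2) atTop (𝓝 0) := fun hw =>
    tendsto_setIntegral_Ici_comp_add ((memLp_two_iff_integrable_sq_norm hw.1).1 hw)
  have h1 := ((hsq h.memLp).sqrt).add ((hsq h.deriv_memLp).sqrt)
  rw [Real.sqrt_zero, add_zero] at h1
  refine squeeze_zero' (Eventually.of_forall fun x => norm_nonneg _) ?_ h1
  filter_upwards [eventually_ge_atTop 0] with x₀ hx₀
  simpa using (h.shift hx₀).norm_le isEdgeDomain_Ici zero_le_one self_mem_Ici one_pos le_rfl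

end Decay

/-! ### Quadratic cutoff -/

section Cutoff

/-- A cutoff function supported in `[-L, L]`. -/
noncomputable def cutoff (L x : ℝ) : ℝ := max 0 (1 - (x / L) ^ 2)

/-- The derivative of `cutoff L` on `[0, ∞)`. -/
noncomputable def cutoffDeriv (L x : ℝ) : ℝ := if x < L then -(2 * (x / L) / L) else 0

variable {L x : ℝ}

theorem cutoff_of_le (hL : 0 < L) (hx0 : 0 ≤ x) (hx : x ≤ L) : cutoff L x = 1 - (x / L) ^ 2 := by
  have h1 : x / L ≤ 1 := (div_le_one hL).2 hx
  have h0 : 0 ≤ x / L := div_nonneg hx0 hL.le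
  exact max_eq_right (by nlinarith)

theorem cutoff_of_ge (hL : 0 < L) (hx : L ≤ x) : cutoff L x = 0 := by
  have h1 : 1 ≤ x / L := (one_le_div hL).2 hx
  exact max_eq_left (by nlinarith)

theorem cutoff_nonneg : 0 ≤ cutoff L x := le_max_left _ _

theorem cutoff_le_one : cutoff L x ≤ 1 := max_le zero_le_one (by nlinarith [sq_nonneg (x / L)])

theorem cutoff_zero : cutoff L 0 = 1 := by simp [cutoff]

theorem continuous_cutoff : Continuous (cutoff L) := by unfold cutoff; fun_prop

theorem one_sub_cutoff_sq_le : 1 - cutoff L x ^ 2 ≤ 2 * (x / L) ^ 2 := by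
  have : 1 - (x / L) ^ 2 ≤ cutoff L x := le_max_right _ _
  nlinarith [cutoff_nonneg (L := L) (x := x), cutoff_le_one (L := L) (x := x)]

theorem absolutelyContinuousOnInterval_cutoff (a b : ℝ) :
    AbsolutelyContinuousOnInterval (cutoff L) a b := by
  have h : AbsolutelyContinuousOnInterval (fun x : ℝ => 1 - (x / L) ^ 2) a b :=
    ContDiffOn.absolutelyContinuousOnInterval (by fun_prop)
  refine h.of_dist_le fun x _ y _ => ?_
  rw [Real.dist_eq, Real.dist_eq]
  have := abs_max_sub_max_le_abs (1 - (x / L) ^ 2) (1 - (y / L) ^ 2) 0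
  unfold cutoff
  rwa [max_comm 0, max_comm 0]

theorem hasDerivAt_cutoff (hL : 0 < L) (hx0 : 0 ≤ x) (hx : x ≠ L) :
    HasDerivAt (cutoff L) (cutoffDeriv L x) x := by
  rcases hx.lt_or_gt with h | h
  · have h1 : HasDerivAt (fun x : ℝ => 1 - (x / L) ^ 2) (-(2 * (x / L) / L)) x := by
      exact ((((hasDerivAt_id x).div_const L).pow 2).const_sub 1).congr_deriv (by simp; ring)
    rw [cutoffDeriv, if_pos h]
    refine h1.congr_of_eventuallyEq ?_
    filter_upwards [Ioo_mem_nhds (show -L < x by linarith) h] with y hy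
    refine max_eq_right ?_
    have h2 : (y / L) ^ 2 ≤ 1 := by
      rw [sq_le_one_iff_abs_le_one, abs_div, abs_of_pos hL, div_le_one hL, abs_le]
      exact ⟨hy.1.le, hy.2.le⟩
    linarith
  · rw [cutoffDeriv, if_neg h.not_gt]
    refine (hasDerivAt_const x (0:ℝ)).congr_of_eventuallyEq ?_
    filter_upwards [Ioi_mem_nhds h] with y hy using cutoff_of_ge hL (le_of_lt hy)

theorem abs_cutoffDeriv_le (hL : 0 < L) (hx0 : 0 ≤ x) : |cutoffDeriv L x| ≤ 2 / L := by
  unfold cutoffDeriv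
  split_ifs with h
  · have h1 : x / L ≤ 1 := (div_le_one hL).2 h.le
    rw [abs_neg, abs_of_nonneg (by positivity)]
    gcongr
    linarith
  · simp; positivity

theorem measurable_cutoffDeriv : Measurable (cutoffDeriv L) :=
  Measurable.ite measurableSet_Iio (by fun_prop) measurable_const

variable {𝕜 : Type*} [RCLike 𝕜] {f g : ℝ → 𝕜}

theorem H1On.cutoff (h : H1On (Ici 0) f g) (hL : 0 < L) :
    H1On (Ici 0) (fun x => (cutoff L x : 𝕜) * f x)
      fun x => (cutoffDeriv L x : 𝕜) * f x + (_root_.cutoff L x : 𝕜) * g x := by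
  have hac : ∀ x ∈ Ici (0:ℝ),
      AbsolutelyContinuousOnInterval (fun x => (_root_.cutoff L x : 𝕜) * f x) 0 x := by
    intro x hx
    have := (absolutelyContinuousOnInterval_cutoff (L := L) 0 x).smul
      (h.ac isEdgeDomain_Ici zero_le_one hx)
    refine this.of_dist_le fun y _ z _ => le_of_eq ?_
    simp [RCLike.real_smul_eq_coe_mul]
  have hmem : MemLp (fun x => (_root_.cutoff L x : 𝕜) * f x) 2 (volume.restrict (Ici 0)) := by
    refine h.memLp.of_le (AEStronglyMeasurable.mul ?_ h.memLp.1) (Eventually.of_forall fun x => ?_)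
    · exact (RCLike.continuous_ofReal.comp continuous_cutoff).aestronglyMeasurable
    · rw [norm_mul, RCLike.norm_ofReal, abs_of_nonneg cutoff_nonneg]
      exact mul_le_of_le_one_left (norm_nonneg _) cutoff_le_one
  have hmem' : MemLp (fun x => (cutoffDeriv L x : 𝕜) * f x + (_root_.cutoff L x : 𝕜) * g x) 2
      (volume.restrict (Ici 0)) := by
    refine MemLp.add ?_ ?_
    · refine MemLp.of_le_mul (c := 2 / L) h.memLp (AEStronglyMeasurable.mul ?_ h.memLp.1) ?_
      · exact (RCLike.measurable_ofReal.comp measurable_cutoffDeriv).aestronglyMeasurable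
      · filter_upwards [ae_restrict_mem measurableSet_Ici] with x hx
        rw [norm_mul, RCLike.norm_ofReal]
        exact mul_le_mul_of_nonneg_right (abs_cutoffDeriv_le hL hx) (norm_nonneg _)
    · refine h.deriv_memLp.of_le (AEStronglyMeasurable.mul ?_ h.deriv_memLp.1)
        (Eventually.of_forall fun x => ?_)
      · exact (RCLike.continuous_ofReal.comp continuous_cutoff).aestronglyMeasurable
      · rw [norm_mul, RCLike.norm_ofReal, abs_of_nonneg cutoff_nonneg]
        exact mul_le_of_le_one_left (norm_nonneg _) cutoff_le_one
  have hder : deriv (fun x => (_root_.cutoff L x : 𝕜) * f x) =ᵐ[volume.restrict (Ici 0)]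
      fun x => (cutoffDeriv L x : 𝕜) * f x + (_root_.cutoff L x : 𝕜) * g x := by
    have hne : ∀ᵐ x ∂(volume.restrict (Ici (0:ℝ))), x ≠ L := ae_restrict_of_ae (Measure.ae_ne volume L)
    filter_upwards [ae_restrict_mem measurableSet_Ici, hne,
      h.hasDerivAt_ae isEdgeDomain_Ici zero_le_one] with x hx hxL hf
    have h1 : HasDerivAt (fun x => (_root_.cutoff L x : 𝕜)) (cutoffDeriv L x : 𝕜) x :=
      (RCLike.ofRealCLM (K := 𝕜)).hasFDerivAt.comp_hasDerivAt x (hasDerivAt_cutoff hL hx hxL)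
    exact (h1.mul hf).deriv
  have h2 := H1On.of_ac isEdgeDomain_Ici zero_le_one hac hmem ((memLp_congr_ae hder).2 hmem')
  refine ⟨fun x hx => ?_, hmem, hmem'⟩
  rw [h2.eq_integral x hx]
  congr 1
  have hx0 : (0:ℝ) ≤ x := hx
  rw [intervalIntegral.integral_of_le hx0, intervalIntegral.integral_of_le hx0]
  refine integral_congr_ae (ae_restrict_of_ae_restrict_of_subset ?_ hder)
  exact Ioc_subset_Icc_self.trans Icc_subset_Ici_self

/-- With `y = x / L`, the loss `1 - χ ^ 2 ≥ y ^ 2` in the coefficient of `‖b‖ ^ 2` pays for the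
cross term, because the derivative of the cutoff is itself proportional to `y`. So no term linear in
`1 / L` remains. -/
theorem norm_sq_cutoff_deriv_le (hL : 0 < L) (hx : 0 ≤ x) (a b : 𝕜) :
    ‖(cutoffDeriv L x : 𝕜) * a + (cutoff L x : 𝕜) * b‖ ^ 2 ≤ ‖b‖ ^ 2 + 8 / L ^ 2 * ‖a‖ ^ 2 := by
  rcases lt_or_ge x L with h | h
  · have hn : ‖(cutoffDeriv L x : 𝕜) * a + (cutoff L x : 𝕜) * b‖ ≤
        |cutoffDeriv L x| * ‖a‖ + cutoff L x * ‖b‖ := by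
      refine (norm_add_le _ _).trans_eq ?_
      rw [norm_mul, norm_mul, RCLike.norm_ofReal, RCLike.norm_ofReal, abs_of_nonneg cutoff_nonneg]
    refine (pow_le_pow_left₀ (norm_nonneg _) hn 2).trans ?_
    rw [cutoff_of_le hL hx h.le, cutoffDeriv, if_pos h, abs_neg,
      abs_of_nonneg (by positivity)]
    set y := x / L
    have hy0 : 0 ≤ y := div_nonneg hx hL.le
    have hy1 : y ≤ 1 := (div_le_one hL).2 h.le
    have e1 : 8 / L ^ 2 * ‖a‖ ^ 2 = 8 * (‖a‖ / L) ^ 2 := by ring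
    have e2 : 2 * y / L * ‖a‖ = 2 * y * (‖a‖ / L) := by ring
    rw [e1, e2]
    set α := ‖a‖ / L
    set β := ‖b‖
    have hy2 : y ^ 2 ≤ 1 := by nlinarith
    have hχ : 0 ≤ 1 - y ^ 2 := by linarith
    have hχ2 : (1 - y ^ 2) ^ 2 ≤ 1 - y ^ 2 := by nlinarith
    have k1 : 2 * (2 * y * α) * ((1 - y ^ 2) * β) ≤ y ^ 2 * β ^ 2 + 4 * (1 - y ^ 2) ^ 2 * α ^ 2 := by
      nlinarith [sq_nonneg (y * β - 2 * (1 - y ^ 2) * α)]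
    have k2 : 4 * (1 - y ^ 2) ^ 2 * α ^ 2 ≤ 4 * α ^ 2 := by nlinarith [sq_nonneg α]
    have k3 : (2 * y * α) ^ 2 ≤ 4 * α ^ 2 := by nlinarith [sq_nonneg α]
    have k4 : (1 - y ^ 2) ^ 2 * β ^ 2 ≤ (1 - y ^ 2) * β ^ 2 := by nlinarith [sq_nonneg β]
    nlinarith
  · rw [cutoffDeriv, if_neg h.not_gt, cutoff_of_ge hL h]
    simp; positivity

/-- Bernoulli's inequality for `(χ ^ 2) ^ (p / 2)`. -/
theorem le_cutoff_rpow {p : ℝ} (hp : 2 ≤ p) :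
    1 - p / 2 * (1 - cutoff L x ^ 2) ≤ cutoff L x ^ p := by
  have h1 := one_add_mul_self_le_rpow_one_add (s := cutoff L x ^ 2 - 1)
    (by nlinarith [sq_nonneg (cutoff L x)]) (p := p / 2) (by linarith)
  rw [add_sub_cancel, ← Real.rpow_two, ← Real.rpow_mul cutoff_nonneg] at h1
  rw [← Real.rpow_two]
  have : 2 * (p / 2) = p := by ring
  rw [this] at h1
  linarith

/-- Beyond `R` the smallness of `‖a‖ ^ (p - 2)` bounds the loss by `ε` times the lost mass; before
`R` the cutoff differs from 1 by `O(R ^ 2 / L ^ 2)`. -/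
theorem norm_rpow_cutoff_ge {p ε R : ℝ} (hp : 2 < p) (hε : 0 ≤ ε) (hL : 0 < L) (hx : 0 ≤ x) (a : 𝕜)
    (ha : R ≤ x → ‖a‖ ^ (p - 2) ≤ ε) :
    ‖a‖ ^ p - p / 2 * (ε * (‖a‖ ^ 2 - ‖(cutoff L x : 𝕜) * a‖ ^ 2) + 2 * R ^ 2 / L ^ 2 * ‖a‖ ^ p) ≤
      ‖(cutoff L x : 𝕜) * a‖ ^ p := by
  rw [norm_mul, RCLike.norm_ofReal, abs_of_nonneg cutoff_nonneg,
    Real.mul_rpow cutoff_nonneg (norm_nonneg _)]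
  have hap : 0 ≤ ‖a‖ ^ p := Real.rpow_nonneg (norm_nonneg _) _
  have ht0 : 0 ≤ 1 - cutoff L x ^ 2 := by
    nlinarith [cutoff_nonneg (L := L) (x := x), cutoff_le_one (L := L) (x := x)]
  have h1 := mul_le_mul_of_nonneg_right (le_cutoff_rpow (L := L) (x := x) hp.le) hap
  have h2 : (1 - cutoff L x ^ 2) * ‖a‖ ^ p ≤
      ε * ((1 - cutoff L x ^ 2) * ‖a‖ ^ 2) + 2 * R ^ 2 / L ^ 2 * ‖a‖ ^ p := by
    rcases le_total R x with h | h
    · have h3 : ‖a‖ ^ p = ‖a‖ ^ (p - 2) * ‖a‖ ^ 2 := by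
        conv_lhs => rw [show p = (p - 2) + 2 by ring]
        rw [Real.rpow_add' (norm_nonneg _) (by linarith), Real.rpow_two]
      have h4 : (1 - cutoff L x ^ 2) * ‖a‖ ^ p ≤ ε * ((1 - cutoff L x ^ 2) * ‖a‖ ^ 2) := by
        rw [h3]
        have := mul_le_mul_of_nonneg_right (ha h)
          (show 0 ≤ (1 - cutoff L x ^ 2) * ‖a‖ ^ 2 by positivity)
        linarith
      have h5 : 0 ≤ 2 * R ^ 2 / L ^ 2 * ‖a‖ ^ p := by positivity
      linarith
    · have h3 : 1 - cutoff L x ^ 2 ≤ 2 * R ^ 2 / L ^ 2 := by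
        refine one_sub_cutoff_sq_le.trans ?_
        rw [div_pow, ← mul_div_assoc]
        gcongr
      have h4 := mul_le_mul_of_nonneg_right h3 hap
      have h5 : 0 ≤ ε * ((1 - cutoff L x ^ 2) * ‖a‖ ^ 2) := by positivity
      linarith
  have h3 := mul_le_mul_of_nonneg_left h2 (show 0 ≤ p / 2 by linarith)
  rw [mul_pow]
  linarith

end Cutoff

/-! ### Truncating a pair of negative energy -/

section Truncation

variable {𝕜 : Type*} [RCLike 𝕜]

/-- A pair of functions multiplied by the cutoff. -/
noncomputable def cutPair (L : ℝ) (f : Bool → ℝ → 𝕜) (b : Bool) (x : ℝ) : 𝕜 :=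
  (cutoff L x : 𝕜) * f b x

/-- The weak derivative of `cutPair L f`, if `g` is that of `f`. -/
noncomputable def cutPairDeriv (L : ℝ) (f g : Bool → ℝ → 𝕜) (b : Bool) (x : ℝ) : 𝕜 :=
  (cutoffDeriv L x : 𝕜) * f b x + (cutoff L x : 𝕜) * g b x

variable {f g : Bool → ℝ → 𝕜}

theorem LinePair.cutPair (h : LinePair f g) {L : ℝ} (hL : 0 < L) :
    LinePair (cutPair L f) (cutPairDeriv L f g) where
  h1On b := (h.h1On b).cutoff hL
  glue := by simp [_root_.cutPair, h.glue]

theorem LinePair.integrable_sq (h : LinePair f g) (b : Bool) :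
    IntegrableOn (fun x => ‖f b x‖ ^ 2) (Ici 0) :=
  (memLp_two_iff_integrable_sq_norm (h.h1On b).memLp.1).1 (h.h1On b).memLp

theorem LinePair.integrable_deriv_sq (h : LinePair f g) (b : Bool) :
    IntegrableOn (fun x => ‖g b x‖ ^ 2) (Ici 0) :=
  (memLp_two_iff_integrable_sq_norm (h.h1On b).deriv_memLp.1).1 (h.h1On b).deriv_memLp

theorem LinePair.integrable_rpow (h : LinePair f g) {r : ℝ} (hr : 2 ≤ r) (b : Bool) :
    IntegrableOn (fun x => ‖f b x‖ ^ r) (Ici 0) := by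
  refine (h.h1On b).memLp.integrable_norm_rpow_of_bdd hr
    (M := √((∫ t in Ici 0, ‖f b t‖ ^ 2) / 1) + √(1 * ∫ t in Ici 0, ‖g b t‖ ^ 2)) ?_
  filter_upwards [ae_restrict_mem measurableSet_Ici] with x hx
  exact (h.h1On b).norm_le isEdgeDomain_Ici zero_le_one hx one_pos le_rfl

theorem norm_cutPair_le (L : ℝ) (b : Bool) (x : ℝ) : ‖cutPair L f b x‖ ≤ ‖f b x‖ := by
  rw [cutPair, norm_mul, RCLike.norm_ofReal, abs_of_nonneg cutoff_nonneg]
  exact mul_le_of_le_one_left (norm_nonneg _) cutoff_le_one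

theorem LinePair.pairMass_cutPair_le (h : LinePair f g) {L : ℝ} (hL : 0 < L) :
    pairMass (_root_.cutPair L f) ≤ pairMass f := by
  refine Finset.sum_le_sum fun b _ => integral_mono ((h.cutPair hL).integrable_sq b)
    (h.integrable_sq b) fun x => ?_
  exact pow_le_pow_left₀ (norm_nonneg _) (norm_cutPair_le L b x) 2

theorem LinePair.tendsto_pairMass_cutPair (h : LinePair f g) :
    Tendsto (fun L => pairMass (_root_.cutPair L f)) atTop (𝓝 (pairMass f)) := by
  refine tendsto_finsetSum _ fun b _ => ?_
  refine tendsto_integral_filter_of_dominated_convergence (fun x => ‖f b x‖ ^ 2) ?_ ?_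
    (h.integrable_sq b) (Eventually.of_forall fun x => ?_)
  · filter_upwards [eventually_gt_atTop 0] with L hL
    exact ((h.cutPair hL).integrable_sq b).1
  · refine Eventually.of_forall fun L => Eventually.of_forall fun x => ?_
    rw [Real.norm_of_nonneg (by positivity)]
    exact pow_le_pow_left₀ (norm_nonneg _) (norm_cutPair_le L b x) 2
  · have h1 : Tendsto (fun L : ℝ => max 0 (1 - (x / L) ^ 2)) atTop (𝓝 (max 0 (1 - 0 ^ 2))) :=
      tendsto_const_nhds.max (((tendsto_const_nhds.div_atTop tendsto_id).pow 2).const_sub 1)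
    have h2 : Tendsto (fun L : ℝ => cutoff L x) atTop (𝓝 1) := by
      simpa [cutoff] using h1
    have h3 := ((h2.mul_const ‖f b x‖).pow 2)
    rw [one_mul] at h3
    refine h3.congr fun L => ?_
    rw [_root_.cutPair, norm_mul, RCLike.norm_ofReal, abs_of_nonneg cutoff_nonneg]

theorem LinePair.kinetic_cutPair_le (h : LinePair f g) {L : ℝ} (hL : 0 < L) :
    ∑ b, ∫ x in Ici 0, ‖cutPairDeriv L f g b x‖ ^ 2 ≤
      (∑ b, ∫ x in Ici 0, ‖g b x‖ ^ 2) + 8 / L ^ 2 * pairMass f := by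
  rw [pairMass, Finset.mul_sum, ← Finset.sum_add_distrib]
  refine Finset.sum_le_sum fun b _ => ?_
  rw [← integral_const_mul, ← integral_add (h.integrable_deriv_sq b)
    ((h.integrable_sq b).const_mul _)]
  refine setIntegral_mono_on ((h.cutPair hL).integrable_deriv_sq b)
    ((h.integrable_deriv_sq b).add ((h.integrable_sq b).const_mul _)) measurableSet_Ici
    fun x hx => norm_sq_cutoff_deriv_le hL hx _ _

theorem LinePair.power_cutPair_ge (h : LinePair f g) {L p ε R : ℝ} (hp : 2 < p) (hε : 0 ≤ ε)
    (hL : 0 < L) (hR : ∀ b x, R ≤ x → ‖f b x‖ ^ (p - 2) ≤ ε) :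
    (∑ b, ∫ x in Ici 0, ‖f b x‖ ^ p) - p / 2 * (ε * (pairMass f - pairMass (_root_.cutPair L f)) +
      2 * R ^ 2 / L ^ 2 * ∑ b, ∫ x in Ici 0, ‖f b x‖ ^ p) ≤
      ∑ b, ∫ x in Ici 0, ‖_root_.cutPair L f b x‖ ^ p := by
  have hb : ∀ b, (∫ x in Ici 0, ‖f b x‖ ^ p) - p / 2 * (ε * ((∫ x in Ici 0, ‖f b x‖ ^ 2) -
      ∫ x in Ici 0, ‖_root_.cutPair L f b x‖ ^ 2) + 2 * R ^ 2 / L ^ 2 * ∫ x in Ici 0, ‖f b x‖ ^ p) ≤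
      ∫ x in Ici 0, ‖_root_.cutPair L f b x‖ ^ p := by
    intro b
    have i1 := h.integrable_rpow hp.le b
    have i2 := (h.integrable_sq b).sub ((h.cutPair hL).integrable_sq b)
    have i3 := (i2.const_mul ε).add (i1.const_mul (2 * R ^ 2 / L ^ 2))
    rw [← integral_sub (h.integrable_sq b) ((h.cutPair hL).integrable_sq b), ← integral_const_mul,
      ← integral_const_mul, ← integral_add (by exact i2.const_mul ε) (i1.const_mul _),
      ← integral_const_mul, ← integral_sub i1 (by exact i3.const_mul (p / 2))]
    refine setIntegral_mono_on (i1.sub (i3.const_mul (p / 2)))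
      ((h.cutPair hL).integrable_rpow hp.le b) measurableSet_Ici fun x hx => ?_
    exact norm_rpow_cutoff_ge hp hε hL hx _ (hR b x)
  have := Finset.sum_le_sum fun b (_ : b ∈ Finset.univ) => hb b
  simpa only [pairMass, Finset.sum_sub_distrib, Finset.sum_add_distrib, ← Finset.mul_sum] using this

/-- A pair of negative energy can be truncated with an energy loss of order `L⁻²`. -/
theorem LinePair.exists_truncation {p : ℝ} (hp : 2 < p) (h : LinePair f g) (hm : pairMass f = 1)
    (he : pairEnergy p f g < 0) :
    ∃ C L₀ : ℝ, 0 < L₀ ∧ ∀ L, L₀ ≤ L → ∃ f' g' : Bool → ℝ → 𝕜, LinePair f' g' ∧ pairMass f' = 1 ∧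
      pairEnergy p f' g' ≤ pairEnergy p f g + C / L ^ 2 ∧ ‖f true 0‖ ≤ ‖f' true 0‖ ∧
      ∀ b x, L ≤ x → f' b x = 0 ∧ g' b x = 0 := by
  have hp0 : 0 < p := by linarith
  set e := pairEnergy p f g with hedef
  set P := ∑ b, ∫ x in Ici 0, ‖f b x‖ ^ p with hP
  have hP0 : 0 ≤ P := Finset.sum_nonneg fun b _ => integral_nonneg fun x =>
    Real.rpow_nonneg (norm_nonneg _) _
  -- The threshold `-e` makes the energy cost of lost mass at most `-e * (1 - m) / 2`, less than
  -- what restoring the mass to 1 gives back. The rate at which `m` tends to 1 is therefore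
  -- irrelevant.
  obtain ⟨R, hR⟩ : ∃ R, ∀ b x, R ≤ x → ‖f b x‖ ^ (p - 2) ≤ -e := by
    have : ∀ b, ∃ R, ∀ x, R ≤ x → ‖f b x‖ ^ (p - 2) ≤ -e := by
      intro b
      have h1 := (h.h1On b).tendsto_zero.norm.rpow_const (p := p - 2) (Or.inr (by linarith))
      rw [norm_zero, Real.zero_rpow (by linarith)] at h1
      exact eventually_atTop.1 (h1.eventually_le_const (show 0 < -e by linarith))
    choose R hR using this
    refine ⟨max (R true) (R false), fun b x hx => hR b x ?_⟩
    cases b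
    exacts [(le_max_right _ _).trans hx, (le_max_left _ _).trans hx]
  obtain ⟨L₁, hL₁⟩ := eventually_atTop.1
    (h.tendsto_pairMass_cutPair.eventually_const_lt (show 1 / 2 < pairMass f by rw [hm]; norm_num))
  refine ⟨2 * (4 + R ^ 2 * P), max 1 L₁, by positivity, fun L hL => ?_⟩
  have hL0 : 0 < L := one_pos.trans_le ((le_max_left _ _).trans hL)
  have hcut := h.cutPair hL0
  set m := pairMass (_root_.cutPair L f) with hmdef
  have hm1 : m ≤ 1 := hm ▸ h.pairMass_cutPair_le hL0
  have hm2 : 1 / 2 < m := hL₁ L ((le_max_right _ _).trans hL)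
  have hm0 : 0 < m := by linarith
  have hk := h.kinetic_cutPair_le hL0
  have hpw := h.power_cutPair_ge hp (show 0 ≤ -e by linarith) hL0 hR
  rw [← hmdef, hm, ← hP] at hpw
  rw [hm] at hk
  set σ := √(m⁻¹) with hσ
  have hσ2 : σ ^ 2 = m⁻¹ := Real.sq_sqrt (by positivity)
  have hσ1 : 1 ≤ σ := by
    rw [hσ, Real.one_le_sqrt]; exact (one_le_inv₀ hm0).2 hm1
  have hσ0 : 0 < σ := by linarith
  refine ⟨_, _, hcut.dilate σ one_pos, ?_, ?_, ?_, fun b x hx => ?_⟩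
  · rw [pairMass_dilate _ _ one_pos, ← hmdef, hσ2, inv_one, mul_one, inv_mul_cancel₀ hm0.ne']
  · rw [pairEnergy_dilate p _ _ hσ0 one_pos, inv_one, mul_one, mul_one]
    set K' := ∑ b, ∫ x in Ici 0, ‖cutPairDeriv L f g b x‖ ^ 2
    set P' := ∑ b, ∫ x in Ici 0, ‖_root_.cutPair L f b x‖ ^ p
    have hP'0 : 0 ≤ P' := Finset.sum_nonneg fun b _ => integral_nonneg fun x =>
      Real.rpow_nonneg (norm_nonneg _) _
    have hpow : σ ^ 2 ≤ σ ^ p := by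
      rw [← Real.rpow_two]; exact Real.rpow_le_rpow_of_exponent_le hσ1 hp.le
    have h1 : 1 / p * P' ≥ 1 / p * P - 1 / 2 * (-e * (1 - m)) - R ^ 2 * P / L ^ 2 := by
      have := mul_le_mul_of_nonneg_left hpw (show 0 ≤ 1 / p by positivity)
      refine le_of_eq_of_le ?_ this
      field_simp
      ring
    -- After division by `m` the main term is `e * (1 + m) / (2 * m) ≤ e`, as `m ≤ 1` and `e < 0`;
    -- the error at most doubles, as `m > 1 / 2`.
    have h2 : 1 / 2 * K' - 1 / p * P' ≤ e * (1 + m) / 2 + (4 + R ^ 2 * P) / L ^ 2 := by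
      have h3 : e = 1 / 2 * (∑ b, ∫ x in Ici 0, ‖g b x‖ ^ 2) - 1 / p * P := rfl
      have h4 : (4 + R ^ 2 * P) / L ^ 2 = 1 / 2 * (8 / L ^ 2 * 1) + R ^ 2 * P / L ^ 2 := by ring
      rw [h4]
      linarith
    have h3 : σ ^ 2 * (1 / 2 * K') - σ ^ p * (1 / p * P') ≤ m⁻¹ * (1 / 2 * K' - 1 / p * P') := by
      have := mul_le_mul_of_nonneg_right hpow (show 0 ≤ 1 / p * P' by positivity)
      rw [mul_sub, ← hσ2]
      linarith
    refine h3.trans ((mul_le_mul_of_nonneg_left h2 (inv_nonneg.2 hm0.le)).trans ?_)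
    have hD : 0 ≤ (4 + R ^ 2 * P) / L ^ 2 := by positivity
    rw [mul_div_assoc 2]
    set D := (4 + R ^ 2 * P) / L ^ 2
    rw [inv_mul_le_iff₀ hm0]
    nlinarith
  · simp only [dilatePair, _root_.cutPair, mul_zero, cutoff_zero, norm_mul, RCLike.norm_ofReal,
      abs_of_pos hσ0, abs_one, one_mul]
    exact le_mul_of_one_le_left (norm_nonneg _) hσ1
  · have hd : cutoffDeriv L x = 0 := by simp [cutoffDeriv, hx.not_gt]
    simp [dilatePair, _root_.cutPair, cutPairDeriv, cutoff_of_ge hL0 hx, hd]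

end Truncation

/-! ### Gluing functions supported near edge ends -/

section Gluing

variable {𝕜 : Type*} [RCLike 𝕜]

theorem H1On.restrict_Icc {f g : ℝ → 𝕜} (h : H1On (Ici 0) f g) (ℓ : ℝ) : H1On (Icc 0 ℓ) f g where
  eq_integral x hx := h.eq_integral x hx.1
  memLp := h.memLp.mono_measure (Measure.restrict_mono_set _ Icc_subset_Ici_self)
  deriv_memLp := h.deriv_memLp.mono_measure (Measure.restrict_mono_set _ Icc_subset_Ici_self)

theorem H1On.reflect_Icc {f g : ℝ → 𝕜} (h : H1On (Ici 0) f g) (ℓ : ℝ) :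
    H1On (Icc 0 ℓ) (fun x => f (ℓ - x)) fun x => (-1) * g (ℓ - x) := by
  have key : ∀ w : ℝ → 𝕜, MemLp w 2 (volume.restrict (Ici 0)) →
      MemLp (fun x => w (ℓ - x)) 2 (volume.restrict (Icc 0 ℓ)) := by
    intro w hw
    have h1 := ((memLp_indicator_iff_restrict measurableSet_Ici).2 hw).comp_reflect ℓ
    refine (memLp_congr_ae ?_).1 (h1.restrict (Icc 0 ℓ))
    filter_upwards [ae_restrict_mem measurableSet_Icc] with x hx
    exact indicator_of_mem (sub_nonneg.2 hx.2) w
  refine ⟨fun x hx => ?_, key f h.memLp, (key g h.deriv_memLp).const_mul _⟩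
  have h1 := h.sub_eq isEdgeDomain_Ici zero_le_one (x := ℓ - x) (y := ℓ)
    (sub_nonneg.2 hx.2) (hx.1.trans hx.2)
  rw [intervalIntegral.integral_const_mul, intervalIntegral.integral_comp_sub_left, sub_zero, ← h1]
  ring

/-- Since `2 * r ≤ ℓ`, at each point at least one summand vanishes, so `Ψ` is additive on the sum.
The sign `s` serves both functions and derivatives. -/
theorem integral_glue (Ψ : 𝕜 → ℝ) (h0 : Ψ 0 = 0) {s : 𝕜} (hs : ∀ z, Ψ (s * z) = Ψ z)
    {f₁ f₂ : ℝ → 𝕜} (h₁ : IntegrableOn (fun x => Ψ (f₁ x)) (Ici 0))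
    (h₂ : IntegrableOn (fun x => Ψ (f₂ x)) (Ici 0)) {r ℓ : ℝ} (hr : 0 < r) (hrℓ : 2 * r ≤ ℓ)
    (hf₁ : ∀ x, r ≤ x → f₁ x = 0) (hf₂ : ∀ x, r ≤ x → f₂ x = 0) :
    ∫ x in Icc 0 ℓ, Ψ (f₁ x + s * f₂ (ℓ - x)) =
      (∫ x in Ici 0, Ψ (f₁ x)) + ∫ x in Ici 0, Ψ (f₂ x) := by
  have hℓ : 0 ≤ ℓ := by linarith
  have hcut : ∀ f : ℝ → 𝕜, (∀ x, r ≤ x → f x = 0) →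
      ∫ x in Icc 0 ℓ, Ψ (f x) = ∫ x in Ici 0, Ψ (f x) := by
    intro f hf
    refine (setIntegral_eq_of_subset_of_forall_sdiff_eq_zero measurableSet_Ici
      Icc_subset_Ici_self fun x hx => ?_).symm
    have : ℓ < x := by
      by_contra! hcon
      exact hx.2 ⟨hx.1, hcon⟩
    rw [hf x (by linarith), h0]
  have hrefl : ∫ x in Icc 0 ℓ, Ψ (f₂ (ℓ - x)) = ∫ x in Icc 0 ℓ, Ψ (f₂ x) := by
    rw [integral_Icc_eq_integral_Ioc, integral_Icc_eq_integral_Ioc,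
      ← intervalIntegral.integral_of_le hℓ, ← intervalIntegral.integral_of_le hℓ,
      intervalIntegral.integral_comp_sub_left (fun x => Ψ (f₂ x))]
    simp
  have hsplit : ∀ x ∈ Icc 0 ℓ, Ψ (f₁ x + s * f₂ (ℓ - x)) = Ψ (f₁ x) + Ψ (f₂ (ℓ - x)) := by
    intro x hx
    rcases le_total r x with h | h
    · rw [hf₁ x h, zero_add, hs, h0, zero_add]
    · rw [hf₂ (ℓ - x) (by linarith), mul_zero, add_zero, h0, add_zero]
  have hi₂ : IntegrableOn (fun x => Ψ (f₂ (ℓ - x))) (Icc 0 ℓ) := by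
    have h1 : IntervalIntegrable (fun x => Ψ (f₂ x)) volume 0 ℓ :=
      (intervalIntegrable_iff_integrableOn_Icc_of_le hℓ).2 (h₂.mono_set Icc_subset_Ici_self)
    have h2 := (h1.comp_sub_left ℓ).symm
    rw [sub_zero, sub_self] at h2
    exact (intervalIntegrable_iff_integrableOn_Icc_of_le hℓ).1 h2
  rw [setIntegral_congr_fun measurableSet_Icc hsplit,
    integral_add (h₁.mono_set Icc_subset_Ici_self) hi₂, hrefl, hcut f₁ hf₁, hcut f₂ hf₂]

end Gluing

namespace MetricGraph

variable {V B H 𝕜 : Type*} [RCLike 𝕜]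

/-- The vertex to which an end of an edge is attached. -/
def endVertex (G : MetricGraph V B H) : B ⊕ B ⊕ H → V := Sum.elim G.src (Sum.elim G.tgt G.base)

/-- Counting edge ends rather than edges treats a self-loop like two distinct edges. -/
theorem degree_eq_card [Finite B] [Finite H] (G : MetricGraph V B H) (v : V) :
    G.degree v = Nat.card {ε // G.endVertex ε = v} := by
  rw [Nat.card_congr Equiv.subtypeSum, Nat.card_sum, Nat.card_congr (Equiv.subtypeSum (α := B)),
    Nat.card_sum, ← add_assoc]
  rfl

/-- Functions given near the ends of the edges, glued to functions on the edges. -/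
def glueEnds (G : MetricGraph V B H) (s : 𝕜) (F : B ⊕ B ⊕ H → ℝ → 𝕜) : B ⊕ H → ℝ → 𝕜 :=
  Sum.elim (fun e x => F (Sum.inl e) x + s * F (Sum.inr (Sum.inl e)) (G.len e - x))
    fun h => F (Sum.inr (Sum.inr h))

theorem hasWeakDeriv_glueEnds [Finite B] {G : MetricGraph V B H} {a : V → 𝕜}
    {F F' : B ⊕ B ⊕ H → ℝ → 𝕜} {r : ℝ} (hr : 0 < r) (hlen : ∀ e, 2 * r ≤ G.len e)
    (hF : ∀ ε, H1On (Ici 0) (F ε) (F' ε)) (ha : ∀ ε, F ε 0 = a (G.endVertex ε))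
    (hsupp : ∀ ε x, r ≤ x → F ε x = 0) :
    G.HasWeakDeriv (GraphFunction.ofBranch a (G.glueEnds 1 F)) (G.glueEnds (-1) F') where
  edge_src e := by
    have := ha (Sum.inl e)
    have h2 := hsupp (Sum.inr (Sum.inl e)) (G.len e) (by linarith [hlen e])
    simp [glueEnds, this, h2, endVertex]
  edge_tgt e := by
    have := ha (Sum.inr (Sum.inl e))
    have h2 := hsupp (Sum.inl e) (G.len e) (by linarith [hlen e])
    simp [glueEnds, this, h2, endVertex]
  ray_base h := by
    have := ha (Sum.inr (Sum.inr h))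
    simp [glueEnds, this, endVertex]
  h1On i := by
    rw [GraphFunction.branch_ofBranch]
    rcases i with e | h
    · have := ((hF (Sum.inl e)).restrict_Icc (G.len e)).add
        (ℓ := G.len e) (Or.inl ⟨_, le_rfl, rfl⟩) (G.len_pos e).le
        ((hF (Sum.inr (Sum.inl e))).reflect_Icc (G.len e))
      simpa [glueEnds, dom] using this
    · exact hF (Sum.inr (Sum.inr h))

theorem sum_integral_glueEnds [Fintype B] [Fintype H] (G : MetricGraph V B H) (Ψ : 𝕜 → ℝ)
    (h0 : Ψ 0 = 0) {s : 𝕜} (hs : ∀ z, Ψ (s * z) = Ψ z) {F : B ⊕ B ⊕ H → ℝ → 𝕜}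
    (hi : ∀ ε, IntegrableOn (fun x => Ψ (F ε x)) (Ici 0))
    {r : ℝ} (hr : 0 < r) (hlen : ∀ e, 2 * r ≤ G.len e) (hsupp : ∀ ε x, r ≤ x → F ε x = 0) :
    ∑ i, ∫ x in G.dom i, Ψ (G.glueEnds s F i x) = ∑ ε, ∫ x in Ici 0, Ψ (F ε x) := by
  simp only [Fintype.sum_sum_type, dom, glueEnds, Sum.elim_inl, Sum.elim_inr]
  rw [← add_assoc, ← Finset.sum_add_distrib]
  congr 1
  exact Finset.sum_congr rfl fun e _ => integral_glue Ψ h0 hs (hi _) (hi _) hr (hlen e)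
    (hsupp _) (hsupp _)

/-! ### Competitors around a vertex of degree two -/

variable [Fintype V] [Fintype B] [Fintype H]

/-- A pair of functions of small support on half-lines can be placed around a vertex of
degree two. -/
theorem exists_placement {G : MetricGraph V B H} {v : V} (hv : G.degree v = 2) {p q κ r : ℝ}
    (hp : 2 ≤ p) (hq : 0 < q) (hr : 0 < r) (hlen : ∀ e, 2 * r ≤ G.len e) {f g : Bool → ℝ → 𝕜}
    (h : LinePair f g) (hf : ∀ b x, r ≤ x → f b x = 0 ∧ g b x = 0) :
    ∃ w : GraphFunction V B H 𝕜, G.MemH1 w ∧ G.mass w = pairMass f ∧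
      G.genEnergy p q κ w = pairEnergy p f g - κ * ‖f true 0‖ ^ q := by
  classical
  rw [degree_eq_card, Nat.card_eq_two_iff] at hv
  obtain ⟨⟨ε₁, h₁⟩, ⟨ε₂, h₂⟩, hne, huniv⟩ := hv
  have hne' : ε₁ ≠ ε₂ := fun h => hne (Subtype.ext h)
  have hends : ∀ ε, G.endVertex ε = v → ε = ε₁ ∨ ε = ε₂ := by
    intro ε hε
    have : (⟨ε, hε⟩ : {ε // G.endVertex ε = v}) ∈ ({⟨ε₁, h₁⟩, ⟨ε₂, h₂⟩} : Set _) := by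
      rw [huniv]; trivial
    simpa using this
  -- One half of the pair goes on each of the two ends at `v`, and zero on every other end. There
  -- being no third end at `v`, continuity there is exactly the gluing condition of the pair.
  set put : (Bool → ℝ → 𝕜) → B ⊕ B ⊕ H → ℝ → 𝕜 := fun f ε =>
    if ε = ε₁ then f true else if ε = ε₂ then f false else fun _ => 0 with hput
  have put₁ : ∀ f, put f ε₁ = f true := fun f => by simp [hput]
  have put₂ : ∀ f, put f ε₂ = f false := fun f => by simp [hput, hne'.symm]
  have put₀ : ∀ f ε, ε ≠ ε₁ ∧ ε ≠ ε₂ → put f ε = fun _ => 0 := fun f ε hε => by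
    simp [hput, hε.1, hε.2]
  have hcases : ∀ ε, ε = ε₁ ∨ ε = ε₂ ∨ (ε ≠ ε₁ ∧ ε ≠ ε₂) := fun ε => by tauto
  have hF : ∀ ε, H1On (Ici 0) (put f ε) (put g ε) := by
    intro ε
    rcases hcases ε with rfl | rfl | hε
    · rw [put₁, put₁]; exact h.h1On true
    · rw [put₂, put₂]; exact h.h1On false
    · rw [put₀ f ε hε, put₀ g ε hε]
      exact ⟨fun x _ => by simp, MemLp.zero, MemLp.zero⟩
  have hsupp : ∀ k : Bool → ℝ → 𝕜, (∀ b x, r ≤ x → k b x = 0) → ∀ ε x, r ≤ x → put k ε x = 0 := by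
    intro k hk ε x hx
    rcases hcases ε with rfl | rfl | hε
    · rw [put₁]; exact hk true x hx
    · rw [put₂]; exact hk false x hx
    · rw [put₀ k ε hε]
  have hsum : ∀ (Ψ : 𝕜 → ℝ), Ψ 0 = 0 → ∀ k : Bool → ℝ → 𝕜,
      ∑ ε, ∫ x in Ici 0, Ψ (put k ε x) = ∑ b, ∫ x in Ici 0, Ψ (k b x) := by
    intro Ψ hΨ k
    rw [Fintype.sum_eq_add ε₁ ε₂ hne' fun ε hε => by simp [put₀ k ε hε, hΨ], put₁, put₂,
      Fintype.sum_bool]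
  have hint : ∀ (Ψ : 𝕜 → ℝ), Ψ 0 = 0 → ∀ k : Bool → ℝ → 𝕜,
      (∀ b, IntegrableOn (fun x => Ψ (k b x)) (Ici 0)) →
      ∀ ε, IntegrableOn (fun x => Ψ (put k ε x)) (Ici 0) := by
    intro Ψ hΨ k hk ε
    rcases hcases ε with rfl | rfl | hε
    · rw [put₁]; exact hk true
    · rw [put₂]; exact hk false
    · rw [put₀ k ε hε]; simp [hΨ]
  have ha : ∀ ε, put f ε 0 = if G.endVertex ε = v then f true 0 else 0 := by
    intro ε
    rcases hcases ε with rfl | rfl | hε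
    · rw [put₁, if_pos h₁]
    · rw [put₂, if_pos h₂, h.glue]
    · rw [put₀ f ε hε, if_neg fun hv => ?_]
      rcases hends ε hv with h | h
      exacts [hε.1 h, hε.2 h]
  have hf1 := hsupp f fun b x hx => (hf b x hx).1
  have hg1 := hsupp g fun b x hx => (hf b x hx).2
  have hw := hasWeakDeriv_glueEnds (G := G) (a := fun w => if w = v then f true 0 else 0)
    hr hlen hF ha hf1
  have hp0 : p ≠ 0 := by linarith
  refine ⟨_, hw.memH1, ?_, ?_⟩
  · rw [mass_eq, GraphFunction.branch_ofBranch,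
      G.sum_integral_glueEnds (fun z => ‖z‖ ^ 2) (by simp) (by simp)
        (hint (fun z => ‖z‖ ^ 2) (by simp) f h.integrable_sq) hr hlen hf1,
      hsum (fun z => ‖z‖ ^ 2) (by simp)]
    rfl
  · rw [genEnergy, hw.kinetic_eq, powerIntegral_eq, GraphFunction.branch_ofBranch,
      G.sum_integral_glueEnds (fun z => ‖z‖ ^ 2) (by simp) (by simp)
        (hint (fun z => ‖z‖ ^ 2) (by simp) g h.integrable_deriv_sq) hr hlen hg1,
      hsum (fun z => ‖z‖ ^ 2) (by simp),
      G.sum_integral_glueEnds (fun z => ‖z‖ ^ p) (by simp [hp0]) (by simp)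
        (hint (fun z => ‖z‖ ^ p) (by simp [hp0]) f (h.integrable_rpow hp)) hr hlen hf1,
      hsum (fun z => ‖z‖ ^ p) (by simp [hp0]), pairEnergy]
    congr 2
    rw [GraphFunction.vertex_ofBranch, Finset.sum_eq_single v]
    · simp
    · intro w _ hw; simp [hw, Real.zero_rpow hq.ne']
    · simp

/-- For large masses, the energy on a graph with a vertex of degree two drops below the ground
state energy `e μ ^ ((p + 2) / (6 - p))` of the line. -/
theorem exists_energy_lt {G : MetricGraph V B H} {v : V} (hv : G.degree v = 2) {p q κ : ℝ}
    (hp : 2 < p ∧ p < 6) (hq : 2 < q) (hκ : 0 < κ) {f g : Bool → ℝ → 𝕜} (h : LinePair f g)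
    (hm : pairMass f = 1) (he : pairEnergy p f g < 0) (hf0 : f true 0 ≠ 0) :
    ∃ μ₀ : ℝ, 0 < μ₀ ∧ ∀ μ, μ₀ ≤ μ → ∃ w : GraphFunction V B H 𝕜, G.MemH1 w ∧ G.mass w = μ ∧
      G.genEnergy p q κ w < pairEnergy p f g * μ ^ ((p + 2) / (6 - p)) := by
  obtain ⟨C, L₀, hL₀, htrunc⟩ := h.exists_truncation hp.1 hm he
  obtain ⟨r, hr, hlen⟩ : ∃ r : ℝ, 0 < r ∧ ∀ e, 2 * r ≤ G.len e := by
    rcases isEmpty_or_nonempty B with hB | hB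
    · exact ⟨1, one_pos, fun e => hB.elim e⟩
    · obtain ⟨e, he⟩ := Finite.exists_min G.len
      exact ⟨G.len e / 2, half_pos (G.len_pos e), fun e' => by linarith [he e']⟩
  have h6 : 0 < 6 - p := by linarith [hp.2]
  set α := 2 / (6 - p) with hα
  set β := (p - 2) / (6 - p) with hβ
  set s := (p + 2) / (6 - p) with hs
  have hβ0 : 0 < β := div_pos (by linarith [hp.1]) h6
  -- The decisive comparison of exponents: `2 * q > 4 > 6 - p`.
  have hαq : 0 < α * q - 1 := by
    rw [hα, sub_pos, div_mul_eq_mul_div, one_lt_div h6]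
    linarith [hp.1]
  have hsβ : s - 2 * β = 1 := by
    rw [hs, hβ]; field_simp; ring
  set c := κ * ‖f true 0‖ ^ q with hc
  have hc0 : 0 < c := mul_pos hκ (Real.rpow_pos_of_pos (norm_pos_iff.2 hf0) q)
  -- `ev1` makes the truncation length `r * μ ^ β` admissible, and `ev2` makes the vertex gain `c *
  -- μ ^ (α * q)` exceed the truncation loss `μ * (C / r ^ 2)`.
  have ev1 := (tendsto_rpow_atTop hβ0).eventually_ge_atTop (L₀ / r)
  have ev2 := (tendsto_rpow_atTop hαq).eventually_gt_atTop (C / r ^ 2 / c)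
  obtain ⟨μ₁, hμ₁⟩ := eventually_atTop.1 (ev1.and ev2)
  refine ⟨max 1 μ₁, by positivity, fun μ hμ => ?_⟩
  have hμ0 : 0 < μ := one_pos.trans_le ((le_max_left _ _).trans hμ)
  obtain ⟨k1, k2⟩ := hμ₁ μ ((le_max_right _ _).trans hμ)
  have hτ : 0 < μ ^ β := Real.rpow_pos_of_pos hμ0 _
  have hσ : 0 < μ ^ α := Real.rpow_pos_of_pos hμ0 _
  -- The truncation is done at mass 1; the dilation by `μ ^ β` then shrinks the support to `[0, r]`.
  obtain ⟨f₁, g₁, h₁, hm₁, he₁, hv₁, hs₁⟩ := htrunc (r * μ ^ β) (by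
    rw [div_le_iff₀ hr] at k1; linarith)
  obtain ⟨d1, d2⟩ := dilate_mass_energy hp hμ0 f₁ g₁
  obtain ⟨w, hw, hwm, hwe⟩ := exists_placement (G := G) (q := q) (κ := κ) hv hp.1.le
    (by linarith) hr hlen (h₁.dilate (μ ^ α) hτ) (fun b x hx => by
      obtain ⟨z1, z2⟩ := hs₁ b (μ ^ β * x) (by rw [mul_comm r]; gcongr)
      simp [dilatePair, z1, z2])
  refine ⟨w, hw, by rw [hwm, d1, hm₁, mul_one], ?_⟩
  rw [hwe, d2]
  have hval : c * μ ^ (α * q) ≤ κ * ‖dilatePair (μ ^ α) (μ ^ β) f₁ true 0‖ ^ q := by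
    rw [dilatePair, mul_zero, norm_mul, RCLike.norm_ofReal, abs_of_pos hσ,
      Real.mul_rpow hσ.le (norm_nonneg _), ← Real.rpow_mul hμ0.le, hc, mul_assoc,
      mul_comm (‖f true 0‖ ^ q)]
    gcongr
  have hμs : μ ^ s = μ * (μ ^ β) ^ 2 := by
    rw [← Real.rpow_natCast, ← Real.rpow_mul hμ0.le]
    conv_rhs => rw [← Real.rpow_one μ, ← Real.rpow_mul hμ0.le, ← Real.rpow_add hμ0]
    congr 1; push_cast; linarith
  have hμq : μ ^ (α * q) = μ * μ ^ (α * q - 1) := by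
    conv_rhs => rw [← Real.rpow_one μ, ← Real.rpow_mul hμ0.le, ← Real.rpow_add hμ0]
    congr 1; ring
  have hE : μ ^ s * pairEnergy p f₁ g₁ ≤ pairEnergy p f g * μ ^ s + μ * (C / r ^ 2) := by
    -- As `s - 2 * β = 1`, the loss `C / (r * μ ^ β) ^ 2` becomes linear in `μ` after scaling.
    have h1 := mul_le_mul_of_nonneg_left he₁ (Real.rpow_nonneg hμ0.le s)
    have h2 : μ ^ s * (C / (r * μ ^ β) ^ 2) = μ * (C / r ^ 2) := by
      rw [hμs]; field_simp
    linarith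
  have hlt : μ * (C / r ^ 2) < c * μ ^ (α * q) := by
    rw [div_lt_iff₀ hc0] at k2
    rw [hμq]
    have := mul_lt_mul_of_pos_left k2 hμ0
    linarith
  linarith

end MetricGraph

/-! ### Existence of ground states -/

theorem mainTheorem2 (𝕜 : Type*) [RCLike 𝕜] {V B H : Type*} [Fintype V] [Fintype B] [Fintype H]
    (G : MetricGraph V B H) (hconn : G.IsConnected) (hnoncompact : Nonempty H)
    (hdeg : ∃ v : V, G.degree v = 2)
    (p q : ℝ) (hp : 2 < p ∧ p < 6) (hq : 2 < q ∧ q < 4) :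
    ∃ μ₀ : ℝ, 0 < μ₀ ∧ ∀ μ : ℝ, μ₀ ≤ μ →
      ∃ u : GraphFunction V B H 𝕜, G.IsGroundState p q μ u := by
  obtain ⟨v, hv⟩ := hdeg
  have hG := hconn.covered hnoncompact
  have hκ : 0 < 1 / q := one_div_pos.2 (by linarith [hq.1])
  obtain ⟨f, g, hfg, hm, he, hf0, hmin⟩ := exists_line_minimizer 𝕜 hp
  obtain ⟨μ₀, hμ₀, H⟩ := MetricGraph.exists_energy_lt hv hp hq.1 hκ hfg hm he hf0
  refine ⟨μ₀, hμ₀, fun μ hμ => ?_⟩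
  obtain ⟨w, hw, hwm, hwe⟩ := H μ hμ
  obtain ⟨I, K, u, hI, hu, hmass, hkin, hen⟩ := hG.exists_minimizing (𝕜 := 𝕜) hp hq hκ.le ⟨w, hw, hwm⟩
  obtain ⟨φ, hφ, U, hU⟩ := hG.exists_isLimit hu (fun n => (hmass n).le) hkin
  have hen' : Tendsto (fun n => G.genEnergy p q (1 / q) ((u ∘ φ) n)) atTop (𝓝 I) :=
    hen.comp hφ.tendsto_atTop
  -- Vanishing of the limit would give `e * μ ^ s ≤ I`, whereas the competitor `w` gives `I < e * μ
  -- ^ s`.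
  have hU0 : 0 < G.mass U := by
    refine (G.mass_nonneg U).lt_of_ne' fun h0 => ?_
    have h1 := hG.le_of_isLimit_of_mass_eq_zero hp (by linarith [hq.1]) he.le hmin
      (fun n => hu (φ n)) (fun n => hmass (φ n)) (fun n => hkin (φ n)) hen' hU h0
    linarith [hI w hw hwm]
  obtain ⟨c, -, h1, h2, h3⟩ := hG.exists_minimizer_of_isLimit hp.1.le hq.1.le hκ.le hI
    (fun n => hu (φ n)) (fun n => hmass (φ n)) hen' hU hU0
  exact ⟨U.scale c, h1, h2, fun w' hw' hwm' => h3.trans (hI w' hw' hwm')⟩
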